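/- Conventions. Submanifolds are smooth, Hausdorff, second countable, without boundary, and may be immersed (embedded ones are a special case). Let $M^k\subset\mathbb R^{N}$ be a submanifold with a smooth $1$-form $\mu$. The pair $(M,\mu)$ is *twisted-austere with phase $e^{i\theta}$* if $N^*M+\mu=\{(x,\xi+\mu_x): x\in M,\ \xi\in N_x^*M\}\subset T^*\mathbb R^{N}=\mathbb C^{N}$ (with $z^j=x^j+iy^j$) is special Lagrangian with phase $e^{i\theta}$, i.e. $\sum_j dx^j\wedge dy^j$ and $\operatorname{Im}(e^{i\theta}dz^1\wedge\dots\wedge dz^{N})$ restrict to zero on it. Its cophase angle is $\phi=\theta-(N-k)\frac{\pi}{2}$. Below $N=n+1$ and $k=3$. Fix Euclidean coordinates $x^0,\dots,x^n$ on $\mathbb R^{n+1}$ (with any origin) and let $v$ be the unit vector in the $x^0$-direction. **Theorem 4.2.** (1) Let $M^3\subset\mathbb R^{n+1}$ be nonempty and nowhere totally geodesic (the second fundamental form does not vanish identically on any nonempty open subset of $M$), let $(M,\mu)$ be twisted-austere with phase $e^{i\theta}$, and let $M$ be ruled by (complete) parallel lines with direction $v$. Then $\cos\phi\neq0$, and there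 is a minimal surface $\Sigma\subset M$ in $\mathbb R^{n+1}$, everywhere transverse to $v$, such that $M$ is the union of the lines through $\Sigma$ parallel to $v$, each of these lines meeting $\Sigma$ once: the projection $\pi:M\to\Sigma$ along the rulings and $u=x^0|_M$ identify $M$ with $\Sigma\times\mathbb R$. Moreover $$\mu=\pi^*\lambda+\sec\phi\,d\big(u\,\pi^*k\big)-\tan\phi\,u\,du ,$$ where $k=x^0|_\Sigma$ and $\lambda$ is a smooth closed $1$-form on $\Sigma$ satisfying $$*d*\lambda=-|\nabla k|^2\tan\phi ,$$ that is, the codifferential $d^*\lambda=-{*d*}\lambda$ is $|\nabla k|^2\tan\phi$. Here the Hodge star and the norm are those of the induced metric on $\Sigma$, so that $*d*d\ell=\operatorname{div}\operatorname{grad}\ell$ for a function $\ell$. (2) Conversely, let $\cos\phi\ne0$, let $\Sigma\subset\mathbb R^{n+1}$ be a minimal surface everywhere transverse to $v$, let $k=x^0|_\Sigma$, and let $\lambda$ be a smooth closed $1$-form on $\Sigma$ with $*d*\lambda=-|\nabla k|^2\tan\phi$. Then the union $M\cong\Sigma\times\mathbb R$ of the lines through $\Sigma$ parallel to $v$ is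 a $3$-dimensional submanifold, and with $\mu$ given by the formula in (1), where $\pi:M\to\Sigma$ is the projection along the lines and $u=x^0|_M$, the pair $(M,\mu)$ is twisted-austere with phase $e^{i\theta}$. -/

import Mathlib

open scoped ContDiff InnerProductSpace

noncomputable section

/-- The model space `ℝᵏ` with its Euclidean norm. -/
abbrev Euc (k : ℕ) : Type := EuclideanSpace ℝ (Fin k)

/-- The `i`-th coordinate vector of `ℝᵏ`. -/
def coordVec {k : ℕ} (i : Fin k) : Euc k := EuclideanSpace.single i (1 : ℝ)

section Submanifolds

variable {X : Type*} [TopologicalSpace X] {V : Type*} [NormedAddCommGroup V] [NormedSpace ℝ V]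

/-- `ψ` (a homeomorphism from an open subset of `ℝᵏ` onto an open subset of `X`) is a local
parametrization for `F : X → V`: the composite `F ∘ ψ` is a smooth immersion. -/
structure IsLocalParam {k : ℕ} (F : X → V) (ψ : OpenPartialHomeomorph (Euc k) X) : Prop where
  smooth : ContDiffOn ℝ ∞ (F ∘ ψ) ψ.source
  immersive : ∀ w ∈ ψ.source, Function.Injective (fderiv ℝ (F ∘ ψ) w)

/-- `F : X → V` is an (immersed) smooth `k`-dimensional submanifold of `V`. The smooth structure
of `X` is the one induced by `F`: any two local parametrizations differ by a diffeomorphism. An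
embedded submanifold `M ⊆ V` is the case where `X` is the subspace `M` and `F` the inclusion. -/
structure IsSubmanifold (k : ℕ) (F : X → V) : Prop where
  hausdorff : T2Space X
  secondCountable : SecondCountableTopology X
  exists_param : ∀ x : X, ∃ ψ : OpenPartialHomeomorph (Euc k) X, IsLocalParam F ψ ∧ x ∈ ψ.target

/-- `a` belongs to the tangent space at `x` of the `k`-dimensional submanifold `F`, regarded as a
subspace of `V`. -/
def IsTangentVector (k : ℕ) (F : X → V) (x : X) (a : V) : Prop :=
  ∃ ψ : OpenPartialHomeomorph (Euc k) X, IsLocalParam F ψ ∧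
    ∃ w ∈ ψ.source, ψ w = x ∧ ∃ b : Euc k, fderiv ℝ (F ∘ ψ) w b = a

/-- A 1-form on a submanifold `F` is given by a covector `μ x` of the ambient space for each point
`x`, of which only the restriction to the tangent space at `x` matters. This is its expression
`ψ^* μ` in the local parametrization `ψ`. More generally, for a smooth map `F` into a submanifold
and covectors `μ x` along `F`, it is the expression of the pulled back form. -/
def localForm {k : ℕ} (F : X → V) (μ : X → (V →L[ℝ] ℝ)) (ψ : OpenPartialHomeomorph (Euc k) X)
    (w : Euc k) : Euc k →L[ℝ] ℝ :=
  (μ (ψ w)).comp (fderiv ℝ (F ∘ ψ) w)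

/-- `μ` is a smooth 1-form on the `k`-dimensional submanifold `F`. -/
def IsSmoothForm (k : ℕ) (F : X → V) (μ : X → (V →L[ℝ] ℝ)) : Prop :=
  ∀ ψ : OpenPartialHomeomorph (Euc k) X, IsLocalParam F ψ →
    ContDiffOn ℝ ∞ (localForm F μ ψ) ψ.source

/-- The 1-form `μ` on the `k`-dimensional submanifold `F` is closed. -/
def IsClosedForm (k : ℕ) (F : X → V) (μ : X → (V →L[ℝ] ℝ)) : Prop :=
  ∀ ψ : OpenPartialHomeomorph (Euc k) X, IsLocalParam F ψ → ∀ w ∈ ψ.source, ∀ a b : Euc k,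
    fderiv ℝ (localForm F μ ψ) w a b = fderiv ℝ (localForm F μ ψ) w b a

end Submanifolds

section SpecialLagrangian

variable {N : ℕ}

/-- The standard symplectic form `∑ⱼ dxʲ ∧ dyʲ` of `ℂᴺ`, `zʲ = xʲ + i yʲ`. -/
def symplecticForm (a b : EuclideanSpace ℂ (Fin N)) : ℝ :=
  ∑ j, ((a j).re * (b j).im - (a j).im * (b j).re)

/-- The holomorphic volume form `dz¹ ∧ ⋯ ∧ dzᴺ` of `ℂᴺ`. -/
def holVolume (a : Fin N → EuclideanSpace ℂ (Fin N)) : ℂ :=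
  Matrix.det (Matrix.of fun j i : Fin N => a i j)

/-- `Φ : L → ℂᴺ` is a special Lagrangian submanifold with phase `e^{iθ}`: it is an
`N`-dimensional submanifold to which the symplectic form and `Im (e^{iθ} dz¹ ∧ ⋯ ∧ dzᴺ)` restrict
to zero (equivalently, suitably oriented it is calibrated by `Re (e^{iθ} dz¹ ∧ ⋯ ∧ dzᴺ)`). -/
structure IsSpecialLagrangian {L : Type*} [TopologicalSpace L] (θ : ℝ)
    (Φ : L → EuclideanSpace ℂ (Fin N)) : Prop where
  submanifold : IsSubmanifold N Φ
  lagrangian : ∀ ψ : OpenPartialHomeomorph (Euc N) L, IsLocalParam Φ ψ → ∀ w ∈ ψ.source,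
    ∀ a b : Euc N, symplecticForm (fderiv ℝ (Φ ∘ ψ) w a) (fderiv ℝ (Φ ∘ ψ) w b) = 0
  special : ∀ ψ : OpenPartialHomeomorph (Euc N) L, IsLocalParam Φ ψ → ∀ w ∈ ψ.source,
    (Complex.exp (Complex.I * θ) *
      holVolume fun i : Fin N => fderiv ℝ (Φ ∘ ψ) w (coordVec i)).im = 0

variable {X : Type*} [TopologicalSpace X]

/-- The twisted conormal bundle `N^*M + μ` of the `k`-dimensional submanifold `M` given by
`F : X → ℝᴺ`: pairs of a point `x` and a covector at `F x` (given by its vector `η` of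
components) lying in `N_x^*M + μ_x`, that is, restricting to `μ_x` on the tangent space. -/
def twistedConormal (k : ℕ) (F : X → Euc N) (μ : X → (Euc N →L[ℝ] ℝ)) : Set (X × Euc N) :=
  {q | ∀ a : Euc N, IsTangentVector k F q.1 a → ⟪q.2, a⟫_ℝ = μ q.1 a}

/-- The map of the twisted conormal bundle to `T^*ℝᴺ = ℂᴺ`, `(x, η) ↦ F x + i η`. -/
def twistedConormalMap (k : ℕ) (F : X → Euc N) (μ : X → (Euc N →L[ℝ] ℝ))
    (q : twistedConormal k F μ) : EuclideanSpace ℂ (Fin N) :=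
  WithLp.toLp 2 fun j => ((F q.1.1 j : ℝ) : ℂ) + Complex.I * ((q.1.2 j : ℝ) : ℂ)

/-- `(M, μ)` is a twisted-austere pair with phase `e^{iθ}`, where `M` is the `k`-dimensional
submanifold given by `F : X → ℝᴺ`: the twisted conormal bundle is special Lagrangian. -/
structure IsTwistedAustere (k : ℕ) (θ : ℝ) (F : X → Euc N) (μ : X → (Euc N →L[ℝ] ℝ)) : Prop where
  submanifold : IsSubmanifold k F
  smooth : IsSmoothForm k F μ
  specialLagrangian : IsSpecialLagrangian θ (twistedConormalMap k F μ)

/-- The cophase angle `φ = θ - (N - k) π / 2` of a `k`-dimensional submanifold of `ℝᴺ`. -/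
def cophase (N k : ℕ) (θ : ℝ) : ℝ := θ - ((N : ℝ) - (k : ℝ)) * (Real.pi / 2)

end SpecialLagrangian

section Curvature

variable {k N : ℕ}

/-- The matrix `g_{ij}` of the metric induced by the local immersion `f`. -/
def metricMatrix (f : Euc k → Euc N) (w : Euc k) : Matrix (Fin k) (Fin k) ℝ :=
  Matrix.of fun i j => ⟪fderiv ℝ f w (coordVec i), fderiv ℝ f w (coordVec j)⟫_ℝ

/-- The second fundamental form of the local immersion `f`: the normal component of its second
derivative. -/
def secondFundForm (f : Euc k → Euc N) (w a b : Euc k) : Euc N :=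
  ((LinearMap.range (fderiv ℝ f w).toLinearMap)ᗮ).starProjection (fderiv ℝ (fderiv ℝ f) w a b)

/-- The mean curvature vector, the trace `∑ g^{ij} II(∂ᵢ, ∂ⱼ)` of the second fundamental form. -/
def meanCurvature (f : Euc k → Euc N) (w : Euc k) : Euc N :=
  ∑ i, ∑ j, (metricMatrix f w)⁻¹ i j • secondFundForm f w (coordVec i) (coordVec j)

variable {X : Type*} [TopologicalSpace X]

/-- The second fundamental form of the `k`-dimensional submanifold `F` is nonzero at `x`. -/
def SecondFundFormNeZeroAt (k : ℕ) (F : X → Euc N) (x : X) : Prop :=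
  ∃ ψ : OpenPartialHomeomorph (Euc k) X, IsLocalParam F ψ ∧
    ∃ w ∈ ψ.source, ψ w = x ∧ ∃ a b : Euc k, secondFundForm (F ∘ ψ) w a b ≠ 0

/-- `F` is a minimal `k`-dimensional submanifold of `ℝᴺ`. -/
structure IsMinimalSubmanifold (k : ℕ) (F : X → Euc N) : Prop where
  submanifold : IsSubmanifold k F
  minimal : ∀ ψ : OpenPartialHomeomorph (Euc k) X, IsLocalParam F ψ → ∀ w ∈ ψ.source,
    meanCurvature (F ∘ ψ) w = 0

/-- The squared norm `g^{ij} ∂ᵢh ∂ⱼh` of the gradient of a function `h`, in the metric induced by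
the local immersion `f`. -/
def gradNormSq (f : Euc k → Euc N) (h : Euc k → ℝ) (w : Euc k) : ℝ :=
  ∑ i, ∑ j, (metricMatrix f w)⁻¹ i j * fderiv ℝ h w (coordVec i) * fderiv ℝ h w (coordVec j)

end Curvature

section HodgeStar

variable {N : ℕ}

/-- The Hodge star of the 1-form `α` for the metric induced by the local immersion `f` of an open
subset of `ℝ²` (standard orientation): the components of
`*α = - √(det g) g^{1j} αⱼ dx⁰ + √(det g) g^{0j} αⱼ dx¹`. -/
def hodgeStar (f : Euc 2 → Euc N) (α : Euc 2 → (Euc 2 →L[ℝ] ℝ)) (w : Euc 2) : Fin 2 → ℝ :=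
  ![- (Real.sqrt (metricMatrix f w).det * ∑ j, (metricMatrix f w)⁻¹ 1 j * α w (coordVec j)),
    Real.sqrt (metricMatrix f w).det * ∑ j, (metricMatrix f w)⁻¹ 0 j * α w (coordVec j)]

/-- The function `* d * α` for the metric induced by the local immersion `f` of an open subset of
`ℝ²`, where `*(h dx⁰ ∧ dx¹) = h / √(det g)`. It does not depend on the orientation, and
`* d * dℓ` is the Laplacian `div grad ℓ`. -/
def starDStar (f : Euc 2 → Euc N) (α : Euc 2 → (Euc 2 →L[ℝ] ℝ)) (w : Euc 2) : ℝ :=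
  (fderiv ℝ (fun z => hodgeStar f α z 1) w (coordVec 0) -
    fderiv ℝ (fun z => hodgeStar f α z 0) w (coordVec 1)) / Real.sqrt (metricMatrix f w).det

end HodgeStar

section Cylinders

variable {N : ℕ} {X : Type*} [TopologicalSpace X] {Y : Type*} [TopologicalSpace Y]

/-- The Euclidean coordinate `x⁰` in the direction of the unit vector `v`, with origin `o`. -/
def height (v o p : Euc N) : ℝ := ⟪v, p - o⟫_ℝ

/-- The submanifold `F` is ruled by lines parallel to `v`: it contains, through each of its points,
the whole line with direction `v`. -/
def IsRuledByLines (v : Euc N) (F : X → Euc N) : Prop :=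
  ∀ x : X, ∃ c : ℝ → X, Continuous c ∧ c 0 = x ∧ ∀ t : ℝ, F (c t) = F x + t • v

/-- The surface `Σ` given by `G` is everywhere transverse to the unit vector `v`, and `F` is the
union of the lines through `Σ` parallel to `v`, with projection `p` along these lines: `p` and the
coordinate `x⁰ ∘ F` identify `X` with `Σ × ℝ`, and each point `F x` lies on the line through
`G (p x)` parallel to `v`. -/
structure IsLineUnion (v o : Euc N) (F : X → Euc N) (G : Y → Euc N) (p : X → Y) : Prop where
  transverse : ∀ y : Y, ¬ IsTangentVector 2 G y v
  homeomorph : IsHomeomorph fun x : X => (p x, height v o (F x))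
  on_line : ∀ x : X, ∃ s : ℝ, F x = G (p x) + s • v

/-- `lam` is a smooth closed 1-form on the surface `G` with `* d * lam = - |∇k|² tan φ`, where `k`
is the restriction of the coordinate `x⁰`. -/
structure IsAdmissibleForm (φ : ℝ) (v o : Euc N) (G : Y → Euc N) (lam : Y → (Euc N →L[ℝ] ℝ)) :
    Prop where
  smooth : IsSmoothForm 2 G lam
  closed : IsClosedForm 2 G lam
  codiff : ∀ ψ : OpenPartialHomeomorph (Euc 2) Y, IsLocalParam G ψ → ∀ w ∈ ψ.source,
    starDStar (G ∘ ψ) (localForm G lam ψ) w =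
      - (gradNormSq (G ∘ ψ) (fun z => height v o (G (ψ z))) w * Real.tan φ)

/-- The equation `μ = p^* lam + sec φ d(u p^* k) - tan φ u du` of 1-forms on the 3-dimensional
submanifold `F`, where `u` and `k` are the restrictions of the coordinate `x⁰` to `F` and `G`. -/
def IsCylinderForm (φ : ℝ) (v o : Euc N) (F : X → Euc N) (G : Y → Euc N) (p : X → Y)
    (lam : Y → (Euc N →L[ℝ] ℝ)) (μ : X → (Euc N →L[ℝ] ℝ)) : Prop :=
  ∀ ψ : OpenPartialHomeomorph (Euc 3) X, IsLocalParam F ψ → ∀ w ∈ ψ.source,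
    localForm F μ ψ w =
      localForm (G ∘ p) (lam ∘ p) ψ w
      + (1 / Real.cos φ) •
          fderiv ℝ (fun z => height v o (F (ψ z)) * height v o (G (p (ψ z)))) w
      - (Real.tan φ * height v o (F (ψ w))) • fderiv ℝ (fun z => height v o (F (ψ z))) w

end Cylinders

end

/-! Let `f` be a local immersion with metric g, let α be the 1-form in these parameters, and let η
be a covector inducing α. Put h(a, b) = ∂ₐα(b) - ⟪η, ∂ₐ∂_b f⟫ (`twistForm`). Differentiating ⟪η,
df(a)⟫ = α(a) shows that a tangent vector of the twisted conormal bundle with base part W and fibre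
part E satisfies ⟪E, df(a)⟫ = h(W, a). So the bundle is Lagrangian iff every h is symmetric, that
is, α is closed. The phase condition becomes Im (e^{iφ} det (g + i h)) = 0 for every such η: each
normal direction contributes a factor i, and the cophase absorbs these factors. This is
`TwistedAustereAt`; both directions of the equivalence are proved.

For a cylinder carrying the form of the theorem, the ruling entry of g + i h is 1 - i tan φ.
Eliminating it leaves g_Σ + i (h_Σ + tan φ dk ⊗ dk) on the surface, because sec² φ = 1 + tan² φ. The
imaginary part of this 2 × 2 determinant is det g_Σ times a trace, and the trace of h_Σ is `*d*λ -
⟪η', H⟫`, with H the mean curvature (`trace_twistForm`). As η' runs over all covectors inducing λ,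
the condition splits into H = 0 and `*d*λ = -|∇k|² tan φ` (`twistedAustereAt_cylinder_iff`). This
gives the converse, and in the direct part it gives minimality of Σ and the equation for λ.

It remains to find Σ and the shape of μ on a ruled M. Where the second fundamental form is nonzero,
moving η along a normal vector gives a pencil g + i (h - s A) with A killing the ruling direction;
`phase_rigidity` then forces cos φ ∂_v μ(v) + sin φ = 0. By density and continuity this holds
everywhere. Hence cos φ ≠ 0, and cos φ μ(v) + sin φ x⁰ is constant along rulings. Σ is the set where
this function equals x⁰, a transverse section meeting each ruling once (`exists_section`). With this
choice μ(v) = sec φ k - tan φ u, and closedness of μ integrates along the rulings to the full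
formula (`localForm_cylParam`). -/

/-! ### Local parametrizations, smooth local inverses and graphs. -/

section LocalParametrizations

variable {X : Type*} [TopologicalSpace X] {V : Type*} [NormedAddCommGroup V] [NormedSpace ℝ V]
  {k : ℕ} {F : X → V} {ψ ψ' : OpenPartialHomeomorph (Euc k) X}

theorem IsLocalParam.contDiffAt (h : IsLocalParam F ψ) {w : Euc k} (hw : w ∈ ψ.source) :
    ContDiffAt ℝ ∞ (F ∘ ψ) w :=
  h.smooth.contDiffAt (ψ.open_source.mem_nhds hw)

theorem IsLocalParam.differentiableAt (h : IsLocalParam F ψ) {w : Euc k} (hw : w ∈ ψ.source) :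
    DifferentiableAt ℝ (F ∘ ψ) w :=
  (h.contDiffAt hw).differentiableAt (by simp)

theorem IsLocalParam.continuousOn_fderiv (h : IsLocalParam F ψ) :
    ContinuousOn (fderiv ℝ (F ∘ ψ)) ψ.source :=
  h.smooth.continuousOn_fderiv_of_isOpen ψ.open_source (by simp)

theorem IsLocalParam.contDiffAt_fderiv (h : IsLocalParam F ψ) {w : Euc k} (hw : w ∈ ψ.source) :
    ContDiffAt ℝ ∞ (fderiv ℝ (F ∘ ψ)) w :=
  (h.contDiffAt hw).fderiv_right (by simp)

theorem ContinuousLinearMap.exists_comp_eq_id_of_injective {E : Type*} [NormedAddCommGroup E]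
    [NormedSpace ℝ E] [FiniteDimensional ℝ V] (A : E →L[ℝ] V)
    (hA : Function.Injective A) : ∃ L : V →L[ℝ] E, ∀ a, L (A a) = a := by
  obtain ⟨g, hg⟩ := LinearMap.exists_leftInverse_of_injective (A : E →ₗ[ℝ] V)
    (LinearMap.ker_eq_bot.2 hA)
  exact ⟨LinearMap.toContinuousLinearMap g, fun a => congrArg (fun T => T a) hg⟩

theorem ContinuousLinearMap.exists_equiv_of_injective (A : Euc k →L[ℝ] Euc k)
    (hA : Function.Injective A) : ∃ e : Euc k ≃L[ℝ] Euc k, (e : Euc k →L[ℝ] Euc k) = A := by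
  refine ⟨(LinearEquiv.ofInjectiveEndo (A : Euc k →ₗ[ℝ] Euc k) hA).toContinuousLinearEquiv, ?_⟩
  ext1 x
  simp

/-- After composition with a linear map that is injective on the tangent space, a local
parametrization has a smooth local inverse. -/
theorem IsLocalParam.exists_localInverse (h : IsLocalParam F ψ) {w₀ : Euc k}
    (hw₀ : w₀ ∈ ψ.source) (L : V →L[ℝ] Euc k)
    (hL : Function.Injective fun a => L (fderiv ℝ (F ∘ ψ) w₀ a)) :
    ∃ e : OpenPartialHomeomorph (Euc k) (Euc k), w₀ ∈ e.source ∧ e.source ⊆ ψ.source ∧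
      (∀ w, e w = L (F (ψ w))) ∧ ∀ z ∈ e.target, ContDiffAt ℝ ∞ e.symm z := by
  have hd : ∀ w ∈ ψ.source, HasFDerivAt (fun w => L (F (ψ w))) (L.comp (fderiv ℝ (F ∘ ψ) w)) w :=
    fun w hw => L.hasFDerivAt.comp w (h.differentiableAt hw).hasFDerivAt
  have hs : ∀ w ∈ ψ.source, ContDiffAt ℝ ∞ (fun w => L (F (ψ w))) w := fun w hw =>
    L.contDiff.contDiffAt.comp w (h.contDiffAt hw)
  obtain ⟨A, hA⟩ := (L.comp (fderiv ℝ (F ∘ ψ) w₀)).exists_equiv_of_injective hL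
  have hd₀ : HasFDerivAt (fun w => L (F (ψ w))) (A : Euc k →L[ℝ] Euc k) w₀ := hA ▸ hd w₀ hw₀
  -- Restricting to the open set where the composed differential is invertible makes the inverse
  -- smooth on its whole domain, not only at the image of `w₀`.
  set s : Set (Euc k) := ψ.source ∩ (fun w => L.comp (fderiv ℝ (F ∘ ψ) w)) ⁻¹'
    {T : Euc k →L[ℝ] Euc k | IsUnit T} with hsdef
  have hso : IsOpen s := by
    refine ContinuousOn.isOpen_inter_preimage ?_ ψ.open_source Units.isOpen
    exact (ContinuousLinearMap.compL ℝ (Euc k) V (Euc k) L).continuous.comp_continuousOn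
      h.continuousOn_fderiv
  have hu : ∀ w ∈ s, ∃ B : Euc k ≃L[ℝ] Euc k, (B : Euc k →L[ℝ] Euc k) =
      L.comp (fderiv ℝ (F ∘ ψ) w) := by
    rintro w ⟨-, u, hu⟩
    exact ⟨ContinuousLinearEquiv.ofUnit u, hu⟩
  let e := ((hs w₀ hw₀).toOpenPartialHomeomorph _ hd₀ (by simp)).restrOpen s hso
  have he : ∀ w, e w = L (F (ψ w)) := fun w => rfl
  refine ⟨e, ⟨(hs w₀ hw₀).mem_toOpenPartialHomeomorph_source hd₀ (by simp), hw₀, ?_⟩,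
    fun w hw => hw.2.1, he, fun z hz => ?_⟩
  · rw [Set.mem_preimage, ← hA]
    exact ⟨(ContinuousLinearEquiv.unitsEquiv ℝ (Euc k)).symm A, rfl⟩
  · have hz' : e.symm z ∈ s := (e.map_target hz).2
    obtain ⟨B, hB⟩ := hu _ hz'
    exact e.contDiffAt_symm hz (hB ▸ hd _ hz'.1) (hs _ hz'.1)

/-- Differentiate `L ∘ F ∘ χ = id`. In a graph parametrization the fixed map `L` inverts every
differential, which yields injectivity and identifies tangent directions. -/
theorem graphParam_fderiv {χ : OpenPartialHomeomorph (Euc k) X} (L : V →L[ℝ] Euc k)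
    (hL : ∀ w ∈ χ.source, L (F (χ w)) = w) {w : Euc k} (hw : w ∈ χ.source)
    (hd : DifferentiableAt ℝ (F ∘ χ) w) (a : Euc k) : L (fderiv ℝ (F ∘ χ) w a) = a := by
  have h1 : (fun z => L ((F ∘ χ) z)) =ᶠ[nhds w] id := by
    filter_upwards [χ.open_source.mem_nhds hw] with z hz using hL z hz
  have h2 := L.hasFDerivAt.comp w hd.hasFDerivAt
  exact congrArg (fun T : Euc k →L[ℝ] Euc k => T a)
    (h2.unique (h1.hasFDerivAt_iff.2 (hasFDerivAt_id w)))

/-- The expression of a pulled back form under a change of parameters. -/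
theorem localForm_comp {W : Type*} [NormedAddCommGroup W] [NormedSpace ℝ W]
    {Y : Type*} [TopologicalSpace Y] {m : ℕ} (G : Y → W) (lam : Y → (W →L[ℝ] ℝ))
    (χ : OpenPartialHomeomorph (Euc m) Y) (p : X → Y) (ψ : OpenPartialHomeomorph (Euc k) X)
    {σ : Euc k → Euc m} {w : Euc k} (hσ : (fun z => p (ψ z)) =ᶠ[nhds w] fun z => χ (σ z))
    (hd : DifferentiableAt ℝ σ w) (hG : DifferentiableAt ℝ (G ∘ χ) (σ w)) :
    localForm (G ∘ p) (lam ∘ p) ψ w = (localForm G lam χ (σ w)).comp (fderiv ℝ σ w) := by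
  have h1 : (G ∘ p) ∘ ψ =ᶠ[nhds w] (G ∘ χ) ∘ σ := hσ.fun_comp G
  have h2 : p (ψ w) = χ (σ w) := hσ.self_of_nhds
  simp only [localForm, Function.comp_apply, h1.fderiv_eq, h2, fderiv_comp w hG hd]
  rfl

/-- Every point of a submanifold has a local parametrization as a graph over a given linear
projection that is injective on the tangent space. -/
theorem IsLocalParam.exists_graphParam (h : IsLocalParam F ψ) {w₀ : Euc k}
    (hw₀ : w₀ ∈ ψ.source) (L : V →L[ℝ] Euc k)
    (hL : Function.Injective fun a => L (fderiv ℝ (F ∘ ψ) w₀ a)) :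
    ∃ χ : OpenPartialHomeomorph (Euc k) X, IsLocalParam F χ ∧ ψ w₀ ∈ χ.target ∧
      ∀ w ∈ χ.source, L (F (χ w)) = w := by
  obtain ⟨e, he₀, hes, he, hse⟩ := h.exists_localInverse hw₀ L hL
  have hLw : ∀ w ∈ (e.symm.trans ψ).source, L (F ((e.symm.trans ψ) w)) = w := by
    intro w hw
    have hw1 : w ∈ e.target := hw.1
    have := e.right_inv hw1
    rwa [he] at this
  have hsm : ∀ w ∈ (e.symm.trans ψ).source, ContDiffAt ℝ ∞ (F ∘ (e.symm.trans ψ)) w := by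
    intro w hw
    have hw1 : w ∈ e.target := hw.1
    exact (h.contDiffAt (hes (e.map_target hw1))).comp w (hse w hw1)
  refine ⟨e.symm.trans ψ, ⟨fun w hw => (hsm w hw).contDiffWithinAt, fun w hw => ?_⟩, ?_, hLw⟩
  · have h4 := graphParam_fderiv L hLw hw ((hsm w hw).differentiableAt (by simp))
    intro a b hab
    rw [← h4 a, ← h4 b, hab]
  · have : ψ w₀ = (e.symm.trans ψ) (e w₀) := by simp [e.left_inv he₀]
    rw [this]
    apply OpenPartialHomeomorph.map_source
    simp [e.map_source he₀, e.left_inv he₀, hw₀]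

variable [FiniteDimensional ℝ V]

/-- A continuous map to a submanifold is smooth if its composite with the immersion is. -/
theorem IsLocalParam.contDiffAt_symm_comp (h : IsLocalParam F ψ) {E : Type*}
    [NormedAddCommGroup E] [NormedSpace ℝ E] {c : E → X} {z₀ : E} (hc : ContinuousAt c z₀)
    (hz₀ : c z₀ ∈ ψ.target) (hF : ContDiffAt ℝ ∞ (F ∘ c) z₀) :
    ContDiffAt ℝ ∞ (fun z => ψ.symm (c z)) z₀ := by
  have hw₀ : ψ.symm (c z₀) ∈ ψ.source := ψ.map_target hz₀
  obtain ⟨L, hL⟩ := (fderiv ℝ (F ∘ ψ) (ψ.symm (c z₀))).exists_comp_eq_id_of_injective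
    (h.immersive _ hw₀)
  obtain ⟨e, he₀, -, he, hes⟩ := h.exists_localInverse hw₀ L (fun a b hab => by simpa [hL] using hab)
  have hcont : ContinuousAt (fun z => ψ.symm (c z)) z₀ :=
    (ψ.continuousAt_symm hz₀).comp hc
  have h1 : ∀ᶠ z in nhds z₀, ψ.symm (c z) ∈ e.source :=
    hcont.eventually (e.open_source.mem_nhds he₀)
  have h2 : ∀ᶠ z in nhds z₀, c z ∈ ψ.target := hc.eventually (ψ.open_target.mem_nhds hz₀)
  -- Near `z₀` the unknown map `ψ.symm ∘ c` is the smooth inverse `e.symm` applied to `L ∘ F ∘ c`.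
  have h3 : (fun z => ψ.symm (c z)) =ᶠ[nhds z₀] fun z => e.symm (L (F (c z))) := by
    filter_upwards [h1, h2] with z hz1 hz2
    rw [← e.left_inv hz1, he, ψ.right_inv hz2]
  refine ContDiffAt.congr_of_eventuallyEq ?_ h3
  have h4 : L (F (c z₀)) ∈ e.target := by
    have := e.map_source he₀
    rwa [he, ψ.right_inv hz₀] at this
  exact (hes _ h4).comp z₀ (L.contDiff.contDiffAt.comp z₀ hF)

theorem IsLocalParam.contDiffAt_transition (h : IsLocalParam F ψ) (h' : IsLocalParam F ψ')
    {w : Euc k} (hw : w ∈ ψ.source) (hw' : ψ w ∈ ψ'.target) :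
    ContDiffAt ℝ ∞ (fun z => ψ'.symm (ψ z)) w :=
  h'.contDiffAt_symm_comp (ψ.continuousAt hw) hw' (h.contDiffAt hw)

theorem OpenPartialHomeomorph.eventually_symm_comp {E : Type*} [TopologicalSpace E]
    (ψ : OpenPartialHomeomorph (Euc k) X) {c : E → X} {z₀ : E} (hc : ContinuousAt c z₀)
    (hz₀ : c z₀ ∈ ψ.target) : c =ᶠ[nhds z₀] fun z => ψ (ψ.symm (c z)) := by
  filter_upwards [hc.eventually (ψ.open_target.mem_nhds hz₀)] with z hz
  rw [ψ.right_inv hz]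

theorem IsLocalParam.fderiv_comp (h : IsLocalParam F ψ) {E : Type*}
    [NormedAddCommGroup E] [NormedSpace ℝ E] {c : E → X} {z₀ : E} (hc : ContinuousAt c z₀)
    (hz₀ : c z₀ ∈ ψ.target) (hF : ContDiffAt ℝ ∞ (F ∘ c) z₀) :
    fderiv ℝ (F ∘ c) z₀ = (fderiv ℝ (F ∘ ψ) (ψ.symm (c z₀))).comp
      (fderiv ℝ (fun z => ψ.symm (c z)) z₀) := by
  have h1 : F ∘ c =ᶠ[nhds z₀] (F ∘ ψ) ∘ fun z => ψ.symm (c z) :=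
    (ψ.eventually_symm_comp hc hz₀).fun_comp F
  rw [h1.fderiv_eq]
  exact _root_.fderiv_comp z₀ (h.differentiableAt (ψ.map_target hz₀))
    ((h.contDiffAt_symm_comp hc hz₀ hF).differentiableAt (by simp))

/-- Transition maps are differentiable, so the chain rule places the tangent vectors of any
parametrization in the image of the differential of any other. -/
theorem IsLocalParam.isTangentVector_iff (h : IsLocalParam F ψ) {w : Euc k} (hw : w ∈ ψ.source)
    {a : V} : IsTangentVector k F (ψ w) a ↔ ∃ b, fderiv ℝ (F ∘ ψ) w b = a := by
  refine ⟨?_, fun hb => ⟨ψ, h, w, hw, rfl, hb⟩⟩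
  rintro ⟨ψ', h', w', hw', hww, b, rfl⟩
  have hz : ψ' w' ∈ ψ.target := hww ▸ ψ.map_source hw
  rw [h.fderiv_comp (ψ'.continuousAt hw') hz (h'.contDiffAt hw'), hww, ψ.left_inv hw]
  exact ⟨_, rfl⟩

end LocalParametrizations

/-! ### Linear algebra of tangent frames of the conormal bundle. -/

section LagrangianLinearAlgebra

variable {k N : ℕ} (A : Euc k →L[ℝ] Euc N) (W : Euc N →L[ℝ] Euc k) (E : Euc N →L[ℝ] Euc N)
  (h : Euc k →L[ℝ] Euc k →L[ℝ] ℝ)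

theorem Euc.sum_smul_coordVec (b : Euc k) : b = ∑ i, b i • coordVec i := by
  ext j
  simp [coordVec, Finset.sum_apply, Pi.single_apply]

theorem inner_eq_sum (a b : Euc N) : ⟪a, b⟫_ℝ = ∑ i, a i * b i := by
  simp [PiLp.inner_apply, mul_comm]

theorem finrank_range_add_finrank_orthogonal (hA : Function.Injective A) :
    k + Module.finrank ℝ (LinearMap.range (A : Euc k →ₗ[ℝ] Euc N))ᗮ = N := by
  have h1 := Submodule.finrank_add_finrank_orthogonal (LinearMap.range (A : Euc k →ₗ[ℝ] Euc N))
  rw [LinearMap.finrank_range_of_inj (by exact hA)] at h1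
  simpa using h1

variable {A W E h}

theorem eq_zero_of_inner_range_eq_zero {m : ℕ}
    (ν : OrthonormalBasis (Fin m) ℝ ((LinearMap.range (A : Euc k →ₗ[ℝ] Euc N))ᗮ))
    {x : Euc N} (h1 : ∀ a, ⟪A a, x⟫_ℝ = 0) (h2 : ∀ i, ⟪(ν i : Euc N), x⟫_ℝ = 0) : x = 0 := by
  have hx : x ∈ (LinearMap.range (A : Euc k →ₗ[ℝ] Euc N))ᗮ := by
    rw [Submodule.mem_orthogonal]
    rintro _ ⟨a, rfl⟩
    exact h1 a
  have h3 : (⟨x, hx⟩ : ((LinearMap.range (A : Euc k →ₗ[ℝ] Euc N))ᗮ : Submodule ℝ _)) = 0 := by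
    apply ν.repr.injective
    ext i
    simpa [ν.repr_apply_apply] using h2 i
  exact congrArg Subtype.val h3

/-- Along a tangent frame of the conormal bundle the differential of the base point is onto. -/
theorem surjective_base (hA : Function.Injective A) (hE : ∀ c a, ⟪E c, A a⟫_ℝ = h (W c) a)
    (hinj : ∀ c, W c = 0 → E c = 0 → c = 0) : Function.Surjective W := by
  have hm := finrank_range_add_finrank_orthogonal A hA
  set K := (LinearMap.range (A : Euc k →ₗ[ℝ] Euc N))ᗮ with hK
  let ν := stdOrthonormalBasis ℝ K
  -- If `W c` and the normal part of `E c` vanish, then `hE` kills the tangential part of `E c` as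
  -- well. So this map is injective, and equality of dimensions makes it onto.
  let T : Euc N →ₗ[ℝ] Euc k × K :=
    LinearMap.prod (W : Euc N →ₗ[ℝ] Euc k)
      ((K.orthogonalProjectionOnto : Euc N →ₗ[ℝ] K) ∘ₗ (E : Euc N →ₗ[ℝ] Euc N))
  have hT : Function.Injective T := by
    rw [← LinearMap.ker_eq_bot, LinearMap.ker_eq_bot']
    intro c hc
    have h1 : W c = 0 := congrArg Prod.fst hc
    have h2 : K.orthogonalProjectionOnto (E c) = 0 := congrArg Prod.snd hc
    refine hinj c h1 (eq_zero_of_inner_range_eq_zero ν (fun a => ?_) fun i => ?_)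
    · rw [real_inner_comm, hE, h1]; simp
    · rw [← Submodule.inner_orthogonalProjectionOnto_eq_of_mem_left, h2]; simp
  have hfr : Module.finrank ℝ (Euc N) = Module.finrank ℝ (Euc k × K) := by
    simp [Module.finrank_prod, hm]
  have hs := (LinearMap.injective_iff_surjective_of_finrank_eq_finrank hfr).1 hT
  intro b
  obtain ⟨c, hc⟩ := hs (b, 0)
  exact ⟨c, congrArg Prod.fst hc⟩

/-- The value of the holomorphic volume form on a tangent frame of the twisted conormal bundle, up
to real factors. -/
theorem exists_holVolume_eq (hA : Function.Injective A)
    (hE : ∀ c a, ⟪E c, A a⟫_ℝ = h (W c) a) (T : Fin N → EuclideanSpace ℂ (Fin N))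
    (hT : ∀ i j, T i j = ((A (W (coordVec i)) j : ℝ) : ℂ) +
      Complex.I * ((E (coordVec i) j : ℝ) : ℂ)) :
    ∃ (m : ℕ) (p r : ℝ), k + m = N ∧ p ≠ 0 ∧
      (p : ℂ) * holVolume T = Complex.I ^ m * Matrix.det (Matrix.of fun i j : Fin k =>
        (⟪A (coordVec i), A (coordVec j)⟫_ℝ : ℂ) + Complex.I * (h (coordVec j) (coordVec i) : ℂ))
        * r ∧
      ((∀ c, W c = 0 → E c = 0 → c = 0) → r ≠ 0) := by
  have hm := finrank_range_add_finrank_orthogonal A hA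
  set K := (LinearMap.range (A : Euc k →ₗ[ℝ] Euc N))ᗮ with hK
  let ν := stdOrthonormalBasis ℝ K
  set m := Module.finrank ℝ K with hmdef
  have hνA : ∀ i a, ⟪(ν i : Euc N), A a⟫_ℝ = 0 := fun i a => by
    rw [real_inner_comm]
    exact (Submodule.mem_orthogonal _ _).1 (ν i).2 _ ⟨a, rfl⟩
  let e : Fin k ⊕ Fin m ≃ Fin N := finSumFinEquiv.trans (finCongr hm)
  let P : Matrix (Fin k ⊕ Fin m) (Fin N) ℝ :=
    Matrix.of (Sum.elim (fun i j => A (coordVec i) j) (fun a j => (ν a : Euc N) j))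
  let R : Matrix (Fin k ⊕ Fin m) (Fin N) ℝ :=
    Matrix.of (Sum.elim (fun i c => W (coordVec c) i) (fun a c => ⟪(ν a : Euc N), E (coordVec c)⟫_ℝ))
  let M : Matrix (Fin k) (Fin k) ℂ := Matrix.of fun i j : Fin k =>
    (⟪A (coordVec i), A (coordVec j)⟫_ℝ : ℂ) + Complex.I * (h (coordVec j) (coordVec i) : ℂ)
  let D : Matrix (Fin k ⊕ Fin m) (Fin k ⊕ Fin m) ℂ :=
    Matrix.fromBlocks M 0 0 (Complex.I • (1 : Matrix (Fin m) (Fin m) ℂ))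
  let Q : Matrix (Fin N) (Fin N) ℂ := Matrix.of fun j i : Fin N => T i j
  have hprod : ∀ (x : Euc N) (c : Fin N), ∑ j, ((x j : ℝ) : ℂ) * T c j =
      (⟪x, A (W (coordVec c))⟫_ℝ : ℂ) + Complex.I * (⟪x, E (coordVec c)⟫_ℝ : ℂ) := by
    intro x c
    rw [inner_eq_sum, inner_eq_sum]
    push_cast
    rw [Finset.mul_sum, ← Finset.sum_add_distrib]
    exact Finset.sum_congr rfl fun j _ => by rw [hT]; ring
  -- Pairing the frame with the tangent rows `A eᵢ` gives (g + i h) W. With the orthonormal normal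
  -- rows it gives i ⟪ν, E⟫, since `A W` is tangent. Determinants then produce the factor i^m.
  have key : P.map (fun x : ℝ => (x : ℂ)) * Q = D * R.map (fun x : ℝ => (x : ℂ)) := by
    ext i c
    rw [Matrix.mul_apply, Matrix.mul_apply, Fintype.sum_sum_type]
    rcases i with i | a
    · have h1 := hprod (A (coordVec i)) c
      have h2 : ∀ c, W (coordVec c) = ∑ j, W (coordVec c) j • coordVec j := fun c =>
        Euc.sum_smul_coordVec _
      have h3 : ⟪A (coordVec i), A (W (coordVec c))⟫_ℝ =
          ∑ j, W (coordVec c) j * ⟪A (coordVec i), A (coordVec j)⟫_ℝ := by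
        conv_lhs => rw [h2 c, map_sum, inner_sum]
        simp [inner_smul_right]
      have h4 : ⟪A (coordVec i), E (coordVec c)⟫_ℝ =
          ∑ j, W (coordVec c) j * h (coordVec j) (coordVec i) := by
        rw [real_inner_comm, hE]
        conv_lhs => rw [h2 c, map_sum, sum_apply]
        simp
      simp only [P, Q, D, R, Matrix.map_apply, Matrix.of_apply, Sum.elim_inl, Sum.elim_inr,
        Matrix.fromBlocks_apply₁₁, Matrix.fromBlocks_apply₁₂, Matrix.zero_apply, zero_mul,
        Finset.sum_const_zero, add_zero]
      rw [h1, h3, h4]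
      push_cast
      rw [Finset.mul_sum, ← Finset.sum_add_distrib]
      exact Finset.sum_congr rfl fun j _ => by simp only [M, Matrix.of_apply]; ring
    · have h1 := hprod (ν a) c
      simp only [P, Q, D, R, Matrix.map_apply, Matrix.of_apply, Sum.elim_inl, Sum.elim_inr,
        Matrix.fromBlocks_apply₂₁, Matrix.fromBlocks_apply₂₂, Matrix.zero_apply, zero_mul,
        Finset.sum_const_zero, zero_add]
      rw [h1, hνA]
      simp [Matrix.one_apply, Matrix.smul_apply]
  refine ⟨m, (P.submatrix e.symm id).det, (R.submatrix e.symm id).det, hm, ?_, ?_, ?_⟩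
  · intro h0
    obtain ⟨v, hv, hv0⟩ := Matrix.exists_mulVec_eq_zero_iff.2 h0
    apply hv
    have hi : ∀ i, ∑ j, P i j * v j = 0 := fun i => by
      have := congrFun hv0 (e i)
      simpa [Matrix.mulVec, dotProduct] using this
    have : (WithLp.toLp 2 v : Euc N) = 0 := by
      refine eq_zero_of_inner_range_eq_zero ν (fun a => ?_) fun i => ?_
      · rw [Euc.sum_smul_coordVec a, map_sum, sum_inner]
        refine Finset.sum_eq_zero fun i _ => ?_
        rw [map_smul, real_inner_smul_left, inner_eq_sum]
        simpa [P] using Or.inr (hi (Sum.inl i))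
      · rw [inner_eq_sum]
        simpa [P] using hi (Sum.inr i)
    funext j
    exact congrArg (fun x : Euc N => x j) this
  · have h1 : (P.map (fun x : ℝ => (x : ℂ))).submatrix e.symm (Equiv.refl _) * Q =
        D.submatrix e.symm e.symm * (R.map (fun x : ℝ => (x : ℂ))).submatrix e.symm (Equiv.refl _) := by
      rw [Matrix.submatrix_mul_equiv, ← key, ← Matrix.submatrix_mul_equiv _ _ _ (Equiv.refl _)]
      rfl
    have h2 := congrArg Matrix.det h1
    have hdet : ∀ B : Matrix (Fin N) (Fin N) ℝ, (B.map (fun x : ℝ => (x : ℂ))).det = (B.det : ℂ) :=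
      fun B => (RingHom.map_det Complex.ofRealHom B).symm
    rw [Matrix.det_mul, Matrix.det_mul, Matrix.det_submatrix_equiv_self] at h2
    simp only [D, Matrix.det_fromBlocks_zero₁₂, Matrix.det_smul, Matrix.det_one, Fintype.card_fin,
      mul_one] at h2
    rw [← hdet, ← hdet]
    rw [mul_comm (Complex.I ^ m)]
    exact h2
  · intro hinj h0
    obtain ⟨v, hv, hv0⟩ := Matrix.exists_mulVec_eq_zero_iff.2 h0
    apply hv
    have hi : ∀ i, ∑ j, R i j * v j = 0 := fun i => by
      have := congrFun hv0 (e i)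
      simpa [Matrix.mulVec, dotProduct] using this
    have hx : (WithLp.toLp 2 v : Euc N) = ∑ c, v c • coordVec c := Euc.sum_smul_coordVec _
    have hW : W (WithLp.toLp 2 v) = 0 := by
      rw [hx, map_sum]
      ext i
      have := hi (Sum.inl i)
      simp only [R, Matrix.of_apply, Sum.elim_inl] at this
      simp only [map_smul, WithLp.ofLp_sum, Finset.sum_apply, PiLp.smul_apply, smul_eq_mul,
        PiLp.zero_apply]
      rw [← this]
      exact Finset.sum_congr rfl fun j _ => mul_comm _ _
    have : (WithLp.toLp 2 v : Euc N) = 0 := by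
      refine hinj _ hW (eq_zero_of_inner_range_eq_zero ν (fun a => ?_) fun i => ?_)
      · rw [real_inner_comm, hE, hW]; simp
      · rw [hx, map_sum, inner_sum]
        have := hi (Sum.inr i)
        simp only [R, Matrix.of_apply, Sum.elim_inr] at this
        rw [← this]
        exact Finset.sum_congr rfl fun j _ => by rw [map_smul, inner_smul_right, mul_comm]
    funext j
    exact congrArg (fun x : Euc N => x j) this

end LagrangianLinearAlgebra

/-! ### The pointwise form of the twisted-austere condition. -/

section TwistedConormal

variable {k N : ℕ}

/-- The real part of a vector of `ℂᴺ`. -/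
noncomputable def rePart (N : ℕ) : EuclideanSpace ℂ (Fin N) →L[ℝ] Euc N :=
  LinearMap.toContinuousLinearMap
    { toFun := fun z => WithLp.toLp 2 fun j => (z j).re
      map_add' := fun a b => by ext j; simp
      map_smul' := fun c a => by ext j; simp }

/-- The imaginary part of a vector of `ℂᴺ`. -/
noncomputable def imPart (N : ℕ) : EuclideanSpace ℂ (Fin N) →L[ℝ] Euc N :=
  LinearMap.toContinuousLinearMap
    { toFun := fun z => WithLp.toLp 2 fun j => (z j).im
      map_add' := fun a b => by ext j; simp
      map_smul' := fun c a => by ext j; simp }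

@[simp] theorem rePart_apply (z : EuclideanSpace ℂ (Fin N)) (j : Fin N) :
    rePart N z j = (z j).re := rfl

@[simp] theorem imPart_apply (z : EuclideanSpace ℂ (Fin N)) (j : Fin N) :
    imPart N z j = (z j).im := rfl

theorem apply_eq_rePart_add (z : EuclideanSpace ℂ (Fin N)) (j : Fin N) :
    z j = ((rePart N z j : ℝ) : ℂ) + Complex.I * ((imPart N z j : ℝ) : ℂ) := by
  rw [rePart_apply, imPart_apply, mul_comm, Complex.re_add_im]

theorem symplecticForm_eq (a b : EuclideanSpace ℂ (Fin N)) : symplecticForm a b =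
    ⟪rePart N a, imPart N b⟫_ℝ - ⟪imPart N a, rePart N b⟫_ℝ := by
  simp [symplecticForm, inner_eq_sum, Finset.sum_sub_distrib]

/-- The derivative of a 1-form minus the component along `η` of the second derivative of the
immersion. -/
noncomputable def twistForm (f : Euc k → Euc N) (α : Euc k → (Euc k →L[ℝ] ℝ)) (w : Euc k)
    (η : Euc N) : Euc k →L[ℝ] Euc k →L[ℝ] ℝ :=
  fderiv ℝ α w -
    (ContinuousLinearMap.compL ℝ (Euc k) (Euc N) ℝ (innerSL ℝ η)).comp (fderiv ℝ (fderiv ℝ f) w)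

theorem twistForm_apply (f : Euc k → Euc N) (α : Euc k → (Euc k →L[ℝ] ℝ)) (w : Euc k)
    (η : Euc N) (a b : Euc k) :
    twistForm f α w η a b = fderiv ℝ α w a b - ⟪η, fderiv ℝ (fderiv ℝ f) w a b⟫_ℝ := rfl

/-- The matrix of the metric plus `i` times the matrix of `twistForm`. -/
noncomputable def phaseMatrix (f : Euc k → Euc N) (α : Euc k → (Euc k →L[ℝ] ℝ)) (w : Euc k)
    (η : Euc N) : Matrix (Fin k) (Fin k) ℂ :=
  Matrix.of fun i j => (⟪fderiv ℝ f w (coordVec i), fderiv ℝ f w (coordVec j)⟫_ℝ : ℂ) +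
    Complex.I * (twistForm f α w η (coordVec j) (coordVec i) : ℂ)

/-- The twisted-austere condition at a point of a local immersion `f` with 1-form `α`. -/
noncomputable def TwistedAustereAt (φ : ℝ) (f : Euc k → Euc N) (α : Euc k → (Euc k →L[ℝ] ℝ))
    (w : Euc k) : Prop :=
  ∀ η : Euc N, (∀ a, ⟪η, fderiv ℝ f w a⟫_ℝ = α w a) →
    (∀ a b, twistForm f α w η a b = twistForm f α w η b a) ∧
      (Complex.exp (Complex.I * φ) * (phaseMatrix f α w η).det).im = 0

/-- θ = φ + mπ/2, so e^{iθ} = e^{iφ} i^m. Together with the i^m from the normal directions this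
leaves the real sign (-1)^m, which is why only the cophase matters. -/
theorem im_phase_mul {m : ℕ} (hm : k + m = N) (θ : ℝ) {p r : ℝ} {D v : ℂ}
    (h : (p : ℂ) * v = Complex.I ^ m * D * r) :
    p * (Complex.exp (Complex.I * θ) * v).im =
      (-1) ^ m * r * (Complex.exp (Complex.I * cophase N k θ) * D).im := by
  have h1 : Complex.exp (Complex.I * θ) =
      Complex.exp (Complex.I * cophase N k θ) * Complex.I ^ m := by
    have h2 : Complex.I ^ m = Complex.exp (m * (Real.pi / 2 * Complex.I)) := by
      rw [Complex.exp_nat_mul, Complex.exp_pi_div_two_mul_I]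
    rw [h2, ← Complex.exp_add]
    congr 1
    have : (N : ℂ) = k + m := by exact_mod_cast hm.symm
    simp only [cophase]
    push_cast
    rw [this]
    ring
  have h3 : (p : ℂ) * (Complex.exp (Complex.I * θ) * v) =
      (((-1) ^ m * r : ℝ) : ℂ) * (Complex.exp (Complex.I * cophase N k θ) * D) := by
    have h4 : Complex.I ^ m * Complex.I ^ m = (-1) ^ m := by
      rw [← mul_pow, Complex.I_mul_I]
    rw [h1]
    push_cast
    linear_combination (Complex.exp (Complex.I * cophase N k θ) * Complex.I ^ m) * h +
      Complex.exp (Complex.I * cophase N k θ) * D * r * h4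
  have := congrArg Complex.im h3
  rwa [Complex.im_ofReal_mul, Complex.im_ofReal_mul] at this

variable {X : Type*} [TopologicalSpace X] {F : X → Euc N} {μ : X → (Euc N →L[ℝ] ℝ)}
  {ψ : OpenPartialHomeomorph (Euc k) X}

theorem rePart_twistedConormalMap (q : twistedConormal k F μ) :
    rePart N (twistedConormalMap k F μ q) = F q.1.1 := by
  ext j; simp [twistedConormalMap]

theorem imPart_twistedConormalMap (q : twistedConormal k F μ) :
    imPart N (twistedConormalMap k F μ q) = q.1.2 := by
  ext j; simp [twistedConormalMap]

theorem IsLocalParam.inner_conormal (hψ : IsLocalParam F ψ) (q : twistedConormal k F μ)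
    (hq : q.1.1 ∈ ψ.target) (a : Euc k) :
    ⟪q.1.2, fderiv ℝ (F ∘ ψ) (ψ.symm q.1.1) a⟫_ℝ = localForm F μ ψ (ψ.symm q.1.1) a := by
  have hw := ψ.map_target hq
  rw [q.2 _ ⟨ψ, hψ, _, hw, ψ.right_inv hq, a, rfl⟩]
  simp [localForm, ψ.right_inv hq]

/-- The differential of a local parametrization of the twisted conormal bundle. -/
theorem exists_conormal_fderiv (hψ : IsLocalParam F ψ)
    (hα : ContDiffOn ℝ ∞ (localForm F μ ψ) ψ.source)
    {Ψ : OpenPartialHomeomorph (Euc N) (twistedConormal k F μ)}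
    (hΨ : IsLocalParam (twistedConormalMap k F μ) Ψ) {z : Euc N} (hz : z ∈ Ψ.source)
    (hx : (Ψ z).1.1 ∈ ψ.target) :
    ∃ (W : Euc N →L[ℝ] Euc k) (E : Euc N →L[ℝ] Euc N),
      (∀ c a, ⟪E c, fderiv ℝ (F ∘ ψ) (ψ.symm (Ψ z).1.1) a⟫_ℝ =
        twistForm (F ∘ ψ) (localForm F μ ψ) (ψ.symm (Ψ z).1.1) (Ψ z).1.2 (W c) a) ∧
      ∀ c, rePart N (fderiv ℝ (twistedConormalMap k F μ ∘ Ψ) z c) =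
          fderiv ℝ (F ∘ ψ) (ψ.symm (Ψ z).1.1) (W c) ∧
        imPart N (fderiv ℝ (twistedConormalMap k F μ ∘ Ψ) z c) = E c := by
  set c : Euc N → X := fun z => (Ψ z).1.1 with hc
  have hcc : ContinuousAt c z :=
    (continuous_fst.comp continuous_subtype_val).continuousAt.comp (Ψ.continuousAt hz)
  have hFc : F ∘ c = rePart N ∘ (twistedConormalMap k F μ ∘ Ψ) := by
    funext z; exact (rePart_twistedConormalMap _).symm
  have hη : (fun z => (Ψ z).1.2) = imPart N ∘ (twistedConormalMap k F μ ∘ Ψ) := by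
    funext z; exact (imPart_twistedConormalMap _).symm
  have hs := hΨ.contDiffAt hz
  have hd := hs.differentiableAt (by simp)
  have hFs : ContDiffAt ℝ ∞ (F ∘ c) z := hFc ▸ (rePart N).contDiff.contDiffAt.comp z hs
  have hw := hψ.contDiffAt_symm_comp hcc hx hFs
  have hwd : HasFDerivAt (fun z => ψ.symm (c z)) (fderiv ℝ (fun z => ψ.symm (c z)) z) z :=
    (hw.differentiableAt (by simp)).hasFDerivAt
  have hηd : HasFDerivAt (fun z => (Ψ z).1.2)
      ((imPart N).comp (fderiv ℝ (twistedConormalMap k F μ ∘ Ψ) z)) z := by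
    rw [hη]; exact (imPart N).hasFDerivAt.comp z hd.hasFDerivAt
  have hws := ψ.map_target hx
  refine ⟨fderiv ℝ (fun z => ψ.symm (c z)) z,
    (imPart N).comp (fderiv ℝ (twistedConormalMap k F μ ∘ Ψ) z), fun b a => ?_,
    fun b => ⟨?_, rfl⟩⟩
  -- The relation defining the bundle is differentiated along `Ψ`; the product rule supplies the
  -- second derivative of `F ∘ ψ` appearing in `twistForm`.
  · have h1 : (fun z => ⟪(Ψ z).1.2, fderiv ℝ (F ∘ ψ) (ψ.symm (c z)) a⟫_ℝ) =ᶠ[nhds z]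
        fun z => localForm F μ ψ (ψ.symm (c z)) a := by
      filter_upwards [hcc.eventually (ψ.open_target.mem_nhds hx)] with y hy
      exact hψ.inner_conormal (Ψ y) hy a
    have hf2 : HasFDerivAt (fun z => fderiv ℝ (F ∘ ψ) (ψ.symm (c z)) a) _ z :=
      ((((hψ.contDiffAt_fderiv hws).differentiableAt (by simp)).hasFDerivAt).comp z hwd).clm_apply
        (hasFDerivAt_const a z)
    have h2 := hηd.inner ℝ hf2
    have hα' : HasFDerivAt (fun z => localForm F μ ψ (ψ.symm (c z)) a) _ z :=
      ((((hα.contDiffAt (ψ.open_source.mem_nhds hws)).differentiableAt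
        (by simp)).hasFDerivAt).comp z hwd).clm_apply (hasFDerivAt_const a z)
    have h3 := congrArg (fun T : Euc N →L[ℝ] ℝ => T b) (h2.unique (h1.hasFDerivAt_iff.2 hα'))
    simp at h3
    rw [twistForm_apply]
    simp only [ContinuousLinearMap.comp_apply]
    linarith
  · have h1 := hψ.fderiv_comp hcc hx hFs
    have h2 : fderiv ℝ (F ∘ c) z = (rePart N).comp
        (fderiv ℝ (twistedConormalMap k F μ ∘ Ψ) z) := by
      rw [hFc]; exact ((rePart N).hasFDerivAt.comp z hd.hasFDerivAt).fderiv
    have h3 := congrArg (fun T : Euc N →L[ℝ] Euc N => T b) (h2.symm.trans h1)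
    exact h3

/-- The pointwise form of the twisted-austere condition: necessity. -/
theorem IsTwistedAustere.twistedAustereAt {θ : ℝ} (h : IsTwistedAustere k θ F μ)
    (hψ : IsLocalParam F ψ) {w : Euc k} (hw : w ∈ ψ.source) :
    TwistedAustereAt (cophase N k θ) (F ∘ ψ) (localForm F μ ψ) w := by
  intro η hη
  have hmem : ((ψ w, η) : X × Euc N) ∈ twistedConormal k F μ := by
    intro a ha
    obtain ⟨b, rfl⟩ := (hψ.isTangentVector_iff hw).1 ha
    exact hη b
  obtain ⟨Ψ, hΨ, hq⟩ := h.specialLagrangian.submanifold.exists_param ⟨(ψ w, η), hmem⟩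
  set z := Ψ.symm ⟨(ψ w, η), hmem⟩ with hz
  have hzs : z ∈ Ψ.source := Ψ.map_target hq
  have hΨz : Ψ z = ⟨(ψ w, η), hmem⟩ := Ψ.right_inv hq
  have hx : (Ψ z).1.1 ∈ ψ.target := by rw [hΨz]; exact ψ.map_source hw
  obtain ⟨W, E, hE, hT⟩ := exists_conormal_fderiv hψ (h.smooth ψ hψ) hΨ hzs hx
  rw [hΨz] at hE hT
  simp only [ψ.left_inv hw] at hE hT
  have hA := hψ.immersive w hw
  have hinj : ∀ c, W c = 0 → E c = 0 → c = 0 := by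
    intro c h1 h2
    apply hΨ.immersive z hzs
    ext j
    rw [apply_eq_rePart_add, (hT c).1, (hT c).2, h1, h2]
    simp
  -- The Lagrangian condition tests `twistForm` only on vectors `W c`; surjectivity of `W` makes
  -- these all vectors.
  have hsurj := surjective_base hA hE hinj
  constructor
  · intro a b
    obtain ⟨c, rfl⟩ := hsurj a
    obtain ⟨d, rfl⟩ := hsurj b
    have h1 := h.specialLagrangian.lagrangian Ψ hΨ z hzs c d
    rw [symplecticForm_eq, (hT c).1, (hT c).2, (hT d).1, (hT d).2, hE, real_inner_comm, hE] at h1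
    linarith
  · obtain ⟨m, p, r, hm, hp, hdet, hr⟩ := exists_holVolume_eq hA hE
      (fun i => fderiv ℝ (twistedConormalMap k F μ ∘ Ψ) z (coordVec i)) (fun i j => by
        rw [apply_eq_rePart_add, (hT _).1, (hT _).2])
    have h1 := im_phase_mul hm θ hdet
    rw [h.specialLagrangian.special Ψ hΨ z hzs, mul_zero] at h1
    have h2 := hr hinj
    have h3 : ((-1 : ℝ) ^ m * r) ≠ 0 := mul_ne_zero (pow_ne_zero _ (by norm_num)) h2
    exact (mul_eq_zero.1 h1.symm).resolve_left h3

/-- A graph parametrization of a submanifold induces one of its twisted conormal bundle. -/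
theorem IsLocalParam.exists_conormalParam (hψ : IsLocalParam F ψ)
    (hα : ContDiffOn ℝ ∞ (localForm F μ ψ) ψ.source) (L : Euc N →L[ℝ] Euc k)
    (hL : ∀ w ∈ ψ.source, L (F (ψ w)) = w) (q : twistedConormal k F μ) (hq : q.1.1 ∈ ψ.target) :
    ∃ Ψ : OpenPartialHomeomorph (Euc N) (twistedConormal k F μ),
      IsLocalParam (twistedConormalMap k F μ) Ψ ∧ q ∈ Ψ.target := by
  classical
  have hLd : ∀ w ∈ ψ.source, ∀ a, L (fderiv ℝ (F ∘ ψ) w a) = a := fun w hw a =>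
    graphParam_fderiv L hL hw (hψ.differentiableAt hw) a
  let K : Submodule ℝ (Euc N) := LinearMap.ker (L : Euc N →ₗ[ℝ] Euc k)
  have hLsurj : Function.Surjective L := fun a => ⟨_, hLd _ (ψ.map_target hq) a⟩
  have hfr : Module.finrank ℝ (Euc N) = Module.finrank ℝ (Euc k × K) := by
    have := LinearMap.finrank_range_add_finrank_ker (L : Euc N →ₗ[ℝ] Euc k)
    rw [LinearMap.range_eq_top.2 hLsurj] at this
    rw [Module.finrank_prod, ← this, finrank_top]
  let e : Euc N ≃L[ℝ] Euc k × K := ContinuousLinearEquiv.ofFinrankEq hfr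
  -- A covector over `w` is written `Lt s + κ` with `κ ∈ ker L`. As `L` inverts the differential,
  -- pairing with the image of `a` gives ⟪s, a⟫ plus the pairing of `κ`; hence membership in the
  -- bundle determines `s` from `κ`, and `κ` is a free fibre coordinate.
  let Lt := ContinuousLinearMap.adjoint L
  let s : Euc k → Euc N → Euc k := fun w κ =>
    ∑ i, (localForm F μ ψ w (coordVec i) - ⟪κ, fderiv ℝ (F ∘ ψ) w (coordVec i)⟫_ℝ) • coordVec i
  let η : Euc k → Euc N → Euc N := fun w κ => Lt (s w κ) + κ
  have hs : ∀ w κ a, ⟪s w κ, a⟫_ℝ = localForm F μ ψ w a - ⟪κ, fderiv ℝ (F ∘ ψ) w a⟫_ℝ := by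
    intro w κ a
    conv_rhs => rw [Euc.sum_smul_coordVec a]
    simp only [s, map_sum, map_smul, inner_sum, sum_inner, real_inner_smul_left, inner_smul_right,
      smul_eq_mul, ← Finset.sum_sub_distrib]
    refine Finset.sum_congr rfl fun i _ => ?_
    have : ⟪(coordVec i : Euc k), a⟫_ℝ = a i := by
      simp [coordVec, EuclideanSpace.inner_single_left]
    rw [this]; ring
  have hη : ∀ w ∈ ψ.source, ∀ κ a, ⟪η w κ, fderiv ℝ (F ∘ ψ) w a⟫_ℝ = localForm F μ ψ w a := by
    intro w hw κ a
    simp only [η, inner_add_left, Lt, ContinuousLinearMap.adjoint_inner_left, hLd w hw, hs]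
    ring
  have hLtK : ∀ x, ∀ κ : K, ⟪Lt x, (κ : Euc N)⟫_ℝ = 0 := by
    intro x κ
    have : L κ = 0 := κ.2
    simp [Lt, ContinuousLinearMap.adjoint_inner_left, this]
  have hproj : ∀ x (κ : K), K.orthogonalProjectionOnto (Lt x + κ) = κ := by
    intro x κ
    have h1 : K.orthogonalProjectionOnto (Lt x) = 0 := by
      rw [Submodule.orthogonalProjectionOnto_eq_zero_iff]
      rw [Submodule.mem_orthogonal]
      intro u hu
      rw [real_inner_comm]; exact hLtK x ⟨u, hu⟩
    rw [map_add, h1, zero_add, Submodule.orthogonalProjectionOnto_mem_subspace_eq_self]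
  have hsmooth : ContDiffOn ℝ ∞ (fun z => η (e z).1 (e z).2) {z | (e z).1 ∈ ψ.source} := by
    have h1 : ContDiff ℝ ∞ (fun z => (e z).1) := contDiff_fst.comp e.contDiff
    have h2 : ContDiff ℝ ∞ (fun z => ((e z).2 : Euc N)) :=
      K.subtypeL.contDiff.comp (contDiff_snd.comp e.contDiff)
    have h3 : ContDiffOn ℝ ∞ (fun z => fderiv ℝ (F ∘ ψ) (e z).1) {z | (e z).1 ∈ ψ.source} :=
      (hψ.smooth.fderiv_of_isOpen ψ.open_source (by simp)).comp h1.contDiffOn fun z hz => hz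
    have h4 : ContDiffOn ℝ ∞ (fun z => localForm F μ ψ (e z).1) {z | (e z).1 ∈ ψ.source} :=
      hα.comp h1.contDiffOn fun z hz => hz
    refine ContDiffOn.add (Lt.contDiff.comp_contDiffOn (ContDiffOn.sum fun i _ => ?_))
      h2.contDiffOn
    exact ((h4.clm_apply contDiffOn_const).sub
      (h2.contDiffOn.inner ℝ (h3.clm_apply contDiffOn_const))).smul contDiffOn_const
  let Ψ₀ : Euc N → X × Euc N := fun z => (ψ (e z).1, η (e z).1 (e z).2)
  have hΨ₀ : ∀ z, (e z).1 ∈ ψ.source → Ψ₀ z ∈ twistedConormal k F μ := by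
    intro z hz a ha
    obtain ⟨b, rfl⟩ := (hψ.isTangentVector_iff hz).1 ha
    exact hη _ hz _ b
  -- The value `q` is a default outside the chart domain, needed only to have a total map into the
  -- subtype.
  let Ψf : Euc N → twistedConormal k F μ := fun z =>
    if h : Ψ₀ z ∈ twistedConormal k F μ then ⟨Ψ₀ z, h⟩ else q
  have hΨf : ∀ z, (e z).1 ∈ ψ.source → (Ψf z : X × Euc N) = Ψ₀ z := by
    intro z hz
    simp only [Ψf, dif_pos (hΨ₀ z hz)]
  let g : Euc N →L[ℝ] K := K.orthogonalProjectionOnto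
  have hleft : ∀ z, (e z).1 ∈ ψ.source →
      e.symm (ψ.symm (Ψf z).1.1, g (Ψf z).1.2) = z := by
    intro z hz
    rw [hΨf z hz]
    simp only [Ψ₀, η, g, ψ.left_inv hz, hproj]
    exact e.symm_apply_apply z
  have hright : ∀ y : twistedConormal k F μ, y.1.1 ∈ ψ.target →
      Ψf (e.symm (ψ.symm y.1.1, g y.1.2)) = y := by
    intro y hy
    have hys := ψ.map_target hy
    apply Subtype.ext
    rw [hΨf _ (by simpa using hys)]
    simp only [Ψ₀, e.apply_symm_apply, ψ.right_inv hy]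
    refine Prod.ext rfl ?_
    change η (ψ.symm y.1.1) (g y.1.2) = y.1.2
    rw [← sub_eq_zero]
    set δ := η (ψ.symm y.1.1) (g y.1.2) - y.1.2 with hδ
    have h1 : ∀ a, ⟪δ, fderiv ℝ (F ∘ ψ) (ψ.symm y.1.1) a⟫_ℝ = 0 := fun a => by
      rw [hδ, inner_sub_left, hη _ hys, hψ.inner_conormal y hy, sub_self]
    have h2 : ∀ κ : K, ⟪δ, (κ : Euc N)⟫_ℝ = 0 := fun κ => by
      have h3 : ⟪((g y.1.2 : K) : Euc N), (κ : Euc N)⟫_ℝ = ⟪y.1.2, (κ : Euc N)⟫_ℝ := by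
        have h5 := Submodule.inner_orthogonalProjectionOnto_eq_of_mem_right κ y.1.2
        rw [← h5]; rfl
      rw [hδ, inner_sub_left, inner_add_left, hLtK, h3, zero_add, sub_self]
    rw [← inner_self_eq_zero (𝕜 := ℝ)]
    -- `δ` is orthogonal to the tangent space and to `ker L`. These two span, since subtracting the
    -- tangent vector over `L δ` moves `δ` into `ker L`; hence ⟪δ, δ⟫ = 0.
    have h4 : δ - fderiv ℝ (F ∘ ψ) (ψ.symm y.1.1) (L δ) ∈ K := by
      simp only [K, LinearMap.mem_ker, ContinuousLinearMap.coe_coe, map_sub, hLd _ hys, sub_self]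
    have h5 := h2 ⟨_, h4⟩
    rw [inner_sub_right, h1, sub_zero] at h5
    exact h5
  let Ψ : OpenPartialHomeomorph (Euc N) (twistedConormal k F μ) :=
    { toFun := Ψf
      invFun := fun y => e.symm (ψ.symm y.1.1, g y.1.2)
      source := {z | (e z).1 ∈ ψ.source}
      target := {y | y.1.1 ∈ ψ.target}
      map_source' := fun z hz => by
        change (Ψf z).1.1 ∈ ψ.target
        rw [hΨf z hz]; exact ψ.map_source hz
      map_target' := fun y hy => by
        change (e (e.symm (ψ.symm y.1.1, g y.1.2))).1 ∈ ψ.source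
        rw [e.apply_symm_apply]; exact ψ.map_target hy
      left_inv' := hleft
      right_inv' := hright
      open_source := ψ.open_source.preimage (continuous_fst.comp e.continuous)
      open_target := ψ.open_target.preimage (continuous_fst.comp continuous_subtype_val)
      continuousOn_toFun := by
        rw [Topology.IsInducing.subtypeVal.continuousOn_iff]
        refine ContinuousOn.congr (f := Ψ₀) ?_ hΨf
        exact (ψ.continuousOn.comp (continuous_fst.comp e.continuous).continuousOn
          fun z hz => hz).prodMk hsmooth.continuousOn
      continuousOn_invFun := by
        refine e.symm.continuous.comp_continuousOn (ContinuousOn.prodMk ?_ ?_)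
        · exact ψ.continuousOn_symm.comp (continuous_fst.comp continuous_subtype_val).continuousOn
            fun y hy => hy
        · exact (g.continuous.comp (continuous_snd.comp continuous_subtype_val)).continuousOn }
  have hre : ∀ z ∈ Ψ.source, rePart N ((twistedConormalMap k F μ ∘ Ψ) z) = F (ψ (e z).1) := by
    intro z hz
    refine (rePart_twistedConormalMap _).trans ?_
    change F (Ψf z).1.1 = _
    rw [hΨf z hz]
  have him : ∀ z ∈ Ψ.source, imPart N ((twistedConormalMap k F μ ∘ Ψ) z) =
      η (e z).1 (e z).2 := by
    intro z hz
    refine (imPart_twistedConormalMap _).trans ?_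
    change (Ψf z).1.2 = _
    rw [hΨf z hz]
  have hΨs : ContDiffOn ℝ ∞ (twistedConormalMap k F μ ∘ Ψ) Ψ.source := by
    have h1 : ContDiffOn ℝ ∞ (fun z => F (ψ (e z).1)) Ψ.source :=
      hψ.smooth.comp (contDiff_fst.comp e.contDiff).contDiffOn fun z hz => hz
    let J : Euc N × Euc N →L[ℝ] EuclideanSpace ℂ (Fin N) := LinearMap.toContinuousLinearMap
      { toFun := fun z => WithLp.toLp 2 fun j => ((z.1 j : ℝ) : ℂ) + Complex.I * ((z.2 j : ℝ) : ℂ)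
        map_add' := fun a b => by ext j; simp; ring
        map_smul' := fun c a => by ext j; simp; ring }
    refine (J.contDiff.comp_contDiffOn (h1.prodMk hsmooth)).congr fun z hz => ?_
    ext j
    rw [apply_eq_rePart_add, hre z hz, him z hz]
    rfl
  refine ⟨Ψ, ⟨hΨs, fun z hz => ?_⟩, hq⟩
  -- A fixed linear map recovers both coordinates, `w` from the real part by `L` and `κ` from the
  -- imaginary part by projection. The parametrization is therefore immersive.
  let B : EuclideanSpace ℂ (Fin N) →L[ℝ] Euc N :=
    (e.symm : Euc k × K →L[ℝ] Euc N).comp ((L.comp (rePart N)).prod (g.comp (imPart N)))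
  have hB : (fun z => B ((twistedConormalMap k F μ ∘ Ψ) z)) =ᶠ[nhds z] id := by
    filter_upwards [Ψ.open_source.mem_nhds hz] with y hy
    change e.symm (L (rePart N _), g (imPart N _)) = y
    rw [hre y hy, him y hy, hL _ hy]
    have : g (η (e y).1 (e y).2) = (e y).2 := hproj _ _
    rw [this]
    exact e.symm_apply_apply y
  have h1 := B.hasFDerivAt.comp z
    ((hΨs.contDiffAt (Ψ.open_source.mem_nhds hz)).differentiableAt (by simp)).hasFDerivAt
  have h2 := h1.unique (hB.hasFDerivAt_iff.2 (hasFDerivAt_id z))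
  have h3 : ∀ a, B (fderiv ℝ (twistedConormalMap k F μ ∘ Ψ) z a) = a := fun a =>
    congrArg (fun T : Euc N →L[ℝ] Euc N => T a) h2
  intro a b hab
  rw [← h3 a, ← h3 b, hab]

/-- The pointwise form of the twisted-austere condition: sufficiency. -/
theorem isTwistedAustere_of_twistedAustereAt {θ : ℝ} (hF : IsSubmanifold k F)
    (hμ : IsSmoothForm k F μ)
    (h : ∀ x : X, ∃ ψ : OpenPartialHomeomorph (Euc k) X, IsLocalParam F ψ ∧ x ∈ ψ.target ∧
      ∀ w ∈ ψ.source, TwistedAustereAt (cophase N k θ) (F ∘ ψ) (localForm F μ ψ) w) :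
    IsTwistedAustere k θ F μ := by
  have hT2 := hF.hausdorff
  have hsc := hF.secondCountable
  refine ⟨hF, hμ, ⟨inferInstance, inferInstance, fun q => ?_⟩, fun Ψ hΨ z hz c d => ?_,
    fun Ψ hΨ z hz => ?_⟩
  · obtain ⟨ψ, hψ, hx⟩ := hF.exists_param q.1.1
    have hw := ψ.map_target hx
    obtain ⟨L, hL⟩ := (fderiv ℝ (F ∘ ψ) (ψ.symm q.1.1)).exists_comp_eq_id_of_injective
      (hψ.immersive _ hw)
    obtain ⟨χ, hχ, hxχ, hLχ⟩ := hψ.exists_graphParam hw L (fun a b hab => by simpa [hL] using hab)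
    rw [ψ.right_inv hx] at hxχ
    exact hχ.exists_conormalParam (hμ χ hχ) L hLχ q hxχ
  · obtain ⟨ψ, hψ, hx, hta⟩ := h (Ψ z).1.1
    obtain ⟨W, E, hE, hT⟩ := exists_conormal_fderiv hψ (hμ ψ hψ) hΨ hz hx
    have h1 := (hta _ (ψ.map_target hx) (Ψ z).1.2 (hψ.inner_conormal _ hx)).1
    rw [symplecticForm_eq, (hT c).1, (hT c).2, (hT d).1, (hT d).2, hE, real_inner_comm, hE, h1,
      sub_self]
  · obtain ⟨ψ, hψ, hx, hta⟩ := h (Ψ z).1.1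
    obtain ⟨W, E, hE, hT⟩ := exists_conormal_fderiv hψ (hμ ψ hψ) hΨ hz hx
    have h1 := (hta _ (ψ.map_target hx) (Ψ z).1.2 (hψ.inner_conormal _ hx)).2
    obtain ⟨m, p, r, hm, hp, hdet, -⟩ := exists_holVolume_eq (hψ.immersive _ (ψ.map_target hx)) hE
      (fun i => fderiv ℝ (twistedConormalMap k F μ ∘ Ψ) z (coordVec i)) (fun i j => by
        rw [apply_eq_rePart_add, (hT _).1, (hT _).2])
    have h2 := im_phase_mul hm θ hdet
    have h3 : (Complex.exp (Complex.I * cophase N k θ) * Matrix.det (Matrix.of fun i j : Fin k =>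
        (⟪fderiv ℝ (F ∘ ψ) (ψ.symm (Ψ z).1.1) (coordVec i),
          fderiv ℝ (F ∘ ψ) (ψ.symm (Ψ z).1.1) (coordVec j)⟫_ℝ : ℂ) + Complex.I *
        (twistForm (F ∘ ψ) (localForm F μ ψ) (ψ.symm (Ψ z).1.1) (Ψ z).1.2 (coordVec j)
          (coordVec i) : ℂ))).im = 0 := h1
    rw [h3, mul_zero] at h2
    exact (mul_eq_zero.1 h2).resolve_left hp

end TwistedConormal

/-! ### Second fundamental form, Hodge star and trace on a surface. -/

section SurfaceCalculus

variable {k N : ℕ}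

theorem symm_second_fderiv {V : Type*} [NormedAddCommGroup V] [NormedSpace ℝ V] {f : Euc k → V}
    {w : Euc k} (hf : ContDiffAt ℝ ∞ f w) (a b : Euc k) :
    fderiv ℝ (fderiv ℝ f) w a b = fderiv ℝ (fderiv ℝ f) w b a :=
  (hf.isSymmSndFDerivAt (by
    rw [minSmoothness_of_isRCLikeNormedField]
    exact WithTop.coe_le_coe.2 (le_top : (2 : ℕ∞) ≤ ⊤))).eq a b

/-- Here `τ` is the tangential part of `η`, and only the normal vector `η - τ` pairs with a normal
projection. This separates mean curvature from Christoffel terms in `trace_twistForm`. -/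
theorem inner_secondFundForm {f : Euc k → Euc N} {w : Euc k} {η τ : Euc N}
    (hτ : τ ∈ LinearMap.range (fderiv ℝ f w).toLinearMap)
    (hη : ∀ a, ⟪η, fderiv ℝ f w a⟫_ℝ = ⟪τ, fderiv ℝ f w a⟫_ℝ) (a b : Euc k) :
    ⟪η, secondFundForm f w a b⟫_ℝ = ⟪η, fderiv ℝ (fderiv ℝ f) w a b⟫_ℝ -
      ⟪τ, fderiv ℝ (fderiv ℝ f) w a b⟫_ℝ := by
  set K := (LinearMap.range (fderiv ℝ f w).toLinearMap)ᗮ with hK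
  have h1 : η - τ ∈ K := by
    rw [hK, Submodule.mem_orthogonal']
    rintro _ ⟨c, rfl⟩
    rw [inner_sub_left]
    exact sub_eq_zero.2 (hη c)
  have h2 : τ ∈ Kᗮ := by rw [hK]; exact Submodule.le_orthogonal_orthogonal _ hτ
  have h3 : K.starProjection η = η - τ := by
    have : η = (η - τ) + τ := by abel
    conv_lhs => rw [this]
    rw [map_add, Submodule.starProjection_eq_self_iff.2 h1,
      (Submodule.starProjection_apply_eq_zero_iff K).2 h2, add_zero]
  rw [secondFundForm, ← Submodule.inner_starProjection_left_eq_right, h3, inner_sub_left]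

/-- The function is `a / √D`. Components of `hodgeStar` have this shape, the inverse metric being
its cofactors over the determinant. -/
theorem fderiv_sqrt_mul_inv_mul {E : Type*} [NormedAddCommGroup E] [NormedSpace ℝ E]
    {D a : E → ℝ} {D' a' : E →L[ℝ] ℝ} {y : E} (hD : HasFDerivAt D D' y) (ha : HasFDerivAt a a' y)
    (h : 0 < D y) (b : E) : fderiv ℝ (fun z => Real.sqrt (D z) * ((D z)⁻¹ * a z)) y b =
      (a' b - a y * D' b / (2 * D y)) / Real.sqrt (D y) := by
  have h1 : (fun z => Real.sqrt (D z) * ((D z)⁻¹ * a z)) = fun z => (Real.sqrt (D z))⁻¹ * a z := by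
    funext z
    rw [← mul_assoc, ← div_eq_mul_inv, Real.sqrt_div_self', one_div]
  have hs : 0 < Real.sqrt (D y) := Real.sqrt_pos.2 h
  have h2 : HasFDerivAt (fun z => (Real.sqrt (D z))⁻¹ * a z) _ y :=
    ((hasDerivAt_inv hs.ne').comp_hasFDerivAt y (hD.sqrt h.ne')).mul ha
  rw [h1, h2.fderiv]
  simp
  have h3 : D y = Real.sqrt (D y) ^ 2 := (Real.sq_sqrt h.le).symm
  field_simp
  rw [← h3]
  ring

theorem inv_fin_two_apply (M : Matrix (Fin 2) (Fin 2) ℝ) :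
    M⁻¹ 0 0 = M.det⁻¹ * M 1 1 ∧ M⁻¹ 0 1 = M.det⁻¹ * -M 0 1 ∧ M⁻¹ 1 0 = M.det⁻¹ * -M 1 0 ∧
      M⁻¹ 1 1 = M.det⁻¹ * M 0 0 := by
  simp [Matrix.inv_def, Matrix.adjugate_fin_two, Ring.inverse_eq_inv']

theorem metricMatrix_det (g : Euc 2 → Euc N) (y : Euc 2) : (metricMatrix g y).det =
    ⟪fderiv ℝ g y (coordVec 0), fderiv ℝ g y (coordVec 0)⟫_ℝ *
      ⟪fderiv ℝ g y (coordVec 1), fderiv ℝ g y (coordVec 1)⟫_ℝ -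
    ⟪fderiv ℝ g y (coordVec 0), fderiv ℝ g y (coordVec 1)⟫_ℝ ^ 2 := by
  rw [Matrix.det_fin_two]
  simp only [metricMatrix, Matrix.of_apply]
  rw [real_inner_comm (fderiv ℝ g y (coordVec 0)) (fderiv ℝ g y (coordVec 1))]
  ring

theorem metricMatrix_det_pos {g : Euc 2 → Euc N} {y : Euc 2}
    (hinj : Function.Injective (fderiv ℝ g y)) : 0 < (metricMatrix g y).det := by
  rw [metricMatrix_det]
  set A := fderiv ℝ g y
  set E := ⟪A (coordVec 0), A (coordVec 0)⟫_ℝ with hE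
  set M := ⟪A (coordVec 0), A (coordVec 1)⟫_ℝ with hM
  set G := ⟪A (coordVec 1), A (coordVec 1)⟫_ℝ with hG
  have hz : ∀ a, A a = 0 → a = 0 := fun a ha => hinj (by rw [ha, map_zero])
  have hGpos : 0 < G := by
    rw [hG, real_inner_self_eq_norm_sq]
    have : A (coordVec 1) ≠ 0 := fun h => by simpa [coordVec] using hz _ h
    positivity
  -- The image of this vector is `G` times the part of the first frame vector orthogonal to the
  -- second.
  have h1 : ⟪A (G • coordVec 0 - M • coordVec 1), A (G • coordVec 0 - M • coordVec 1)⟫_ℝ =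
      G * (E * G - M ^ 2) := by
    simp only [map_sub, map_smul, inner_sub_left, inner_sub_right, real_inner_smul_left,
      inner_smul_right, real_inner_comm (A (coordVec 0)) (A (coordVec 1)), ← hE, ← hM, ← hG]
    ring
  have h2 : A (G • coordVec 0 - M • coordVec 1) ≠ 0 := by
    intro h
    have h3 := congrArg (fun x : Euc 2 => x 0) (hz _ h)
    simp [coordVec] at h3
    exact hGpos.ne' h3
  have h3 : 0 < G * (E * G - M ^ 2) := by
    rw [← h1, real_inner_self_eq_norm_sq]; positivity
  exact pos_of_mul_pos_right h3 hGpos.le |> fun h => h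

/-- In terms of the second derivatives of the immersion, `* d * lam` is the trace of the derivative
of `lam` corrected by the tangential second derivatives; with the full second derivatives there is
an extra term given by the mean curvature. -/
theorem trace_twistForm {g : Euc 2 → Euc N} {lam : Euc 2 → (Euc 2 →L[ℝ] ℝ)} {y : Euc 2}
    (hg : ContDiffAt ℝ ∞ g y) (hinj : Function.Injective (fderiv ℝ g y))
    (hl : DifferentiableAt ℝ lam y) {η : Euc N} (hη : ∀ a, ⟪η, fderiv ℝ g y a⟫_ℝ = lam y a) :
    metricMatrix g y 1 1 * twistForm g lam y η (coordVec 0) (coordVec 0) -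
      metricMatrix g y 0 1 * (twistForm g lam y η (coordVec 0) (coordVec 1) +
        twistForm g lam y η (coordVec 1) (coordVec 0)) +
      metricMatrix g y 0 0 * twistForm g lam y η (coordVec 1) (coordVec 1) =
    (metricMatrix g y).det * (starDStar g lam y - ⟪η, meanCurvature g y⟫_ℝ) := by
  have hD := metricMatrix_det_pos hinj
  have hdd : HasFDerivAt (fderiv ℝ g) (fderiv ℝ (fderiv ℝ g) y) y :=
    ((hg.fderiv_right (m := ∞) (by simp)).differentiableAt (by simp)).hasFDerivAt
  have hm : ∀ i j : Fin 2, ∃ m : Euc 2 →L[ℝ] ℝ,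
      HasFDerivAt (fun z => metricMatrix g z i j) m y ∧
      ∀ a, m a = ⟪fderiv ℝ g y (coordVec i), fderiv ℝ (fderiv ℝ g) y a (coordVec j)⟫_ℝ +
        ⟪fderiv ℝ g y (coordVec j), fderiv ℝ (fderiv ℝ g) y a (coordVec i)⟫_ℝ := fun i j => by
    have hgi : ∀ i : Fin 2, HasFDerivAt (fun z => fderiv ℝ g z (coordVec i))
        ((fderiv ℝ (fderiv ℝ g) y).flip (coordVec i)) y := fun i => by
      simpa using hdd.clm_apply (hasFDerivAt_const (coordVec i) y)
    refine ⟨_, (hgi i).inner ℝ (hgi j), fun a => ?_⟩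
    simp [real_inner_comm]
  choose m' hm hma using hm
  have hli : ∀ i : Fin 2, HasFDerivAt (fun z => lam z (coordVec i))
      ((fderiv ℝ lam y).flip (coordVec i)) y := fun i => by
    simpa using hl.hasFDerivAt.clm_apply (hasFDerivAt_const (coordVec i) y)
  have hdet : HasFDerivAt (fun z => (metricMatrix g z).det) _ y :=
    (((hm 0 0).mul (hm 1 1)).sub ((hm 0 1).mul (hm 1 0))).congr_of_eventuallyEq
      (Filter.Eventually.of_forall fun z => Matrix.det_fin_two _)
  have hs1 : (fun z => hodgeStar g lam z 1) = fun z => Real.sqrt (metricMatrix g z).det *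
      ((metricMatrix g z).det⁻¹ * (metricMatrix g z 1 1 * lam z (coordVec 0) -
        metricMatrix g z 0 1 * lam z (coordVec 1))) := by
    funext z
    obtain ⟨h00, h01, -, -⟩ := inv_fin_two_apply (metricMatrix g z)
    simp only [hodgeStar, Fin.sum_univ_two, h00, h01, Matrix.cons_val_one, Matrix.cons_val_fin_one]
    ring
  have hs0 : (fun z => hodgeStar g lam z 0) = fun z => Real.sqrt (metricMatrix g z).det *
      ((metricMatrix g z).det⁻¹ * (metricMatrix g z 1 0 * lam z (coordVec 0) -
        metricMatrix g z 0 0 * lam z (coordVec 1))) := by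
    funext z
    obtain ⟨-, -, h10, h11⟩ := inv_fin_two_apply (metricMatrix g z)
    simp only [hodgeStar, Fin.sum_univ_two, h10, h11, Matrix.cons_val_zero]
    ring
  have hd1 := fderiv_sqrt_mul_inv_mul hdet
    (((hm 1 1).mul (hli 0)).sub ((hm 0 1).mul (hli 1))) hD (coordVec 0)
  have hd0 := fderiv_sqrt_mul_inv_mul hdet
    (((hm 1 0).mul (hli 0)).sub ((hm 0 0).mul (hli 1))) hD (coordVec 1)
  have hsym := symm_second_fderiv hg (coordVec 1) (coordVec 0)
  set A := fderiv ℝ g y with hA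
  set B := fderiv ℝ (fderiv ℝ g) y with hB
  set D := (metricMatrix g y).det with hDdef
  set l0 := lam y (coordVec 0) with hl0
  set l1 := lam y (coordVec 1) with hl1
  have hM : ∀ i j, metricMatrix g y i j = ⟪A (coordVec i), A (coordVec j)⟫_ℝ := fun i j => rfl
  set E := metricMatrix g y 0 0 with hE
  set M := metricMatrix g y 0 1 with hMd
  set G := metricMatrix g y 1 1 with hG
  have hM10 : metricMatrix g y 1 0 = M := by rw [hMd, hM, hM, real_inner_comm]
  have hDe : D = E * G - M ^ 2 := by rw [hDdef, Matrix.det_fin_two, hM10]; ring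
  -- The tangent vector representing `lam`, its coefficients being g⁻¹ applied to `lam`. Pairing `τ`
  -- with second derivatives gives exactly the Christoffel terms that arise when `*d*`
  -- differentiates the metric.
  let τ : Euc N := A (((G * l0 - M * l1) / D) • coordVec 0 + ((E * l1 - M * l0) / D) • coordVec 1)
  have hτe : ∀ x, ⟪τ, x⟫_ℝ = (G * l0 - M * l1) / D * ⟪A (coordVec 0), x⟫_ℝ +
      (E * l1 - M * l0) / D * ⟪A (coordVec 1), x⟫_ℝ := fun x => by
    simp only [τ, map_add, map_smul, inner_add_left, real_inner_smul_left]
  have hDne : D ≠ 0 := hD.ne'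
  have hτ : ∀ a, ⟪η, A a⟫_ℝ = ⟪τ, A a⟫_ℝ := by
    intro a
    rw [hη, Euc.sum_smul_coordVec a]
    simp only [Fin.sum_univ_two, map_add, map_smul, inner_add_right, inner_smul_right, hτe, ← hM,
      ← hE, ← hMd, ← hG, hM10, smul_eq_mul, ← hl0, ← hl1]
    field_simp
    rw [hDe]
    ring
  have hII := inner_secondFundForm (f := g) (w := y) (η := η) (τ := τ) ⟨_, rfl⟩ hτ
  have hmean : ⟪η, meanCurvature g y⟫_ℝ = ∑ i, ∑ j, (metricMatrix g y)⁻¹ i j *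
      (⟪η, B (coordVec i) (coordVec j)⟫_ℝ - ⟪τ, B (coordVec i) (coordVec j)⟫_ℝ) := by
    simp only [meanCurvature, inner_sum, inner_smul_right, hII]
    rfl
  obtain ⟨h00, h01, h10, h11⟩ := inv_fin_two_apply (metricMatrix g y)
  have hsq : Real.sqrt D * Real.sqrt D = D := Real.mul_self_sqrt hD.le
  have hsne : Real.sqrt D ≠ 0 := (Real.sqrt_pos.2 hD).ne'
  simp only [Pi.sub_apply, Pi.mul_apply] at hd1 hd0
  rw [hmean, starDStar, hs1, hs0, hd1, hd0]
  simp only [Fin.sum_univ_two, h00, h01, h10, h11, twistForm_apply, ← hDdef, hM10, ← hE, ← hMd,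
    ← hG, ← hB, hτe, hsym, sub_apply, add_apply, smul_apply, smul_eq_mul, hma, ← hl0, ← hl1,
    ContinuousLinearMap.flip_apply]
  rw [← sub_div, div_div, hsq]
  field_simp
  rw [hDe]
  ring

end SurfaceCalculus

/-! ### Cylinders over a surface in coordinates. -/

section CylinderCalculus

variable {N : ℕ}

theorem gradNormSq_fin_two (g : Euc 2 → Euc N) (h : Euc 2 → ℝ) (y : Euc 2) :
    gradNormSq g h y = (metricMatrix g y).det⁻¹ *
      (metricMatrix g y 1 1 * fderiv ℝ h y (coordVec 0) ^ 2 -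
        2 * metricMatrix g y 0 1 * (fderiv ℝ h y (coordVec 0) * fderiv ℝ h y (coordVec 1)) +
        metricMatrix g y 0 0 * fderiv ℝ h y (coordVec 1) ^ 2) := by
  obtain ⟨h00, h01, h10, h11⟩ := inv_fin_two_apply (metricMatrix g y)
  have hM10 : metricMatrix g y 1 0 = metricMatrix g y 0 1 := by
    simp only [metricMatrix, Matrix.of_apply]; exact real_inner_comm _ _
  simp only [gradNormSq, Fin.sum_univ_two, h00, h01, h10, h11, hM10]
  ring

/-- The phase of the matrix of a cylinder. -/
theorem im_phase_det_cylinder {φ : ℝ} (hφ : Real.cos φ ≠ 0) (E M G k₀ k₁ a b b' c : ℝ) :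
    (Complex.exp (Complex.I * φ) * Matrix.det (!![((E - k₀ * k₀ : ℝ) : ℂ) + Complex.I * a,
        ((M - k₀ * k₁ : ℝ) : ℂ) + Complex.I * b, Complex.I * ((1 / Real.cos φ * k₀ : ℝ) : ℂ);
        ((M - k₀ * k₁ : ℝ) : ℂ) + Complex.I * b', ((G - k₁ * k₁ : ℝ) : ℂ) + Complex.I * c,
        Complex.I * ((1 / Real.cos φ * k₁ : ℝ) : ℂ);
        Complex.I * ((1 / Real.cos φ * k₀ : ℝ) : ℂ), Complex.I * ((1 / Real.cos φ * k₁ : ℝ) : ℂ),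
        1 + Complex.I * ((-Real.tan φ : ℝ) : ℂ)] : Matrix (Fin 3) (Fin 3) ℂ)).im =
      1 / Real.cos φ * (G * a - M * (b + b') + E * c +
        Real.tan φ * (G * k₀ ^ 2 - 2 * M * (k₀ * k₁) + E * k₁ ^ 2)) := by
  set s := 1 / Real.cos φ with hs
  set t := Real.tan φ with ht
  have hcs : Real.cos φ * s = 1 := by rw [hs]; field_simp
  have hsin : Real.sin φ = t * Real.cos φ := (Real.tan_mul_cos hφ).symm
  have hst : s ^ 2 = 1 + t ^ 2 := by
    have h1 := Real.sin_sq_add_cos_sq φ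
    rw [hsin] at h1
    calc s ^ 2 = s ^ 2 * ((t * Real.cos φ) ^ 2 + Real.cos φ ^ 2) := by rw [h1, mul_one]
      _ = (Real.cos φ * s) ^ 2 * (1 + t ^ 2) := by ring
      _ = 1 + t ^ 2 := by rw [hcs]; ring
  have hexp : Complex.exp (Complex.I * φ) =
      ((Real.cos φ : ℝ) : ℂ) * (1 + Complex.I * ((t : ℝ) : ℂ)) := by
    rw [mul_comm, Complex.exp_mul_I, ← Complex.ofReal_cos, ← Complex.ofReal_sin, hsin]
    push_cast
    ring
  rw [hexp, mul_assoc, Complex.im_ofReal_mul]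
  -- Since (1 + it)(1 - it) = s², the Schur complement of the last entry is g - k⊗k + i h + s² k⊗k /
  -- (1 - it) = g + i (h + t k⊗k), and the imaginary part of its determinant is linear in h + t k⊗k.
  have key : ((1 + Complex.I * ((t : ℝ) : ℂ)) *
      Matrix.det (!![((E - k₀ * k₀ : ℝ) : ℂ) + Complex.I * a,
        ((M - k₀ * k₁ : ℝ) : ℂ) + Complex.I * b, Complex.I * ((s * k₀ : ℝ) : ℂ);
        ((M - k₀ * k₁ : ℝ) : ℂ) + Complex.I * b', ((G - k₁ * k₁ : ℝ) : ℂ) + Complex.I * c,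
        Complex.I * ((s * k₁ : ℝ) : ℂ);
        Complex.I * ((s * k₀ : ℝ) : ℂ), Complex.I * ((s * k₁ : ℝ) : ℂ),
        1 + Complex.I * ((-t : ℝ) : ℂ)] : Matrix (Fin 3) (Fin 3) ℂ)).im =
      s ^ 2 * (G * a - M * (b + b') + E * c +
        t * (G * k₀ ^ 2 - 2 * M * (k₀ * k₁) + E * k₁ ^ 2)) := by
    simp [Matrix.det_fin_three]
    linear_combination -((G - k₁ * k₁) * a - (M - k₀ * k₁) * (b + b') + (E - k₀ * k₀) * c) * hst
  rw [key]
  linear_combination s * (G * a - M * (b + b') + E * c +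
        t * (G * k₀ ^ 2 - 2 * M * (k₀ * k₁) + E * k₁ ^ 2)) * hcs

/-- The splitting `ℝ³ = ℝ² × ℝ`. -/
noncomputable def cylSplit : Euc 3 ≃L[ℝ] Euc 2 × ℝ :=
  LinearEquiv.toContinuousLinearEquiv
    { toFun := fun z => (!₂[z 0, z 1], z 2)
      invFun := fun q => !₂[q.1 0, q.1 1, q.2]
      map_add' := fun a b => by
        refine Prod.ext ?_ rfl
        ext i; fin_cases i <;> rfl
      map_smul' := fun c a => by
        refine Prod.ext ?_ rfl
        ext i; fin_cases i <;> rfl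
      left_inv := fun a => by ext i; fin_cases i <;> rfl
      right_inv := fun q => by
        refine Prod.ext ?_ rfl
        ext i; fin_cases i <;> rfl }

/-- The projection of `ℝ³` to `ℝ²`. -/
noncomputable def cylBase : Euc 3 →L[ℝ] Euc 2 :=
  (ContinuousLinearMap.fst ℝ (Euc 2) ℝ).comp (cylSplit : Euc 3 →L[ℝ] Euc 2 × ℝ)

/-- The last coordinate of `ℝ³`. -/
noncomputable def cylHeight : Euc 3 →L[ℝ] ℝ :=
  (ContinuousLinearMap.snd ℝ (Euc 2) ℝ).comp (cylSplit : Euc 3 →L[ℝ] Euc 2 × ℝ)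

theorem cylBase_coordVec : cylBase (coordVec 0) = coordVec 0 ∧ cylBase (coordVec 1) = coordVec 1 ∧
    cylBase (coordVec 2) = 0 := by
  refine ⟨?_, ?_, ?_⟩ <;> ext i <;> fin_cases i <;>
    simp [cylBase, cylSplit, coordVec]

theorem cylHeight_coordVec : cylHeight (coordVec 0) = 0 ∧ cylHeight (coordVec 1) = 0 ∧
    cylHeight (coordVec 2) = 1 := by
  refine ⟨?_, ?_, ?_⟩ <;> simp [cylHeight, cylSplit, coordVec]

theorem cylBase_symm (y : Euc 2) (u : ℝ) : cylBase (cylSplit.symm (y, u)) = y := by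
  simp [cylBase]

theorem cylHeight_symm (y : Euc 2) (u : ℝ) : cylHeight (cylSplit.symm (y, u)) = u := by
  simp [cylHeight]

theorem euc_three_ext {a b : Euc 3} (h1 : cylBase a = cylBase b)
    (h2 : cylHeight a = cylHeight b) : a = b :=
  cylSplit.injective (Prod.ext h1 h2)

/-- The cylinder over the surface `g` with rulings parallel to `v`. -/
noncomputable def cylMap (v o : Euc N) (g : Euc 2 → Euc N) (z : Euc 3) : Euc N :=
  g (cylBase z) + (cylHeight z - height v o (g (cylBase z))) • v

/-- The 1-form `lam + sec φ d(u k) - tan φ u du` on a cylinder. -/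
noncomputable def cylForm (φ : ℝ) (v o : Euc N) (g : Euc 2 → Euc N)
    (lam : Euc 2 → (Euc 2 →L[ℝ] ℝ)) (z : Euc 3) : Euc 3 →L[ℝ] ℝ :=
  (lam (cylBase z)).comp cylBase +
    (1 / Real.cos φ) • (cylHeight z • ((innerSL ℝ v).comp (fderiv ℝ g (cylBase z))).comp cylBase +
      height v o (g (cylBase z)) • cylHeight) - (Real.tan φ * cylHeight z) • cylHeight

variable {v o : Euc N} {g : Euc 2 → Euc N} {lam : Euc 2 → (Euc 2 →L[ℝ] ℝ)} {z : Euc 3}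

theorem hasFDerivAt_height {E : Type*} [NormedAddCommGroup E] [NormedSpace ℝ E] {f : E → Euc N}
    {f' : E →L[ℝ] Euc N} {x : E} (hf : HasFDerivAt f f' x) :
    HasFDerivAt (fun z => height v o (f z)) ((innerSL ℝ v).comp f') x :=
  ((innerSL ℝ v).hasFDerivAt.comp x (hf.sub_const o))

theorem hasFDerivAt_cylMap (hg : DifferentiableAt ℝ g (cylBase z)) :
    HasFDerivAt (cylMap v o g) ((fderiv ℝ g (cylBase z)).comp cylBase +
      (cylHeight - ((innerSL ℝ v).comp (fderiv ℝ g (cylBase z))).comp cylBase).smulRight v) z := by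
  have h1 : HasFDerivAt (fun z => g (cylBase z)) ((fderiv ℝ g (cylBase z)).comp cylBase) z :=
    hg.hasFDerivAt.comp z cylBase.hasFDerivAt
  exact h1.add ((cylHeight.hasFDerivAt.sub (hasFDerivAt_height h1)).smul_const v)

theorem fderiv_fderiv_cylMap (hg : ContDiffAt ℝ ∞ g (cylBase z)) (a b : Euc 3) :
    fderiv ℝ (fderiv ℝ (cylMap v o g)) z a b =
      fderiv ℝ (fderiv ℝ g) (cylBase z) (cylBase a) (cylBase b) -
        ⟪v, fderiv ℝ (fderiv ℝ g) (cylBase z) (cylBase a) (cylBase b)⟫_ℝ • v := by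
  have hd : ∀ᶠ x in nhds z, DifferentiableAt ℝ g (cylBase x) := by
    refine cylBase.continuous.continuousAt.eventually ?_
    have : ContDiffAt ℝ 1 g (cylBase z) := hg.of_le (by simp)
    filter_upwards [this.eventually (by simp)] with x hx using hx.differentiableAt (by simp)
  have h1 : fderiv ℝ (cylMap v o g) =ᶠ[nhds z] fun z => (fderiv ℝ g (cylBase z)).comp cylBase +
      (cylHeight - ((innerSL ℝ v).comp (fderiv ℝ g (cylBase z))).comp cylBase).smulRight v := by
    filter_upwards [hd] with x hx using (hasFDerivAt_cylMap hx).fderiv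
  have hdd : HasFDerivAt (fun z => fderiv ℝ g (cylBase z))
      ((fderiv ℝ (fderiv ℝ g) (cylBase z)).comp cylBase) z :=
    ((hg.fderiv_right (m := ∞) (by simp)).differentiableAt (by simp)).hasFDerivAt.comp z
      cylBase.hasFDerivAt
  -- The differential of the cylinder is a fixed linear function `R` of that of `g`, up to a
  -- constant, so one chain rule gives the second derivative.
  let R : (Euc 2 →L[ℝ] Euc N) →L[ℝ] (Euc 3 →L[ℝ] Euc N) :=
    ((ContinuousLinearMap.compL ℝ (Euc 3) (Euc 2) (Euc N)).flip cylBase) -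
      (ContinuousLinearMap.smulRightL ℝ (Euc 3) (Euc N)).flip v ∘L
        ((ContinuousLinearMap.compL ℝ (Euc 3) (Euc 2) ℝ).flip cylBase) ∘L
          (ContinuousLinearMap.compL ℝ (Euc 2) (Euc N) ℝ (innerSL ℝ v))
  have h2 : (fun z => (fderiv ℝ g (cylBase z)).comp cylBase +
      (cylHeight - ((innerSL ℝ v).comp (fderiv ℝ g (cylBase z))).comp cylBase).smulRight v) =
      fun z => R (fderiv ℝ g (cylBase z)) + cylHeight.smulRight v := by
    funext x
    ext1 a
    simp [R, sub_smul]
    abel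
  have h3 : HasFDerivAt (fun z => R (fderiv ℝ g (cylBase z)) + cylHeight.smulRight v) _ z :=
    (R.hasFDerivAt.comp z hdd).add_const _
  rw [h1.fderiv_eq, h2, h3.fderiv]
  simp [R]

theorem fderiv_cylForm (φ : ℝ) (hg : ContDiffAt ℝ ∞ g (cylBase z))
    (hl : DifferentiableAt ℝ lam (cylBase z)) (a b : Euc 3) :
    fderiv ℝ (cylForm φ v o g lam) z a b =
      fderiv ℝ lam (cylBase z) (cylBase a) (cylBase b) +
      1 / Real.cos φ * (cylHeight a * ⟪v, fderiv ℝ g (cylBase z) (cylBase b)⟫_ℝ +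
        cylHeight z * ⟪v, fderiv ℝ (fderiv ℝ g) (cylBase z) (cylBase a) (cylBase b)⟫_ℝ +
        ⟪v, fderiv ℝ g (cylBase z) (cylBase a)⟫_ℝ * cylHeight b) -
      Real.tan φ * cylHeight a * cylHeight b := by
  have hg1 : HasFDerivAt (fun z => g (cylBase z)) ((fderiv ℝ g (cylBase z)).comp cylBase) z :=
    (hg.differentiableAt (by simp)).hasFDerivAt.comp z cylBase.hasFDerivAt
  have hdd : HasFDerivAt (fun z => fderiv ℝ g (cylBase z))
      ((fderiv ℝ (fderiv ℝ g) (cylBase z)).comp cylBase) z :=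
    ((hg.fderiv_right (m := ∞) (by simp)).differentiableAt (by simp)).hasFDerivAt.comp z
      cylBase.hasFDerivAt
  have hl1 : HasFDerivAt (fun z => lam (cylBase z)) ((fderiv ℝ lam (cylBase z)).comp cylBase) z :=
    hl.hasFDerivAt.comp z cylBase.hasFDerivAt
  have hl2 : HasFDerivAt (fun z => lam (cylBase z) (cylBase b)) _ z :=
    hl1.clm_apply (hasFDerivAt_const (cylBase b) z)
  have hk1 : HasFDerivAt (fun z => ⟪v, fderiv ℝ g (cylBase z) (cylBase b)⟫_ℝ) _ z :=
    (innerSL ℝ v).hasFDerivAt.comp z (hdd.clm_apply (hasFDerivAt_const (cylBase b) z))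
  have hk := hasFDerivAt_height (v := v) (o := o) hg1
  have hu : HasFDerivAt (fun z => cylHeight z) cylHeight z := cylHeight.hasFDerivAt
  have hall : HasFDerivAt (fun z => cylForm φ v o g lam z b) _ z :=
    (hl2.add (((hu.mul hk1).add (hk.mul_const (cylHeight b))).const_mul (1 / Real.cos φ))).sub
      ((hu.const_mul (Real.tan φ)).mul_const (cylHeight b))
  have hdiff : DifferentiableAt ℝ (cylForm φ v o g lam) z := by
    unfold cylForm
    have h1 := hl1.differentiableAt
    have h2 := hdd.differentiableAt
    have h3 := hk.differentiableAt
    fun_prop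
  have h1 : fderiv ℝ (cylForm φ v o g lam) z a b =
      fderiv ℝ (fun z => cylForm φ v o g lam z b) z a := by
    rw [fderiv_clm_apply hdiff (differentiableAt_const b)]
    simp
  rw [h1, hall.fderiv]
  simp
  ring

/-- The second derivatives of k = x⁰ ∘ g occur with coefficient u sec φ from d(uk) and with ⟪η, v⟫
from the shift along `v`. Both are absorbed by subtracting a multiple of `v` from `η`, leaving the
surface term and first-order terms. -/
theorem cylinder_twistForm (φ : ℝ) (hg : ContDiffAt ℝ ∞ g (cylBase z))
    (hl : DifferentiableAt ℝ lam (cylBase z)) (η : Euc N) (a b : Euc 3) :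
    twistForm (cylMap v o g) (cylForm φ v o g lam) z η a b =
      twistForm g lam (cylBase z) (η - (1 / Real.cos φ * cylHeight z + ⟪η, v⟫_ℝ) • v)
        (cylBase a) (cylBase b) +
      1 / Real.cos φ * (cylHeight a * ⟪v, fderiv ℝ g (cylBase z) (cylBase b)⟫_ℝ +
        ⟪v, fderiv ℝ g (cylBase z) (cylBase a)⟫_ℝ * cylHeight b) -
      Real.tan φ * cylHeight a * cylHeight b := by
  rw [twistForm_apply, twistForm_apply, fderiv_fderiv_cylMap hg, fderiv_cylForm φ hg hl]
  rw [inner_sub_left, inner_sub_right, inner_smul_right, real_inner_smul_left]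
  ring

/-- The cylinder frame consists of the surface frame made orthogonal to `v`, and of `v` itself, so
the metric is g - dk⊗dk next to 1. Its imaginary part comes from `cylinder_twistForm`; then
`im_phase_det_cylinder` and `trace_twistForm` evaluate the phase. -/
theorem phaseMatrix_cylinder (φ : ℝ) (hv : ‖v‖ = 1) (hφ : Real.cos φ ≠ 0)
    (hg : ContDiffAt ℝ ∞ g (cylBase z)) (hinj : Function.Injective (fderiv ℝ g (cylBase z)))
    (hl : DifferentiableAt ℝ lam (cylBase z)) {η : Euc N}
    (hη : ∀ a, ⟪η - (1 / Real.cos φ * cylHeight z + ⟪η, v⟫_ℝ) • v,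
      fderiv ℝ g (cylBase z) a⟫_ℝ = lam (cylBase z) a) :
    (Complex.exp (Complex.I * φ) *
      (phaseMatrix (cylMap v o g) (cylForm φ v o g lam) z η).det).im =
    1 / Real.cos φ * ((metricMatrix g (cylBase z)).det * (starDStar g lam (cylBase z) -
      ⟪η - (1 / Real.cos φ * cylHeight z + ⟪η, v⟫_ℝ) • v, meanCurvature g (cylBase z)⟫_ℝ +
      gradNormSq g (fun y => height v o (g y)) (cylBase z) * Real.tan φ)) := by
  set y := cylBase z with hy
  set η' := η - (1 / Real.cos φ * cylHeight z + ⟪η, v⟫_ℝ) • v with hη'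
  set A := fderiv ℝ g y with hA
  have hvv : ⟪v, v⟫_ℝ = 1 := by rw [real_inner_self_eq_norm_sq, hv]; norm_num
  have hk : ∀ a, fderiv ℝ (fun y => height v o (g y)) y a = ⟪v, A a⟫_ℝ := fun a => by
    rw [(hasFDerivAt_height (hg.differentiableAt (by simp)).hasFDerivAt).fderiv]; rfl
  have hdf : ∀ b, fderiv ℝ (cylMap v o g) z b =
      A (cylBase b) + (cylHeight b - ⟪v, A (cylBase b)⟫_ℝ) • v := fun b => by
    rw [(hasFDerivAt_cylMap (hg.differentiableAt (by simp))).fderiv]; rfl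
  obtain ⟨b0, b1, b2⟩ := cylBase_coordVec
  obtain ⟨t0, t1, t2⟩ := cylHeight_coordVec
  have hdet := metricMatrix_det_pos hinj
  have htr := trace_twistForm hg hinj hl hη
  have hM : ∀ i j, metricMatrix g y i j = ⟪A (coordVec i), A (coordVec j)⟫_ℝ := fun i j => rfl
  have hmat : phaseMatrix (cylMap v o g) (cylForm φ v o g lam) z η =
      !![((metricMatrix g y 0 0 - ⟪v, A (coordVec 0)⟫_ℝ * ⟪v, A (coordVec 0)⟫_ℝ : ℝ) : ℂ) +
          Complex.I * (twistForm g lam y η' (coordVec 0) (coordVec 0) : ℝ),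
        ((metricMatrix g y 0 1 - ⟪v, A (coordVec 0)⟫_ℝ * ⟪v, A (coordVec 1)⟫_ℝ : ℝ) : ℂ) +
          Complex.I * (twistForm g lam y η' (coordVec 1) (coordVec 0) : ℝ),
        Complex.I * ((1 / Real.cos φ * ⟪v, A (coordVec 0)⟫_ℝ : ℝ) : ℂ);
        ((metricMatrix g y 0 1 - ⟪v, A (coordVec 0)⟫_ℝ * ⟪v, A (coordVec 1)⟫_ℝ : ℝ) : ℂ) +
          Complex.I * (twistForm g lam y η' (coordVec 0) (coordVec 1) : ℝ),
        ((metricMatrix g y 1 1 - ⟪v, A (coordVec 1)⟫_ℝ * ⟪v, A (coordVec 1)⟫_ℝ : ℝ) : ℂ) +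
          Complex.I * (twistForm g lam y η' (coordVec 1) (coordVec 1) : ℝ),
        Complex.I * ((1 / Real.cos φ * ⟪v, A (coordVec 1)⟫_ℝ : ℝ) : ℂ);
        Complex.I * ((1 / Real.cos φ * ⟪v, A (coordVec 0)⟫_ℝ : ℝ) : ℂ),
        Complex.I * ((1 / Real.cos φ * ⟪v, A (coordVec 1)⟫_ℝ : ℝ) : ℂ),
        1 + Complex.I * ((-Real.tan φ : ℝ) : ℂ)] := by
    have hs : ∀ a, ⟪A a, v⟫_ℝ = ⟪v, A a⟫_ℝ := fun x => real_inner_comm _ _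
    have h01 := real_inner_comm (A (coordVec 0)) (A (coordVec 1))
    ext i j
    simp only [phaseMatrix, Matrix.of_apply, hdf, cylinder_twistForm φ hg hl, hM]
    fin_cases i <;> fin_cases j <;>
    simp only [Fin.zero_eta, Fin.mk_one, Fin.reduceFinMk, b0, b1, b2, t0, t1, t2, map_zero,
      zero_apply, inner_zero_left, inner_zero_right, inner_add_left, inner_add_right,
      real_inner_smul_left, inner_smul_right, hvv, hs, h01, Matrix.cons_val',
      Matrix.cons_val_zero, Matrix.cons_val_one, Matrix.cons_val, Matrix.cons_val_fin_one,
      ← hη', ← hA, ← hy] <;>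
    push_cast <;> ring
  rw [hmat, im_phase_det_cylinder hφ, gradNormSq_fin_two, hk, hk]
  congr 1
  have h1 : (metricMatrix g y).det * ((metricMatrix g y).det⁻¹ *
      (metricMatrix g y 1 1 * ⟪v, A (coordVec 0)⟫_ℝ ^ 2 -
        2 * metricMatrix g y 0 1 * (⟪v, A (coordVec 0)⟫_ℝ * ⟪v, A (coordVec 1)⟫_ℝ) +
        metricMatrix g y 0 0 * ⟪v, A (coordVec 1)⟫_ℝ ^ 2)) =
      (metricMatrix g y 1 1 * ⟪v, A (coordVec 0)⟫_ℝ ^ 2 -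
        2 * metricMatrix g y 0 1 * (⟪v, A (coordVec 0)⟫_ℝ * ⟪v, A (coordVec 1)⟫_ℝ) +
        metricMatrix g y 0 0 * ⟪v, A (coordVec 1)⟫_ℝ ^ 2) := by
    rw [← mul_assoc, mul_inv_cancel₀ hdet.ne', one_mul]
  linear_combination htr - Real.tan φ * h1

/-- Covectors representing the form on the cylinder correspond to covectors representing `lam`. -/
theorem cylinder_covector (φ : ℝ) (hg : DifferentiableAt ℝ g (cylBase z))
    {η : Euc N} : (∀ b, ⟪η, fderiv ℝ (cylMap v o g) z b⟫_ℝ = cylForm φ v o g lam z b) ↔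
      (⟪η, v⟫_ℝ = 1 / Real.cos φ * height v o (g (cylBase z)) - Real.tan φ * cylHeight z ∧
      ∀ a, ⟪η - (1 / Real.cos φ * cylHeight z + ⟪η, v⟫_ℝ) • v, fderiv ℝ g (cylBase z) a⟫_ℝ =
        lam (cylBase z) a) := by
  have hdf : ∀ b, fderiv ℝ (cylMap v o g) z b = fderiv ℝ g (cylBase z) (cylBase b) +
      (cylHeight b - ⟪v, fderiv ℝ g (cylBase z) (cylBase b)⟫_ℝ) • v := fun b => by
    rw [(hasFDerivAt_cylMap hg).fderiv]; rfl
  have hfo : ∀ b, cylForm φ v o g lam z b = lam (cylBase z) (cylBase b) +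
      1 / Real.cos φ * (cylHeight z * ⟪v, fderiv ℝ g (cylBase z) (cylBase b)⟫_ℝ +
        height v o (g (cylBase z)) * cylHeight b) - Real.tan φ * cylHeight z * cylHeight b :=
    fun b => rfl
  simp only [hdf, hfo, inner_add_right, inner_smul_right, inner_sub_left, real_inner_smul_left]
  constructor
  · intro h
    have h1 : ⟪η, v⟫_ℝ = 1 / Real.cos φ * height v o (g (cylBase z)) -
        Real.tan φ * cylHeight z := by
      have := h (cylSplit.symm (0, 1))
      simpa [cylBase_symm, cylHeight_symm] using this
    refine ⟨h1, fun a => ?_⟩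
    have h2 := h (cylSplit.symm (a, 0))
    simp only [cylBase_symm, cylHeight_symm] at h2
    linear_combination h2
  · rintro ⟨h1, h2⟩ b
    linear_combination h2 (cylBase b) + cylHeight b * h1

/-- The twisted-austere condition along a ruling of a cylinder over a surface. -/
theorem twistedAustereAt_cylinder_iff {φ : ℝ} (hv : ‖v‖ = 1) (hφ : Real.cos φ ≠ 0) {y : Euc 2}
    (hg : ContDiffAt ℝ ∞ g y) (hinj : Function.Injective (fderiv ℝ g y))
    (hl : DifferentiableAt ℝ lam y) :
    (∀ z, cylBase z = y → TwistedAustereAt φ (cylMap v o g) (cylForm φ v o g lam) z) ↔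
      (∀ a b, fderiv ℝ lam y a b = fderiv ℝ lam y b a) ∧ meanCurvature g y = 0 ∧
        starDStar g lam y = -(gradNormSq g (fun y => height v o (g y)) y * Real.tan φ) := by
  have hvv : ⟪v, v⟫_ℝ = 1 := by rw [real_inner_self_eq_norm_sq, hv]; norm_num
  constructor
  · intro h
    have key : ∀ η' : Euc N, (∀ a, ⟪η', fderiv ℝ g y a⟫_ℝ = lam y a) →
        (∀ a b, fderiv ℝ lam y a b = fderiv ℝ lam y b a) ∧
        starDStar g lam y - ⟪η', meanCurvature g y⟫_ℝ +
          gradNormSq g (fun y => height v o (g y)) y * Real.tan φ = 0 := by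
      intro η' hη'
      -- A given `η'` comes from a covector on the cylinder only at this height: the prescribed
      -- value of ⟪η, v⟫ requires u sec φ + ⟪η', v⟫ = 0. Reaching every `η'` thus uses the entire
      -- ruling.
      obtain ⟨u, hu⟩ : ∃ u : ℝ, u = -(Real.cos φ * ⟪η', v⟫_ℝ) := ⟨_, rfl⟩
      obtain ⟨z, hzy, hzu⟩ : ∃ z, cylBase z = y ∧ cylHeight z = u :=
        ⟨cylSplit.symm (y, u), cylBase_symm y u, cylHeight_symm y u⟩
      subst hzy
      set c : ℝ := 1 / Real.cos φ * height v o (g (cylBase z)) - Real.tan φ * u with hc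
      set η := η' + (1 / Real.cos φ * u + c) • v with hη
      have h1 : ⟪η, v⟫_ℝ = c := by
        rw [hη, inner_add_left, real_inner_smul_left, hvv, hu]
        field_simp
        ring
      have h2 : η - (1 / Real.cos φ * cylHeight z + ⟪η, v⟫_ℝ) • v = η' := by
        rw [h1, hzu, hη]; abel
      have h3 := h z rfl η ((cylinder_covector φ (hg.differentiableAt (by simp))).2
        ⟨by rw [h1, hc, hzu], fun a => by rw [h2]; exact hη' a⟩)
      have h4 := phaseMatrix_cylinder (o := o) φ hv hφ hg hinj hl (η := η)
        (fun a => by rw [h2]; exact hη' a)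
      rw [h3.2, h2] at h4
      constructor
      · intro a b
        have h5 := h3.1 (cylSplit.symm (a, 0)) (cylSplit.symm (b, 0))
        simp only [cylinder_twistForm φ hg hl, cylBase_symm, cylHeight_symm, twistForm_apply,
          symm_second_fderiv hg b a] at h5
        linarith
      · have h6 : 1 / Real.cos φ ≠ 0 := one_div_ne_zero hφ
        have h7 := (mul_eq_zero.1 h4.symm).resolve_left h6
        exact (mul_eq_zero.1 h7).resolve_left (metricMatrix_det_pos hinj).ne'
    obtain ⟨L, hL⟩ := (fderiv ℝ g y).exists_comp_eq_id_of_injective hinj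
    let η₀ : Euc N := (InnerProductSpace.toDual ℝ (Euc N)).symm ((lam y).comp L)
    have hη₀ : ∀ a, ⟪η₀, fderiv ℝ g y a⟫_ℝ = lam y a := fun a => by
      simp [η₀, InnerProductSpace.toDual_symm_apply, hL]
    have hperp : ∀ a, ⟪meanCurvature g y, fderiv ℝ g y a⟫_ℝ = 0 := by
      intro a
      have hmem : meanCurvature g y ∈ (LinearMap.range (fderiv ℝ g y).toLinearMap)ᗮ :=
        Submodule.sum_mem _ fun i _ => Submodule.sum_mem _ fun j _ => Submodule.smul_mem _ _
          (Submodule.starProjection_apply_mem _ _)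
      rw [real_inner_comm]
      exact (Submodule.mem_orthogonal _ _).1 hmem _ ⟨a, rfl⟩
    have h1 := key η₀ hη₀
    -- The mean curvature vector is normal, so adding it keeps the covector admissible; the
    -- difference of the two identities is ⟪H, H⟫ = 0.
    have h2 := key (η₀ + meanCurvature g y) fun a => by
      rw [inner_add_left, hperp, add_zero, hη₀]
    have h3 : meanCurvature g y = 0 := by
      rw [← inner_self_eq_zero (𝕜 := ℝ)]
      have := h2.2
      rw [inner_add_left] at this
      linarith [h1.2]
    refine ⟨h1.1, h3, ?_⟩
    have := h1.2
    rw [h3, inner_zero_right] at this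
    linarith
  · rintro ⟨h1, h2, h3⟩ z rfl η hη
    obtain ⟨hη1, hη2⟩ := (cylinder_covector φ (hg.differentiableAt (by simp))).1 hη
    constructor
    · intro a b
      simp only [cylinder_twistForm φ hg hl, twistForm_apply, h1 (cylBase a),
        symm_second_fderiv hg (cylBase a) (cylBase b)]
      ring
    · rw [phaseMatrix_cylinder φ hv hφ hg hinj hl hη2, h2, h3, inner_zero_right]
      ring

end CylinderCalculus

/-! ### Change of parametrization. -/

section ChangeOfChart

variable {X : Type*} [TopologicalSpace X] {V : Type*} [NormedAddCommGroup V] [NormedSpace ℝ V]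
  [FiniteDimensional ℝ V] {k : ℕ} {F : X → V} {μ : X → (V →L[ℝ] ℝ)}

theorem IsLocalParam.localForm_transition {ψ ψ' : OpenPartialHomeomorph (Euc k) X}
    (hψ : IsLocalParam F ψ) (hψ' : IsLocalParam F ψ') {w : Euc k} (hw : w ∈ ψ.source)
    (hw' : ψ w ∈ ψ'.target) : localForm F μ ψ w =
      (localForm F μ ψ' (ψ'.symm (ψ w))).comp (fderiv ℝ (fun z => ψ'.symm (ψ z)) w) :=
  localForm_comp F μ ψ' id ψ (ψ'.eventually_symm_comp (ψ.continuousAt hw) hw')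
    ((hψ.contDiffAt_transition hψ' hw hw').differentiableAt (by simp))
    (hψ'.differentiableAt (ψ'.map_target hw'))

/-- Smoothness of a 1-form can be checked in an atlas. -/
theorem isSmoothForm_of_forall_exists (h : ∀ x : X, ∃ ψ : OpenPartialHomeomorph (Euc k) X,
    IsLocalParam F ψ ∧ x ∈ ψ.target ∧ ContDiffOn ℝ ∞ (localForm F μ ψ) ψ.source) :
    IsSmoothForm k F μ := by
  intro ψ hψ w hw
  obtain ⟨ψ', hψ', hx, hs⟩ := h (ψ w)
  have hev : ∀ᶠ z in nhds w, z ∈ ψ.source ∧ ψ z ∈ ψ'.target :=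
    Filter.Eventually.and (ψ.open_source.mem_nhds hw)
      ((ψ.continuousAt hw).eventually (ψ'.open_target.mem_nhds hx))
  have h1 : localForm F μ ψ =ᶠ[nhds w] fun z => (localForm F μ ψ' (ψ'.symm (ψ z))).comp
      (fderiv ℝ (fun z => ψ'.symm (ψ z)) z) := by
    filter_upwards [hev] with z hz using hψ.localForm_transition hψ' hz.1 hz.2
  have hσ := hψ.contDiffAt_transition hψ' hw hx
  have h2 : ContDiffAt ℝ ∞ (fun z => localForm F μ ψ' (ψ'.symm (ψ z))) w :=
    ContDiffAt.comp (f := fun z => ψ'.symm (ψ z)) w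
      (hs.contDiffAt (ψ'.open_source.mem_nhds (ψ'.map_target hx))) hσ
  have h3 : ContDiffAt ℝ ∞ (fderiv ℝ (fun z => ψ'.symm (ψ z))) w := hσ.fderiv_right (by simp)
  exact ((h2.clm_comp h3).congr_of_eventuallyEq h1).contDiffWithinAt

theorem TwistedAustereAt.congr {N : ℕ} {φ : ℝ} {f : Euc k → Euc N}
    {α β : Euc k → (Euc k →L[ℝ] ℝ)} {w : Euc k} (h : TwistedAustereAt φ f α w)
    (hαβ : α =ᶠ[nhds w] β) : TwistedAustereAt φ f β w := by
  have h1 : twistForm f α w = twistForm f β w := by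
    funext η; simp only [twistForm, hαβ.fderiv_eq]
  have h2 : phaseMatrix f α w = phaseMatrix f β w := by
    funext η; simp only [phaseMatrix, h1]
  intro η hη
  rw [← hαβ.self_of_nhds] at hη
  have := h η hη
  rwa [h1, h2] at this

end ChangeOfChart

/-! ### Cylinders over immersed surfaces, and the converse part. -/

section Cylinder

variable {N : ℕ} {X : Type*} [TopologicalSpace X] {Y : Type*} [TopologicalSpace Y] {v o : Euc N}
  {F : X → Euc N} {G : Y → Euc N} {p : X → Y} {φ : ℝ} {lam : Y → (Euc N →L[ℝ] ℝ)}
  {μ : X → (Euc N →L[ℝ] ℝ)} {χ : OpenPartialHomeomorph (Euc 2) Y}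

/-- The local parametrization of a cylinder induced by one of the base surface. -/
noncomputable def IsLineUnion.cylParam (hU : IsLineUnion v o F G p)
    (χ : OpenPartialHomeomorph (Euc 2) Y) : OpenPartialHomeomorph (Euc 3) X :=
  (cylSplit.toHomeomorph.toOpenPartialHomeomorph.trans
    (χ.prod (OpenPartialHomeomorph.refl ℝ))).trans
      hU.homeomorph.homeomorph.symm.toOpenPartialHomeomorph

namespace IsLineUnion

variable (hU : IsLineUnion v o F G p)

theorem mem_cylParam_source {z : Euc 3} : z ∈ (hU.cylParam χ).source ↔ cylBase z ∈ χ.source := by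
  simp [cylParam, cylBase]

theorem mem_cylParam_target {x : X} : x ∈ (hU.cylParam χ).target ↔ p x ∈ χ.target := by
  simp [cylParam]

theorem pair_cylParam (z : Euc 3) : (p (hU.cylParam χ z), height v o (F (hU.cylParam χ z))) =
    (χ (cylBase z), cylHeight z) :=
  hU.homeomorph.homeomorph.apply_symm_apply (χ (cylBase z), cylHeight z)

theorem proj_cylParam (z : Euc 3) : p (hU.cylParam χ z) = χ (cylBase z) :=
  congrArg Prod.fst (hU.pair_cylParam z)

theorem height_cylParam (z : Euc 3) : height v o (F (hU.cylParam χ z)) = cylHeight z :=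
  congrArg Prod.snd (hU.pair_cylParam z)

theorem eq_add (hv : ‖v‖ = 1) (hU : IsLineUnion v o F G p) (x : X) :
    F x = G (p x) + (height v o (F x) - height v o (G (p x))) • v := by
  obtain ⟨s, hs⟩ := hU.on_line x
  have : height v o (F x) - height v o (G (p x)) = s := by
    rw [height, height, ← inner_sub_right, hs]
    have : G (p x) + s • v - o - (G (p x) - o) = s • v := by abel
    rw [this, inner_smul_right, real_inner_self_eq_norm_sq, hv]
    ring
  rw [this]
  exact hs

theorem comp_cylParam (hv : ‖v‖ = 1) : F ∘ hU.cylParam χ = cylMap v o (G ∘ χ) := by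
  funext z
  rw [Function.comp_apply, eq_add hv hU, hU.height_cylParam, hU.proj_cylParam]
  rfl

theorem contDiffAt_cylMap {g : Euc 2 → Euc N} {z : Euc 3} (hg : ContDiffAt ℝ ∞ g (cylBase z)) :
    ContDiffAt ℝ ∞ (cylMap v o g) z := by
  have h1 : ContDiffAt ℝ ∞ (fun z => g (cylBase z)) z := hg.comp z cylBase.contDiff.contDiffAt
  exact h1.add ((cylHeight.contDiff.contDiffAt.sub
    (contDiffAt_const.inner ℝ (h1.sub contDiffAt_const))).smul contDiffAt_const)

/-- A kernel vector with nonzero coefficient of `v` would exhibit `v` as tangent to the surface,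
against transversality. Without it, immersivity of `G ∘ χ` kills the base part, and then the height
part vanishes. -/
theorem isLocalParam_cylParam (hv : ‖v‖ = 1) (hχ : IsLocalParam G χ) :
    IsLocalParam F (hU.cylParam χ) := by
  constructor
  · intro z hz
    rw [hU.comp_cylParam hv]
    exact (contDiffAt_cylMap (hχ.contDiffAt (hU.mem_cylParam_source.1 hz))).contDiffWithinAt
  · intro z hz
    have hy := hU.mem_cylParam_source.1 hz
    rw [hU.comp_cylParam hv, (hasFDerivAt_cylMap (hχ.differentiableAt hy)).fderiv]
    rw [injective_iff_map_eq_zero]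
    intro b hb
    set s := cylHeight b - ⟪v, fderiv ℝ (G ∘ χ) (cylBase z) (cylBase b)⟫_ℝ with hs
    have hb' : fderiv ℝ (G ∘ χ) (cylBase z) (cylBase b) + s • v = 0 := hb
    have hs0 : s = 0 := by
      by_contra hne
      refine hU.transverse (χ (cylBase z)) ⟨χ, hχ, _, hy, rfl, (-s⁻¹) • cylBase b, ?_⟩
      rw [map_smul, eq_neg_of_add_eq_zero_left hb', smul_neg, neg_smul, neg_neg, smul_smul,
        inv_mul_cancel₀ hne, one_smul]
    rw [hs0, zero_smul, add_zero] at hb'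
    have h1 : cylBase b = 0 := hχ.immersive _ hy (by rw [hb', map_zero])
    refine euc_three_ext (by rw [h1, map_zero]) ?_
    rw [map_zero]
    rw [h1] at hs
    simpa [hs0] using hs.symm

/-- The form of a twisted-austere cylinder in the parametrization induced by the base. -/
theorem cylinderForm_cylParam (φ : ℝ) (lam : Y → (Euc N →L[ℝ] ℝ)) (hχ : IsLocalParam G χ)
    {z : Euc 3} (hz : cylBase z ∈ χ.source) :
    localForm (G ∘ p) (lam ∘ p) (hU.cylParam χ) z
      + (1 / Real.cos φ) • fderiv ℝ (fun z => height v o (F (hU.cylParam χ z)) *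
          height v o (G (p (hU.cylParam χ z)))) z
      - (Real.tan φ * height v o (F (hU.cylParam χ z))) •
          fderiv ℝ (fun z => height v o (F (hU.cylParam χ z))) z =
    cylForm φ v o (G ∘ χ) (localForm G lam χ) z := by
  have h1 : localForm (G ∘ p) (lam ∘ p) (hU.cylParam χ) z =
      (localForm G lam χ (cylBase z)).comp cylBase := by
    rw [localForm_comp G lam χ p (hU.cylParam χ) (σ := cylBase)
      (Filter.Eventually.of_forall hU.proj_cylParam) cylBase.differentiableAt
      (hχ.differentiableAt hz), cylBase.fderiv]
  have hg1 : HasFDerivAt (fun z => (G ∘ χ) (cylBase z))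
      ((fderiv ℝ (G ∘ χ) (cylBase z)).comp cylBase) z :=
    (hχ.differentiableAt hz).hasFDerivAt.comp z cylBase.hasFDerivAt
  have hk := hasFDerivAt_height (v := v) (o := o) hg1
  have h2 : (fun z => height v o (F (hU.cylParam χ z))) = fun z => cylHeight z :=
    funext hU.height_cylParam
  have h3 : (fun z => height v o (F (hU.cylParam χ z)) * height v o (G (p (hU.cylParam χ z)))) =
      fun z => cylHeight z * height v o ((G ∘ χ) (cylBase z)) := by
    funext z
    rw [hU.height_cylParam, hU.proj_cylParam, Function.comp_apply]
  have h4 : HasFDerivAt (fun z => cylHeight z * height v o ((G ∘ χ) (cylBase z))) _ z :=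
    cylHeight.hasFDerivAt.mul hk
  rw [h1, h3, h4.fderiv, h2, cylHeight.fderiv, hU.height_cylParam]
  rfl

theorem isSubmanifold (hv : ‖v‖ = 1) (hU : IsLineUnion v o F G p) (hG : IsSubmanifold 2 G) :
    IsSubmanifold 3 F := by
  have := hG.hausdorff
  have := hG.secondCountable
  let Θ := hU.homeomorph.homeomorph
  refine ⟨Θ.isEmbedding.t2Space, Θ.isEmbedding.secondCountableTopology, fun x => ?_⟩
  obtain ⟨χ, hχ, hy⟩ := hG.exists_param (p x)
  exact ⟨hU.cylParam χ, hU.isLocalParam_cylParam hv hχ, hU.mem_cylParam_target.2 hy⟩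

end IsLineUnion

theorem contDiffAt_cylForm {g : Euc 2 → Euc N} {l : Euc 2 → (Euc 2 →L[ℝ] ℝ)} {z : Euc 3}
    (hg : ContDiffAt ℝ ∞ g (cylBase z)) (hl : ContDiffAt ℝ ∞ l (cylBase z)) :
    ContDiffAt ℝ ∞ (cylForm φ v o g l) z := by
  have h1 : ContDiffAt ℝ ∞ (fun z => g (cylBase z)) z := hg.comp z cylBase.contDiff.contDiffAt
  have h2 : ContDiffAt ℝ ∞ (fun z => fderiv ℝ g (cylBase z)) z :=
    (hg.fderiv_right (m := ∞) (by simp)).comp z cylBase.contDiff.contDiffAt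
  have h3 : ContDiffAt ℝ ∞ (fun z => l (cylBase z)) z := hl.comp z cylBase.contDiff.contDiffAt
  have h4 : ContDiffAt ℝ ∞ (fun z => height v o (g (cylBase z))) z :=
    contDiffAt_const.inner ℝ (h1.sub contDiffAt_const)
  have hu : ContDiffAt ℝ ∞ (fun z => cylHeight z) z := cylHeight.contDiff.contDiffAt
  exact ((h3.clm_comp contDiffAt_const).add (((hu.smul
    ((contDiffAt_const.clm_comp h2).clm_comp contDiffAt_const)).add
      (h4.smul contDiffAt_const)).const_smul _)).sub
        ((contDiffAt_const.mul hu).smul contDiffAt_const)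

/-- Cylinders over minimal surfaces carry twisted-austere structures. -/
theorem isTwistedAustere_of_isCylinderForm {n : ℕ} {θ : ℝ} {v o : Euc (n + 1)}
    {F : X → Euc (n + 1)} {G : Y → Euc (n + 1)} {lam : Y → (Euc (n + 1) →L[ℝ] ℝ)}
    {μ : X → (Euc (n + 1) →L[ℝ] ℝ)} (hv : ‖v‖ = 1)
    (hφ : Real.cos (cophase (n + 1) 3 θ) ≠ 0) (hG : IsMinimalSubmanifold 2 G)
    (hl : IsAdmissibleForm (cophase (n + 1) 3 θ) v o G lam) (hU : IsLineUnion v o F G p)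
    (hμ : IsCylinderForm (cophase (n + 1) 3 θ) v o F G p lam μ) : IsTwistedAustere 3 θ F μ := by
  have hform : ∀ χ : OpenPartialHomeomorph (Euc 2) Y, IsLocalParam G χ →
      ∀ z ∈ (hU.cylParam χ).source, localForm F μ (hU.cylParam χ) z =
        cylForm (cophase (n + 1) 3 θ) v o (G ∘ χ) (localForm G lam χ) z := fun χ hχ z hz => by
    rw [← hU.cylinderForm_cylParam _ lam hχ (hU.mem_cylParam_source.1 hz)]
    exact hμ _ (hU.isLocalParam_cylParam hv hχ) z hz
  refine isTwistedAustere_of_twistedAustereAt (IsLineUnion.isSubmanifold hv hU hG.submanifold)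
    (isSmoothForm_of_forall_exists fun x => ?_) fun x => ?_
  · obtain ⟨χ, hχ, hy⟩ := hG.submanifold.exists_param (p x)
    refine ⟨hU.cylParam χ, hU.isLocalParam_cylParam hv hχ, hU.mem_cylParam_target.2 hy, ?_⟩
    refine ContDiffOn.congr (fun z hz => ?_) (hform χ hχ)
    have hz' := hU.mem_cylParam_source.1 hz
    exact (contDiffAt_cylForm (hχ.contDiffAt hz')
      ((hl.smooth χ hχ).contDiffAt (χ.open_source.mem_nhds hz'))).contDiffWithinAt
  · obtain ⟨χ, hχ, hy⟩ := hG.submanifold.exists_param (p x)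
    refine ⟨hU.cylParam χ, hU.isLocalParam_cylParam hv hχ, hU.mem_cylParam_target.2 hy, ?_⟩
    intro z hz
    have hz' := hU.mem_cylParam_source.1 hz
    rw [hU.comp_cylParam hv]
    refine TwistedAustereAt.congr
      (α := cylForm (cophase (n + 1) 3 θ) v o (G ∘ χ) (localForm G lam χ)) ?_ ?_
    · exact (twistedAustereAt_cylinder_iff hv hφ (hχ.contDiffAt hz') (hχ.immersive _ hz')
        (((hl.smooth χ hχ).contDiffAt (χ.open_source.mem_nhds hz')).differentiableAt (by simp))).2
        ⟨hl.closed χ hχ _ hz', hG.minimal χ hχ _ hz', hl.codiff χ hχ _ hz'⟩ z rfl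
    · filter_upwards [(hU.cylParam χ).open_source.mem_nhds hz] with z' hz'
      exact (hform χ hχ z' hz').symm

/-- The equation of a cylinder form can be checked in the parametrizations induced by the base. -/
theorem isCylinderForm_of_cylParam (hv : ‖v‖ = 1) (hG : IsSubmanifold 2 G)
    (hU : IsLineUnion v o F G p)
    (h : ∀ χ : OpenPartialHomeomorph (Euc 2) Y, IsLocalParam G χ →
      ∀ z ∈ (hU.cylParam χ).source, localForm F μ (hU.cylParam χ) z =
        cylForm φ v o (G ∘ χ) (localForm G lam χ) z) : IsCylinderForm φ v o F G p lam μ := by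
  intro ψ hψ w hw
  obtain ⟨χ, hχ, hy⟩ := hG.exists_param (p (ψ w))
  set ψ' := hU.cylParam χ with hψ'd
  have hψ' : IsLocalParam F ψ' := hU.isLocalParam_cylParam hv hχ
  have hw' : ψ w ∈ ψ'.target := hU.mem_cylParam_target.2 hy
  set σ : Euc 3 → Euc 3 := fun z => ψ'.symm (ψ z) with hσd
  have hσ : DifferentiableAt ℝ σ w :=
    (hψ.contDiffAt_transition hψ' hw hw').differentiableAt (by simp)
  have hσs : σ w ∈ ψ'.source := ψ'.map_target hw'
  have hσb : cylBase (σ w) ∈ χ.source := hU.mem_cylParam_source.1 hσs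
  have hev : (fun z => ψ z) =ᶠ[nhds w] fun z => ψ' (σ z) :=
    ψ'.eventually_symm_comp (ψ.continuousAt hw) hw'
  have hgd : DifferentiableAt ℝ (fun z => (G ∘ χ) (cylBase z)) (σ w) :=
    (hχ.differentiableAt hσb).comp (σ w) cylBase.differentiableAt
  have hGp : (G ∘ p) ∘ ψ' = fun z => (G ∘ χ) (cylBase z) := by
    funext z
    simp only [Function.comp_apply, hψ'd, hU.proj_cylParam]
  have h1 : localForm (G ∘ p) (lam ∘ p) ψ w =
      (localForm (G ∘ p) (lam ∘ p) ψ' (σ w)).comp (fderiv ℝ σ w) :=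
    localForm_comp (G ∘ p) (lam ∘ p) ψ' id ψ hev hσ (hGp ▸ hgd)
  have hfd : ∀ f : X → ℝ, DifferentiableAt ℝ (fun z => f (ψ' z)) (σ w) →
      fderiv ℝ (fun z => f (ψ z)) w = (fderiv ℝ (fun z => f (ψ' z)) (σ w)).comp (fderiv ℝ σ w) := by
    intro f hf
    have : (fun z => f (ψ z)) =ᶠ[nhds w] (fun z => f (ψ' z)) ∘ σ := hev.fun_comp f
    rw [this.fderiv_eq]
    exact fderiv_comp w hf hσ
  have hu : DifferentiableAt ℝ (fun z => height v o (F (ψ' z))) (σ w) :=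
    (hasFDerivAt_height (hψ'.differentiableAt hσs).hasFDerivAt).differentiableAt
  have hk : DifferentiableAt ℝ (fun z => height v o (G (p (ψ' z)))) (σ w) := by
    have : (fun z => height v o (G (p (ψ' z)))) = fun z => height v o ((G ∘ χ) (cylBase z)) := by
      funext z
      simp only [hψ'd, hU.proj_cylParam, Function.comp_apply]
    rw [this]
    exact (hasFDerivAt_height hgd.hasFDerivAt).differentiableAt
  have hw2 : height v o (F (ψ w)) = height v o (F (ψ' (σ w))) :=
    congrArg (fun x => height v o (F x)) hev.self_of_nhds
  rw [hψ.localForm_transition hψ' hw hw', h1,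
    hfd (fun x => height v o (F x) * height v o (G (p x))) (hu.mul hk),
    hfd (fun x => height v o (F x)) hu, hw2]
  change (localForm F μ ψ' (σ w)).comp (fderiv ℝ σ w) = _
  -- Every term has been pulled back through the same transition map `σ`, so the identity in the
  -- induced parametrization transfers.
  rw [h χ hχ _ hσs, ← hU.cylinderForm_cylParam _ lam hχ hσb]
  rfl

/-- On a twisted-austere cylinder the base is minimal and the form on it is admissible. -/
theorem isMinimal_and_isAdmissible_of_cylParam {n : ℕ} {θ : ℝ} {v o : Euc (n + 1)}
    {F : X → Euc (n + 1)} {G : Y → Euc (n + 1)} {lam : Y → (Euc (n + 1) →L[ℝ] ℝ)}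
    {μ : X → (Euc (n + 1) →L[ℝ] ℝ)} (hv : ‖v‖ = 1)
    (hφ : Real.cos (cophase (n + 1) 3 θ) ≠ 0) (hG : IsSubmanifold 2 G)
    (hl : IsSmoothForm 2 G lam) (hU : IsLineUnion v o F G p) (hF : IsTwistedAustere 3 θ F μ)
    (h : ∀ χ : OpenPartialHomeomorph (Euc 2) Y, IsLocalParam G χ →
      ∀ z ∈ (hU.cylParam χ).source, localForm F μ (hU.cylParam χ) z =
        cylForm (cophase (n + 1) 3 θ) v o (G ∘ χ) (localForm G lam χ) z) :
    IsMinimalSubmanifold 2 G ∧ IsAdmissibleForm (cophase (n + 1) 3 θ) v o G lam := by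
  have key : ∀ χ : OpenPartialHomeomorph (Euc 2) Y, IsLocalParam G χ → ∀ y ∈ χ.source,
      (∀ a b, fderiv ℝ (localForm G lam χ) y a b = fderiv ℝ (localForm G lam χ) y b a) ∧
        meanCurvature (G ∘ χ) y = 0 ∧ starDStar (G ∘ χ) (localForm G lam χ) y =
          -(gradNormSq (G ∘ χ) (fun y => height v o ((G ∘ χ) y)) y *
            Real.tan (cophase (n + 1) 3 θ)) := by
    intro χ hχ y hy
    refine (twistedAustereAt_cylinder_iff hv hφ (hχ.contDiffAt hy) (hχ.immersive _ hy)
      (((hl χ hχ).contDiffAt (χ.open_source.mem_nhds hy)).differentiableAt (by simp))).1 ?_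
    rintro z rfl
    have hz : z ∈ (hU.cylParam χ).source := hU.mem_cylParam_source.2 hy
    have h1 := hF.twistedAustereAt (hU.isLocalParam_cylParam hv hχ) hz
    rw [hU.comp_cylParam hv] at h1
    refine h1.congr ?_
    filter_upwards [(hU.cylParam χ).open_source.mem_nhds hz] with z' hz' using h χ hχ z' hz'
  exact ⟨⟨hG, fun χ hχ y hy => (key χ hχ y hy).2.1⟩, ⟨hl, fun χ hχ y hy => (key χ hχ y hy).1,
    fun χ hχ y hy => (key χ hχ y hy).2.2⟩⟩

end Cylinder

/-! ### Rigidity of the phase along a degenerate pencil. -/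

section PhaseRigidity

/-- For real symmetric `h` the number z* h z is real, so the term i h is invisible in the real part.
-/
theorem re_quadratic_form (g h : Matrix (Fin 3) (Fin 3) ℝ) (hg : g.IsSymm) (hh : h.IsSymm)
    (z : Fin 3 → ℂ) :
    (star z ⬝ᵥ (Matrix.of fun i j => (g i j : ℂ) + Complex.I * (h i j : ℂ)).mulVec z).re =
      (∑ i, ∑ j, g i j * (z i).re * (z j).re) + ∑ i, ∑ j, g i j * (z i).im * (z j).im := by
  have g1 := hg.apply 0 1
  have g2 := hg.apply 0 2
  have g3 := hg.apply 1 2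
  have h1 := hh.apply 0 1
  have h2 := hh.apply 0 2
  have h3 := hh.apply 1 2
  simp [dotProduct, Matrix.mulVec, Fin.sum_univ_three, g1, g2, g3, h1, h2, h3]
  ring

variable {g h : Matrix (Fin 3) (Fin 3) ℝ}

theorem eq_zero_of_re_quadratic_form (hg : g.IsSymm) (hh : h.IsSymm)
    (hpos : ∀ x : Fin 3 → ℝ, x ≠ 0 → 0 < ∑ i, ∑ j, g i j * x i * x j) {z : Fin 3 → ℂ}
    (hz : (star z ⬝ᵥ
      (Matrix.of fun i j => (g i j : ℂ) + Complex.I * (h i j : ℂ)).mulVec z).re = 0) : z = 0 := by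
  rw [re_quadratic_form g h hg hh] at hz
  have hnn : ∀ x : Fin 3 → ℝ, 0 ≤ ∑ i, ∑ j, g i j * x i * x j := fun x => by
    rcases eq_or_ne x 0 with rfl | hx
    · simp
    · exact (hpos x hx).le
  have h1 := hnn fun i => (z i).re
  have h2 := hnn fun i => (z i).im
  have hre : (fun i => (z i).re) = 0 := by
    by_contra hne
    linarith [hpos _ hne]
  have him : (fun i => (z i).im) = 0 := by
    by_contra hne
    linarith [hpos _ hne]
  funext i
  exact Complex.ext (congrFun hre i) (congrFun him i)

/-- If a phase condition holds along a pencil `g + i (h - s A)` with `A` of rank at most two, then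
`A` has rank two and the phase of the complementary entry is determined. -/
theorem phase_rigidity {φ a b c : ℝ} (hg : g.IsSymm) (hh : h.IsSymm)
    (hpos : ∀ x : Fin 3 → ℝ, x ≠ 0 → 0 < ∑ i, ∑ j, g i j * x i * x j) (hg2 : g 2 2 = 1)
    (hA : ¬(a = 0 ∧ b = 0 ∧ c = 0))
    (H : ∀ s : ℝ, (Complex.exp (Complex.I * φ) * Matrix.det (Matrix.of fun i j =>
      (g i j : ℂ) + Complex.I * ((h i j - s * (!![a, b, 0; b, c, 0; 0, 0, 0] :
        Matrix (Fin 3) (Fin 3) ℝ) i j : ℝ) : ℂ))).im = 0) :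
    Real.cos φ * h 2 2 + Real.sin φ = 0 := by
  set M : Matrix (Fin 3) (Fin 3) ℂ := Matrix.of fun i j => (g i j : ℂ) + Complex.I * (h i j : ℂ)
    with hM
  set ρ := Complex.exp (Complex.I * φ) with hρ
  -- The coefficients of s and s² in the determinant. There is no cubic term, because the last row
  -- and column of the pencil direction vanish.
  set P₁ : ℂ := -Complex.I * (a * M.adjugate 0 0 + b * (M.adjugate 0 1 + M.adjugate 1 0) +
    c * M.adjugate 1 1) with hP₁
  set P₂ : ℂ := -((a * c - b ^ 2 : ℝ) : ℂ) * M 2 2 with hP₂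
  have hexpand : ∀ s : ℝ, Matrix.det (Matrix.of fun i j =>
      (g i j : ℂ) + Complex.I * ((h i j - s * (!![a, b, 0; b, c, 0; 0, 0, 0] :
        Matrix (Fin 3) (Fin 3) ℝ) i j : ℝ) : ℂ)) = M.det + s * P₁ + s ^ 2 * P₂ := by
    intro s
    rw [Matrix.det_fin_three, hP₁, hP₂, Matrix.adjugate_fin_three, Matrix.det_fin_three]
    simp [hM]
    linear_combination (s ^ 2 * (a * c - b ^ 2) * (g 2 2 + Complex.I * h 2 2)) * Complex.I_sq
  have hPs : ∀ s : ℝ, (ρ * M.det).im + s * (ρ * P₁).im + s ^ 2 * (ρ * P₂).im = 0 := by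
    intro s
    rw [← H s, hexpand]
    have : ρ * (M.det + s * P₁ + s ^ 2 * P₂) =
        ρ * M.det + (s : ℝ) * (ρ * P₁) + ((s ^ 2 : ℝ) : ℂ) * (ρ * P₂) := by push_cast; ring
    rw [this, Complex.add_im, Complex.add_im, Complex.im_ofReal_mul, Complex.im_ofReal_mul]
  -- A quadratic polynomial vanishing at 0, 1 and -1 has zero coefficients.
  have h0 : (ρ * M.det).im = 0 := by simpa using hPs 0
  have h1 : (ρ * P₁).im = 0 := by linarith [hPs 1, hPs (-1)]
  have h2 : (ρ * P₂).im = 0 := by linarith [hPs 1, hPs (-1)]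
  by_cases hdet : a * c - b ^ 2 = 0
  · exfalso
    have hρn : ρ * star ρ = 1 := by
      rw [hρ, Complex.star_def, ← Complex.exp_conj, ← Complex.exp_add]
      simp
    -- In rank one the direction is ε e eᵀ, and the linear coefficient is -i ε eᵀ adj(M) e.
    obtain ⟨e, ε, he, hε, hPe⟩ : ∃ (e : Fin 3 → ℝ) (ε : ℝ), e ≠ 0 ∧ ε ≠ 0 ∧
        P₁ = -Complex.I * ε * ∑ i, (e i : ℂ) * (M.adjugate.mulVec fun j => (e j : ℂ)) i := by
      by_cases ha : a = 0
      · have hb : b = 0 := by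
          have : b ^ 2 = 0 := by rw [ha] at hdet; linarith
          exact pow_eq_zero_iff (by norm_num) |>.1 this
        refine ⟨![0, 1, 0], c, fun h => ?_, fun h => hA ⟨ha, hb, h⟩, ?_⟩
        · simpa using congrFun h 1
        · simp [hP₁, ha, hb, Matrix.mulVec, dotProduct, Fin.sum_univ_three]
          ring
      · refine ⟨![a, b, 0], a⁻¹, fun h => ha (by simpa using congrFun h 0), inv_ne_zero ha, ?_⟩
        have hc : c = b ^ 2 / a := by field_simp; linarith
        have ha' : (a : ℂ) ≠ 0 := by exact_mod_cast ha
        simp [hP₁, hc, Matrix.mulVec, dotProduct, Fin.sum_univ_three]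
        field_simp
        ring
    set z := M.adjugate.mulVec fun j => (e j : ℂ) with hz
    set q : ℂ := ∑ i, (e i : ℂ) * z i with hq
    have hMz : M.mulVec z = fun i => M.det * (e i : ℂ) := by
      rw [hz, Matrix.mulVec_mulVec, Matrix.mul_adjugate]
      funext i
      simp [Matrix.smul_mulVec]
    have hquad : star z ⬝ᵥ M.mulVec z = M.det * star q := by
      rw [hMz, hq]
      simp only [dotProduct, Pi.star_apply, star_sum, star_mul', Finset.mul_sum]
      refine Finset.sum_congr rfl fun i _ => ?_
      simp only [Complex.star_def, Complex.conj_ofReal]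
      ring
    have hqr : (ρ * (Complex.I * q)).im = 0 := by
      have h3 : ρ * P₁ = ((-ε : ℝ) : ℂ) * (ρ * (Complex.I * q)) := by
        rw [hPe]; push_cast; ring
      rw [h3, Complex.im_ofReal_mul] at h1
      exact (mul_eq_zero.1 h1).resolve_left (neg_ne_zero.2 hε)
    have hre : (star z ⬝ᵥ M.mulVec z).re = 0 := by
      have h3 : star (ρ * (Complex.I * q)) = ρ * (Complex.I * q) := by
        rw [Complex.star_def]; exact Complex.conj_eq_iff_im.2 hqr
      -- Both ρ det M and i ρ q are real and |ρ| = 1, so det M · q̄ is purely imaginary. It equals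
      -- z* M z, whose real part is positive definite in z; therefore z = 0.
      have h4 : M.det * star q = Complex.I * ((ρ * M.det) * (ρ * (Complex.I * q))) := by
        have h5 : star ρ * (-Complex.I * star q) = ρ * (Complex.I * q) := by
          rw [← h3]
          simp [star_mul']
        rw [← h5]
        have : Complex.I * (ρ * M.det * (star ρ * (-Complex.I * star q))) =
            (ρ * star ρ) * (-(Complex.I * Complex.I)) * (M.det * star q) := by ring
        rw [this, hρn, Complex.I_mul_I]
        ring
      rw [hquad, h4]
      simp only [Complex.mul_re, Complex.I_re, Complex.I_im, zero_mul, zero_sub, one_mul,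
        Complex.mul_im (ρ * M.det), h0, hqr]
      ring
    have hz0 := eq_zero_of_re_quadratic_form hg hh hpos hre
    -- From z = 0 and M z = det(M) e with e ≠ 0. This is absurd, since the positive definite real
    -- part makes M injective.
    have hdetM : M.det = 0 := by
      obtain ⟨i, hi⟩ := Function.ne_iff.1 he
      have h3 := congrFun hMz i
      rw [hz0, Matrix.mulVec_zero] at h3
      have h4 : (e i : ℂ) ≠ 0 := by exact_mod_cast hi
      exact (mul_eq_zero.1 h3.symm).resolve_right h4
    obtain ⟨y, hy, hy0⟩ := Matrix.exists_mulVec_eq_zero_iff.2 hdetM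
    refine hy (eq_zero_of_re_quadratic_form hg hh hpos ?_)
    change (star y ⬝ᵥ M.mulVec y).re = 0
    rw [hy0, dotProduct_zero, Complex.zero_re]
  -- In rank two the quadratic coefficient isolates the last diagonal entry 1 + i h₂₂, whose product
  -- with e^{iφ} must be real.
  · have h3 : ρ * P₂ = ((-(a * c - b ^ 2) : ℝ) : ℂ) * (ρ * M 2 2) := by
      rw [hP₂]; push_cast; ring
    rw [h3, Complex.im_ofReal_mul] at h2
    have h4 := (mul_eq_zero.1 h2).resolve_left (neg_ne_zero.2 hdet)
    have h5 : ρ = Complex.cos φ + Complex.sin φ * Complex.I := by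
      rw [hρ, mul_comm, Complex.exp_mul_I]
    rw [h5] at h4
    simpa [hM, hg2, Complex.cos_ofReal_re, Complex.sin_ofReal_re, Complex.cos_ofReal_im,
      Complex.sin_ofReal_im] using h4

end PhaseRigidity

/-! ### The second fundamental form and the ruling derivative of the form. -/

section SecondFundamentalForm

variable {N k : ℕ} {X : Type*} [TopologicalSpace X] {F : X → Euc N}

/-- A nonzero second fundamental form is detected by a normal vector in every parametrization. -/
theorem SecondFundFormNeZeroAt.exists_normal {ψ : OpenPartialHomeomorph (Euc k) X}
    (hψ : IsLocalParam F ψ) {w : Euc k} (hw : w ∈ ψ.source)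
    (h : SecondFundFormNeZeroAt k F (ψ w)) :
    ∃ κ : Euc N, (∀ a, ⟪κ, fderiv ℝ (F ∘ ψ) w a⟫_ℝ = 0) ∧
      ∃ a b, ⟪κ, fderiv ℝ (fderiv ℝ (F ∘ ψ)) w a b⟫_ℝ ≠ 0 := by
  obtain ⟨ψ', hψ', w', hw', hww, a, b, hab⟩ := h
  have hz : ψ' w' ∈ ψ.target := hww ▸ ψ.map_source hw
  set σ : Euc k → Euc k := fun z => ψ.symm (ψ' z) with hσ
  have hσw : σ w' = w := by rw [hσ]; simp only [hww, ψ.left_inv hw]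
  have hσs : ContDiffAt ℝ ∞ σ w' := hψ'.contDiffAt_transition hψ hw' hz
  set κ := secondFundForm (F ∘ ψ') w' a b with hκ
  have hκn : ∀ c, ⟪κ, fderiv ℝ (F ∘ ψ') w' c⟫_ℝ = 0 := fun c => by
    rw [real_inner_comm]
    exact (Submodule.mem_orthogonal _ _).1 (Submodule.starProjection_apply_mem _ _) _ ⟨c, rfl⟩
  have hκn' : ∀ c, ⟪κ, fderiv ℝ (F ∘ ψ) w c⟫_ℝ = 0 := fun c => by
    obtain ⟨d, hd⟩ := (hψ'.isTangentVector_iff hw').1 (hww ▸ (hψ.isTangentVector_iff hw).2 ⟨c, rfl⟩)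
    rw [← hd, hκn]
  refine ⟨κ, hκn', fderiv ℝ σ w' a, fderiv ℝ σ w' b, ?_⟩
  have hev : ∀ᶠ z in nhds w', z ∈ ψ'.source ∧ ψ' z ∈ ψ.target :=
    Filter.Eventually.and (ψ'.open_source.mem_nhds hw')
      ((ψ'.continuousAt hw').eventually (ψ.open_target.mem_nhds hz))
  have h1 : fderiv ℝ (F ∘ ψ') =ᶠ[nhds w'] fun z =>
      (fderiv ℝ (F ∘ ψ) (σ z)).comp (fderiv ℝ σ z) := by
    filter_upwards [hev] with z hz'
    exact hψ.fderiv_comp (ψ'.continuousAt hz'.1) hz'.2 (hψ'.contDiffAt hz'.1)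
  have hdd : HasFDerivAt (fun z => fderiv ℝ (F ∘ ψ) (σ z))
      ((fderiv ℝ (fderiv ℝ (F ∘ ψ)) w).comp (fderiv ℝ σ w')) w' := by
    have h2 : HasFDerivAt (fderiv ℝ (F ∘ ψ)) (fderiv ℝ (fderiv ℝ (F ∘ ψ)) w) (σ w') := by
      rw [hσw]
      exact ((hψ.contDiffAt_fderiv hw).differentiableAt (by simp)).hasFDerivAt
    exact h2.comp w' (hσs.differentiableAt (by simp)).hasFDerivAt
  have hσd : HasFDerivAt (fderiv ℝ σ) (fderiv ℝ (fderiv ℝ σ) w') w' :=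
    ((hσs.fderiv_right (m := ∞) (by simp)).differentiableAt (by simp)).hasFDerivAt
  -- The additional chain-rule term is tangent, so it disappears when paired with the normal vector
  -- `κ`.
  have h2 : fderiv ℝ (fderiv ℝ (F ∘ ψ')) w' a b =
      fderiv ℝ (fderiv ℝ (F ∘ ψ)) w (fderiv ℝ σ w' a) (fderiv ℝ σ w' b) +
        fderiv ℝ (F ∘ ψ) w (fderiv ℝ (fderiv ℝ σ) w' a b) := by
    rw [h1.fderiv_eq, (hdd.clm_comp hσd).fderiv]
    simp only [add_apply, ContinuousLinearMap.comp_apply, ContinuousLinearMap.compL_apply,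
      ContinuousLinearMap.flip_apply, hσw]
    rw [add_comm]
  have h3 := inner_secondFundForm (f := F ∘ ψ') (w := w') (η := κ) (τ := 0) (Submodule.zero_mem _)
    (fun c => by rw [hκn, inner_zero_left]) a b
  rw [inner_zero_left, sub_zero, h2, inner_add_right, hκn', add_zero] at h3
  rw [← h3]
  exact fun h => hab (inner_self_eq_zero.1 h)

/-- On a twisted-austere threefold with a parallel tangent direction, the derivative of the form
along that direction is determined by the phase wherever the second fundamental form is nonzero. -/
theorem TwistedAustereAt.phase_of_normal {φ : ℝ} {f : Euc 3 → Euc N}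
    {α : Euc 3 → (Euc 3 →L[ℝ] ℝ)} {w : Euc 3} {v : Euc N} (h : TwistedAustereAt φ f α w)
    (hf : ContDiffAt ℝ ∞ f w) (hinj : Function.Injective (fderiv ℝ f w)) (hv : ‖v‖ = 1)
    (hfv : ∀ᶠ z in nhds w, fderiv ℝ f z (coordVec 2) = v) {κ : Euc N}
    (hκ : ∀ a, ⟪κ, fderiv ℝ f w a⟫_ℝ = 0) {a b : Euc 3}
    (hab : ⟪κ, fderiv ℝ (fderiv ℝ f) w a b⟫_ℝ ≠ 0) :
    Real.cos φ * fderiv ℝ α w (coordVec 2) (coordVec 2) + Real.sin φ = 0 := by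
  have hdd : HasFDerivAt (fderiv ℝ f) (fderiv ℝ (fderiv ℝ f) w) w :=
    ((hf.fderiv_right (m := ∞) (by simp)).differentiableAt (by simp)).hasFDerivAt
  -- The partial derivative along the last coordinate is the constant `v`, so second derivatives in
  -- that direction vanish and the pencil has the degenerate shape of `phase_rigidity`.
  have hB2 : ∀ a, fderiv ℝ (fderiv ℝ f) w a (coordVec 2) = 0 := by
    intro a
    have h1 : HasFDerivAt (fun z => fderiv ℝ f z (coordVec 2))
        ((fderiv ℝ (fderiv ℝ f) w).flip (coordVec 2)) w := by
      simpa using hdd.clm_apply (hasFDerivAt_const (coordVec 2 : Euc 3) w)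
    have h2 : (fun z => fderiv ℝ f z (coordVec 2)) =ᶠ[nhds w] fun _ => v := hfv
    have h3 := (h1.unique (h2.hasFDerivAt_iff.2 (hasFDerivAt_const v w)))
    exact congrArg (fun T : Euc 3 →L[ℝ] Euc N => T a) h3
  have hsym := symm_second_fderiv hf
  have hB2' : ∀ a, fderiv ℝ (fderiv ℝ f) w (coordVec 2) a = 0 := fun a => by rw [hsym, hB2]
  obtain ⟨L, hL⟩ := (fderiv ℝ f w).exists_comp_eq_id_of_injective hinj
  let η₀ : Euc N := (InnerProductSpace.toDual ℝ (Euc N)).symm ((α w).comp L)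
  have hη₀ : ∀ a, ⟪η₀, fderiv ℝ f w a⟫_ℝ = α w a := fun a => by
    simp [η₀, InnerProductSpace.toDual_symm_apply, hL]
  -- Adding multiples of a normal vector stays in the fibre; this one-parameter family is the
  -- pencil.
  have hη : ∀ s : ℝ, ∀ a, ⟪η₀ + s • κ, fderiv ℝ f w a⟫_ℝ = α w a := fun s a => by
    rw [inner_add_left, real_inner_smul_left, hκ, mul_zero, add_zero, hη₀]
  set A := fderiv ℝ f w with hA
  set B := fderiv ℝ (fderiv ℝ f) w with hB
  let g : Matrix (Fin 3) (Fin 3) ℝ := Matrix.of fun i j => ⟪A (coordVec i), A (coordVec j)⟫_ℝ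
  let hm : Matrix (Fin 3) (Fin 3) ℝ := Matrix.of fun i j =>
    twistForm f α w η₀ (coordVec j) (coordVec i)
  have hg : g.IsSymm := Matrix.IsSymm.ext fun i j => by
    simp only [g, Matrix.of_apply]; exact real_inner_comm _ _
  have hh : hm.IsSymm := Matrix.IsSymm.ext fun i j => (h η₀ hη₀).1 _ _
  have hA2 : A (coordVec 2) = v := hfv.self_of_nhds
  have hg2 : g 2 2 = 1 := by
    change ⟪A (coordVec 2), A (coordVec 2)⟫_ℝ = 1
    rw [hA2, real_inner_self_eq_norm_sq, hv]; norm_num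
  have hpos : ∀ x : Fin 3 → ℝ, x ≠ 0 → 0 < ∑ i, ∑ j, g i j * x i * x j := by
    intro x hx
    have h1 : (∑ i, ∑ j, g i j * x i * x j) =
        ⟪A (∑ i, x i • coordVec i), A (∑ i, x i • coordVec i)⟫_ℝ := by
      simp only [map_sum, map_smul, sum_inner, inner_sum, real_inner_smul_left, inner_smul_right]
      refine Finset.sum_congr rfl fun i _ => ?_
      rw [Finset.mul_sum]
      refine Finset.sum_congr rfl fun j _ => ?_
      simp only [g, Matrix.of_apply]
      rw [real_inner_comm (A (coordVec i)) (A (coordVec j))]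
      ring
    rw [h1, real_inner_self_eq_norm_sq]
    have h2 : A (∑ i, x i • coordVec i) ≠ 0 := by
      intro h0
      apply hx
      have h3 : (WithLp.toLp 2 x : Euc 3) = ∑ i, x i • coordVec i := Euc.sum_smul_coordVec _
      have h4 : (WithLp.toLp 2 x : Euc 3) = 0 := by
        rw [h3]; exact hinj (by rw [h0, map_zero])
      funext i
      exact congrArg (fun y : Euc 3 => y i) h4
    positivity
  have hres := phase_rigidity (φ := φ) (a := ⟪κ, B (coordVec 0) (coordVec 0)⟫_ℝ)
    (b := ⟪κ, B (coordVec 0) (coordVec 1)⟫_ℝ) (c := ⟪κ, B (coordVec 1) (coordVec 1)⟫_ℝ)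
    hg hh hpos hg2 ?_ ?_
  · have h1 : hm 2 2 = fderiv ℝ α w (coordVec 2) (coordVec 2) := by
      simp only [hm, Matrix.of_apply, twistForm_apply, ← hB, hB2, inner_zero_right, sub_zero]
    rwa [h1] at hres
  · rintro ⟨h0, h1, h2⟩
    apply hab
    rw [Euc.sum_smul_coordVec a, Euc.sum_smul_coordVec b]
    simp [Fin.sum_univ_three, hB2, hB2', inner_add_right, inner_smul_right, h0, h1, h2,
      hsym (coordVec 1) (coordVec 0)]
  · intro s
    have hmat : phaseMatrix f α w (η₀ + s • κ) = Matrix.of fun i j => (g i j : ℂ) +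
        Complex.I * ((hm i j - s * (!![⟪κ, B (coordVec 0) (coordVec 0)⟫_ℝ,
          ⟪κ, B (coordVec 0) (coordVec 1)⟫_ℝ, 0; ⟪κ, B (coordVec 0) (coordVec 1)⟫_ℝ,
          ⟪κ, B (coordVec 1) (coordVec 1)⟫_ℝ, 0; 0, 0, 0] :
            Matrix (Fin 3) (Fin 3) ℝ) i j : ℝ) : ℂ) := by
      ext i j
      simp only [phaseMatrix, Matrix.of_apply, twistForm_apply, ← hB, ← hA, hm, g, inner_add_left,
        real_inner_smul_left]
      fin_cases i <;> fin_cases j <;> simp [hB2, hB2', hsym (coordVec 1) (coordVec 0)] <;> ring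
    rw [← hmat]
    exact (h _ (hη s)).2

end SecondFundamentalForm

/-! ### Local injectivity and unique lifting through an immersion. -/

section Rulings

variable {k : ℕ} {X : Type*} [TopologicalSpace X] {V : Type*} [NormedAddCommGroup V]
  [NormedSpace ℝ V] {F : X → V}

theorem IsLocalParam.exists_graph [FiniteDimensional ℝ V] {ψ : OpenPartialHomeomorph (Euc k) X}
    (hψ : IsLocalParam F ψ) {x : X} (hx : x ∈ ψ.target) :
    ∃ (χ : OpenPartialHomeomorph (Euc k) X) (L : V →L[ℝ] Euc k), IsLocalParam F χ ∧
      x ∈ χ.target ∧ ∀ w ∈ χ.source, L (F (χ w)) = w := by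
  obtain ⟨L, hL⟩ := (fderiv ℝ (F ∘ ψ) (ψ.symm x)).exists_comp_eq_id_of_injective
    (hψ.immersive _ (ψ.map_target hx))
  obtain ⟨χ, hχ, hxχ, hLχ⟩ := hψ.exists_graphParam (ψ.map_target hx) L
    (fun a b hab => by simpa [hL] using hab)
  rw [ψ.right_inv hx] at hxχ
  exact ⟨χ, L, hχ, hxχ, hLχ⟩

/-- On the image of a graph parametrization `L ∘ F` is its inverse. Together with Hausdorffness this
makes continuous lifts through `F` unique, which is how rulings are compared. -/
theorem IsSubmanifold.isLocallyInjective [FiniteDimensional ℝ V] (hF : IsSubmanifold k F) :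
    IsLocallyInjective F := by
  intro x
  obtain ⟨ψ, hψ, hx⟩ := hF.exists_param x
  obtain ⟨χ, L, hχ, hxχ, hL⟩ := hψ.exists_graph hx
  refine ⟨χ.target, χ.open_target, hxχ, fun a ha b hb hab => ?_⟩
  have h1 := hL _ (χ.map_target ha)
  have h2 := hL _ (χ.map_target hb)
  rw [χ.right_inv ha] at h1
  rw [χ.right_inv hb] at h2
  rw [← χ.right_inv ha, ← χ.right_inv hb, ← h1, ← h2, hab]

theorem IsSubmanifold.isSeparatedMap (hF : IsSubmanifold k F) : IsSeparatedMap F :=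
  have := hF.hausdorff
  T2Space.isSeparatedMap F

end Rulings

/-! ### The flow along the rulings. -/

section RuledThreefolds

variable {N : ℕ} {X : Type*} [TopologicalSpace X] {F : X → Euc N} {v o : Euc N}

/-- The line through a point of a ruled submanifold. -/
noncomputable def IsRuledByLines.line (hr : IsRuledByLines v F) (x : X) : ℝ → X :=
  (hr x).choose

namespace IsRuledByLines

variable (hr : IsRuledByLines v F)

theorem continuous_line (x : X) : Continuous (hr.line x) := (hr x).choose_spec.1

theorem line_zero (x : X) : hr.line x 0 = x := (hr x).choose_spec.2.1

theorem map_line (x : X) (t : ℝ) : F (hr.line x t) = F x + t • v := (hr x).choose_spec.2.2 t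

theorem eq_line {k : ℕ} (hF : IsSubmanifold k F) {x : X} {d : ℝ → X} (hd : Continuous d)
    (hd0 : d 0 = x) (hFd : ∀ t, F (d t) = F x + t • v) (t : ℝ) : d t = hr.line x t :=
  congrFun (hF.isSeparatedMap.eq_of_comp_eq hF.isLocallyInjective hd (hr.continuous_line x)
    (funext fun t => by rw [Function.comp_apply, Function.comp_apply, hFd, hr.map_line]) 0
    (by rw [hd0, hr.line_zero])) t

/-- Both sides lift the same affine line from the same point, so unique lifting gives the flow
property. -/
theorem line_line {k : ℕ} (hF : IsSubmanifold k F) (x : X) (s t : ℝ) :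
    hr.line (hr.line x s) t = hr.line x (s + t) := by
  refine (hr.eq_line hF ((hr.continuous_line x).comp (continuous_const_add s)) ?_
    (fun t => ?_) t).symm
  · simp
  · simp only [Function.comp_apply, hr.map_line, add_smul, add_assoc]

theorem exists_fderiv_eq {k : ℕ} (hr : IsRuledByLines v F) {ψ : OpenPartialHomeomorph (Euc k) X}
    (hψ : IsLocalParam F ψ) {w : Euc k} (hw : w ∈ ψ.source) :
    ∃ a, fderiv ℝ (F ∘ ψ) w a = v := by
  have hF : F ∘ hr.line (ψ w) = fun t : ℝ => F (ψ w) + t • v := funext (hr.map_line _)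
  have hd : HasFDerivAt (F ∘ hr.line (ψ w)) ((ContinuousLinearMap.id ℝ ℝ).smulRight v) 0 := by
    rw [hF]
    exact ((hasFDerivAt_id (0 : ℝ)).smul_const v).const_add _
  have hz : hr.line (ψ w) 0 ∈ ψ.target := by rw [hr.line_zero]; exact ψ.map_source hw
  have h1 := hψ.fderiv_comp (hr.continuous_line (ψ w)).continuousAt hz
    (by rw [hF]; exact (contDiff_const.add (contDiff_id.smul contDiff_const)).contDiffAt)
  rw [hd.fderiv] at h1
  have h2 := congrArg (fun T : ℝ →L[ℝ] Euc N => T 1) h1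
  simp only [ContinuousLinearMap.comp_apply, ContinuousLinearMap.smulRight_apply,
    ContinuousLinearMap.id_apply, one_smul, hr.line_zero, ψ.left_inv hw] at h2
  exact ⟨_, h2.symm⟩

end IsRuledByLines

/-- A graph parametrization of a threefold whose last coordinate lines are rulings. -/
structure IsRuledParam (v : Euc N) (F : X → Euc N) (L : Euc N →L[ℝ] Euc 3)
    (ψ : OpenPartialHomeomorph (Euc 3) X) : Prop where
  param : IsLocalParam F ψ
  graph : ∀ w ∈ ψ.source, L (F (ψ w)) = w
  axis : L v = coordVec 2
  ruled : ∀ w ∈ ψ.source, fderiv ℝ (F ∘ ψ) w (coordVec 2) = v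

/-- The left inverse of the differential is rotated by a linear isomorphism so that it sends `v` to
the last basis vector. Since `v` is tangent everywhere and `L` inverts the differential of the
graph, that basis vector is the preimage of `v` at every point. -/
theorem IsRuledByLines.exists_ruledParam (hr : IsRuledByLines v F) (hF : IsSubmanifold 3 F)
    (hv : v ≠ 0) (x : X) : ∃ L ψ, IsRuledParam v F L ψ ∧ x ∈ ψ.target := by
  obtain ⟨ψ, hψ, hx⟩ := hF.exists_param x
  have hw := ψ.map_target hx
  obtain ⟨L, hL⟩ := (fderiv ℝ (F ∘ ψ) (ψ.symm x)).exists_comp_eq_id_of_injective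
    (hψ.immersive _ hw)
  obtain ⟨a, ha⟩ := hr.exists_fderiv_eq hψ hw
  have ha0 : a ≠ 0 := fun h => hv (by rw [← ha, h, map_zero])
  have he : (coordVec 2 : Euc 3) ≠ 0 := by simp [coordVec]
  obtain ⟨A, hA⟩ := SeparatingDual.exists_continuousLinearEquiv_apply_eq (R := ℝ) ha0 he
  let L' : Euc N →L[ℝ] Euc 3 := (A : Euc 3 →L[ℝ] Euc 3).comp L
  obtain ⟨χ, hχ, hxχ, hLχ⟩ := hψ.exists_graphParam hw L'
    (fun a b hab => A.injective.eq_iff.1 (by simpa [L', hL] using hab))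
  rw [ψ.right_inv hx] at hxχ
  have hax : L' v = coordVec 2 := by
    rw [← ha]; simp [L', hL, hA]
  refine ⟨L', χ, ⟨hχ, hLχ, hax, fun w hw => ?_⟩, hxχ⟩
  obtain ⟨b, hb⟩ := hr.exists_fderiv_eq hχ hw
  have h1 := graphParam_fderiv L' hLχ hw (hχ.differentiableAt hw) b
  rw [hb, hax] at h1
  rw [h1, hb]

theorem IsRuledParam.exists_ball {L : Euc N →L[ℝ] Euc 3} {ψ : OpenPartialHomeomorph (Euc 3) X}
    (h : IsRuledParam v F L ψ) (hr : IsRuledByLines v F) (hF : IsSubmanifold 3 F) {w₀ : Euc 3}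
    (hw₀ : w₀ ∈ ψ.source) : ∃ r > 0, ∀ w ∈ Metric.ball w₀ r, w ∈ ψ.source ∧
      ∀ t : ℝ, |t| < r → w + t • coordVec 2 ∈ ψ.source ∧
        hr.line (ψ w) t = ψ (w + t • coordVec 2) := by
  obtain ⟨r, hr0, hball⟩ := Metric.isOpen_iff.1 ψ.open_source w₀ hw₀
  -- Half the radius is spent on the base point and half on the translation, so the segment stays in
  -- the ball of radius `r`.
  refine ⟨r / 2, by positivity, fun w hw => ⟨hball (Metric.ball_subset_ball (by linarith) hw),
    fun t ht => ?_⟩⟩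
  have hseg : ∀ s ∈ Set.Ioo (-(r / 2)) (r / 2), w + s • (coordVec 2 : Euc 3) ∈ ψ.source := by
    intro s hs
    apply hball
    rw [Metric.mem_ball] at hw ⊢
    have h1 : dist (w + s • (coordVec 2 : Euc 3)) w = |s| := by
      rw [dist_eq_norm, add_sub_cancel_left, norm_smul]
      simp [coordVec]
    have h2 : |s| < r / 2 := abs_lt.2 hs
    linarith [dist_triangle (w + s • (coordVec 2 : Euc 3)) w w₀]
  have h0 : (0 : ℝ) ∈ Set.Ioo (-(r / 2)) (r / 2) := ⟨by linarith, by linarith⟩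
  have hder : ∀ s ∈ Set.Ioo (-(r / 2)) (r / 2),
      HasDerivAt (fun s : ℝ => F (ψ (w + s • coordVec 2)) - s • v) 0 s := by
    intro s hs
    have h1 : HasDerivAt (fun s : ℝ => w + s • (coordVec 2 : Euc 3)) (coordVec 2) s := by
      simpa using ((hasDerivAt_id s).smul_const (coordVec 2 : Euc 3)).const_add w
    have h2 := (h.param.differentiableAt (hseg s hs)).hasFDerivAt.comp_hasDerivAt s h1
    rw [h.ruled _ (hseg s hs)] at h2
    have h3 := h2.sub ((hasDerivAt_id s).smul_const v)
    rw [one_smul, sub_self] at h3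
    exact h3
  have hconst : ∀ s ∈ Set.Ioo (-(r / 2)) (r / 2),
      F (ψ (w + s • coordVec 2)) = F (ψ w) + s • v := by
    intro s hs
    have h1 := isOpen_Ioo.is_const_of_deriv_eq_zero isPreconnected_Ioo
      (fun s hs => (hder s hs).differentiableAt.differentiableWithinAt)
      (fun s hs => (hder s hs).deriv) hs h0
    simp only [zero_smul, add_zero, sub_zero] at h1
    exact sub_eq_iff_eq_add.1 h1
  -- The coordinate segment and the ruling lift the same affine segment, hence coincide by unique
  -- lifting over an interval.
  refine ⟨hseg t (abs_lt.1 ht), ?_⟩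
  refine hF.isSeparatedMap.eqOn_of_comp_eqOn hF.isLocallyInjective
    (isPreconnected_Ioo (a := -(r / 2)) (b := r / 2)) (hr.continuous_line _).continuousOn
    (g₂ := fun t => ψ (w + t • coordVec 2)) ?_ ?_ h0 ?_ (abs_lt.1 ht)
  · exact ψ.continuousOn.comp (by fun_prop) hseg
  · intro s hs
    simp only [Function.comp_apply, hr.map_line, hconst s hs]
  · simp [hr.line_zero]

namespace IsRuledByLines

variable (hr : IsRuledByLines v F)

/-- Translation along the rulings is jointly continuous. -/
theorem continuous_line_uncurry (hF : IsSubmanifold 3 F) (hv : v ≠ 0) :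
    Continuous fun q : X × ℝ => hr.line q.1 q.2 := by
  have hloc : ∀ x₀ : X, ∀ᶠ q : X × ℝ in nhds (x₀, 0),
      ContinuousAt (fun q : X × ℝ => hr.line q.1 q.2) q := by
    intro x₀
    obtain ⟨L, ψ, hψ, hx⟩ := hr.exists_ruledParam hF hv x₀
    obtain ⟨r, hr0, hb⟩ := hψ.exists_ball hr hF (ψ.map_target hx)
    have hev : ∀ᶠ q : X × ℝ in nhds (x₀, 0), q.1 ∈ ψ.target ∧
        ψ.symm q.1 ∈ Metric.ball (ψ.symm x₀) r ∧ |q.2| < r := by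
      refine (continuousAt_fst.eventually (ψ.open_target.mem_nhds hx)).and
        (Filter.Eventually.and ?_ ?_)
      · exact ((ψ.continuousAt_symm hx).comp continuousAt_fst).eventually
          (Metric.ball_mem_nhds _ hr0)
      · have : Continuous fun q : X × ℝ => |q.2| := continuous_snd.abs
        exact this.continuousAt.eventually (gt_mem_nhds (by simpa using hr0))
    filter_upwards [hev.eventually_nhds] with q hq
    have h1 : (fun q : X × ℝ => hr.line q.1 q.2) =ᶠ[nhds q]
        fun q => ψ (ψ.symm q.1 + q.2 • coordVec 2) := by
      filter_upwards [hq] with q' hq'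
      have := ((hb _ hq'.2.1).2 _ hq'.2.2).2
      rwa [ψ.right_inv hq'.1] at this
    refine ContinuousAt.congr ?_ h1.symm
    have hq0 := hq.self_of_nhds
    have hmem : ψ.symm q.1 + q.2 • (coordVec 2 : Euc 3) ∈ ψ.source :=
      ((hb _ hq0.2.1).2 _ hq0.2.2).1
    have h2 : ContinuousAt (fun q : X × ℝ => ψ.symm q.1 + q.2 • (coordVec 2 : Euc 3)) q :=
      ((ψ.continuousAt_symm hq0.1).comp continuousAt_fst).add
        (continuousAt_snd.smul continuousAt_const)
    exact ContinuousAt.comp (f := fun q : X × ℝ => ψ.symm q.1 + q.2 • (coordVec 2 : Euc 3))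
      (ψ.continuousAt hmem) h2
  rw [continuous_iff_continuousAt]
  rintro ⟨x₀, T⟩
  -- For two times close to `t₀`, the flow to the second is the flow to the first followed by a
  -- short flow near `hr.line x₀ t₀`. Short flows are continuous by `hloc`, so continuity passes
  -- from one time to the other.
  have hstep : ∀ t₀ : ℝ, ∀ᶠ q : ℝ × ℝ in nhds (t₀, t₀),
      ContinuousAt (fun q : X × ℝ => hr.line q.1 q.2) (x₀, q.1) →
        ContinuousAt (fun q : X × ℝ => hr.line q.1 q.2) (x₀, q.2) := by
    intro t₀
    have h1 : ContinuousAt (fun q : ℝ × ℝ => (hr.line x₀ q.1, q.2 - q.1)) (t₀, t₀) := by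
      refine ContinuousAt.prodMk ?_ (by fun_prop)
      exact ((hr.continuous_line x₀).comp continuous_fst).continuousAt
    have h2 := h1.eventually (by simpa using hloc (hr.line x₀ t₀))
    filter_upwards [h2] with q hq hq1
    have h3 : (fun z : X × ℝ => hr.line z.1 z.2) =
        fun z => hr.line (hr.line z.1 q.1) (z.2 - q.1) := by
      funext z
      rw [hr.line_line hF]
      congr 1
      ring
    rw [h3]
    have h4 : ContinuousAt (fun z : X × ℝ => (hr.line z.1 q.1, z.2 - q.1)) (x₀, q.2) := by
      refine ContinuousAt.prodMk ?_ (by fun_prop)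
      have h5 : ContinuousAt (fun z : X × ℝ => (z.1, q.1)) (x₀, q.2) :=
        continuousAt_fst.prodMk continuousAt_const
      exact ContinuousAt.comp (f := fun z : X × ℝ => (z.1, q.1)) hq1 h5
    exact ContinuousAt.comp (f := fun z : X × ℝ => (hr.line z.1 q.1, z.2 - q.1))
      (g := fun q : X × ℝ => hr.line q.1 q.2) hq h4
  -- Connectedness of the time axis carries continuity from time 0 to any time.
  have hind := PreconnectedSpace.induction₂'
    (fun s t => ContinuousAt (fun q : X × ℝ => hr.line q.1 q.2) (x₀, s) →
      ContinuousAt (fun q : X × ℝ => hr.line q.1 q.2) (x₀, t))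
    (fun t₀ => by
      have h1 : ContinuousAt (fun t : ℝ => (t₀, t)) t₀ := by fun_prop
      have h2 : ContinuousAt (fun t : ℝ => (t, t₀)) t₀ := by fun_prop
      exact (h1.eventually (hstep t₀)).and (h2.eventually (hstep t₀)))
    ⟨fun a b c hab hbc h => hbc (hab h)⟩ 0 T
  exact hind (hloc x₀).self_of_nhds

end IsRuledByLines

end RuledThreefolds

/-! ### Transverse sections of the rulings. -/

section Sections

variable {N : ℕ} {X : Type*} [TopologicalSpace X] {F : X → Euc N} {v o : Euc N}

theorem height_add_smul (hv : ‖v‖ = 1) (a : Euc N) (t : ℝ) :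
    height v o (a + t • v) = height v o a + t := by
  have : a + t • v - o = (a - o) + t • v := by abel
  rw [height, this, inner_add_right, inner_smul_right, real_inner_self_eq_norm_sq, hv, height]
  ring

theorem continuous_height : Continuous (height v o) :=
  continuous_const.inner (continuous_id.sub continuous_const)

theorem contDiff_height : ContDiff ℝ ∞ (height v o) :=
  contDiff_const.inner ℝ (contDiff_id.sub contDiff_const)

theorem IsSubmanifold.continuous {k : ℕ} (hF : IsSubmanifold k F) : Continuous F := by
  rw [continuous_iff_continuousAt]
  intro x
  obtain ⟨ψ, hψ, hx⟩ := hF.exists_param x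
  have h1 : F =ᶠ[nhds x] fun y => (F ∘ ψ) (ψ.symm y) := by
    filter_upwards [ψ.open_target.mem_nhds hx] with y hy
    rw [Function.comp_apply, ψ.right_inv hy]
  exact ((hψ.contDiffAt (ψ.map_target hx)).continuousAt.comp (ψ.continuousAt_symm hx)).congr h1.symm

/-- A function on a ruled threefold that is invariant along the rulings has, as the set where it
agrees with the height, a surface transverse to the rulings that meets every ruling once. -/
theorem IsRuledByLines.exists_section (hr : IsRuledByLines v F) (hF : IsSubmanifold 3 F)
    (hv : ‖v‖ = 1) (H : X → ℝ) (hinv : ∀ x t, H (hr.line x t) = H x)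
    (hsm : ∀ L ψ, IsRuledParam v F L ψ → ContDiffOn ℝ ∞ (H ∘ ψ) ψ.source) :
    ∃ p : X → {x | height v o (F x) = H x}, (∀ y : {x | height v o (F x) = H x}, p y = y) ∧
      IsSubmanifold 2 (fun y : {x | height v o (F x) = H x} => F y) ∧
      IsLineUnion v o F (fun y : {x | height v o (F x) = H x} => F y) p ∧
      ∀ x, height v o (F (p x)) = H x := by
  have hv0 : v ≠ 0 := fun h => by simp [h] at hv
  have hline := hr.continuous_line_uncurry hF hv0
  have hFc := hF.continuous
  have huc : Continuous fun x => height v o (F x) := continuous_height.comp hFc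
  have hHc : Continuous H := by
    rw [continuous_iff_continuousAt]
    intro x
    obtain ⟨L, ψ, hψ, hx⟩ := hr.exists_ruledParam hF hv0 x
    have h1 : H =ᶠ[nhds x] fun y => (H ∘ ψ) (ψ.symm y) := by
      filter_upwards [ψ.open_target.mem_nhds hx] with y hy
      rw [Function.comp_apply, ψ.right_inv hy]
    exact (((hsm L ψ hψ).continuousOn.continuousAt (ψ.open_source.mem_nhds
      (ψ.map_target hx))).comp (ψ.continuousAt_symm hx)).congr h1.symm
  have hul : ∀ x t, height v o (F (hr.line x t)) = height v o (F x) + t := fun x t => by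
    rw [hr.map_line, height_add_smul hv]
  set S : Set X := {x | height v o (F x) = H x} with hS
  -- Height grows at unit speed along a ruling while `H` is constant, so this is the unique time at
  -- which they agree.
  let q : X → X := fun x => hr.line x (H x - height v o (F x))
  have hqS : ∀ x, q x ∈ S := fun x => by
    change height v o (F (hr.line x _)) = H (hr.line x _)
    rw [hul, hinv]; ring
  have hql : ∀ x t, q (hr.line x t) = q x := fun x t => by
    change hr.line (hr.line x t) (H (hr.line x t) - _) = hr.line x _
    rw [hr.line_line hF, hinv, hul]
    congr 1; ring
  have hqs : ∀ x ∈ S, q x = x := fun x hx => by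
    have : H x - height v o (F x) = 0 := sub_eq_zero.2 (Eq.symm hx)
    change hr.line x _ = x
    rw [this, hr.line_zero]
  have hqc : Continuous q := hline.comp (continuous_id.prodMk (hHc.sub huc))
  let p : X → S := fun x => ⟨q x, hqS x⟩
  have hpc : Continuous p := hqc.subtype_mk _
  have hup : ∀ x, height v o (F (p x)) = H x := fun x => by
    change height v o (F (hr.line x _)) = H x
    rw [hul]; ring
  have hFp : ∀ x, F (p x) = F x + (H x - height v o (F x)) • v := fun x => hr.map_line x _
  let Θ : X ≃ₜ S × ℝ :=
    { toFun := fun x => (p x, height v o (F x))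
      invFun := fun y => hr.line y.1 (y.2 - height v o (F y.1))
      left_inv := fun x => by
        change hr.line (hr.line x _) (height v o (F x) - height v o (F (p x))) = x
        rw [hup, hr.line_line hF]
        ring_nf
        exact hr.line_zero x
      right_inv := fun y => by
        refine Prod.ext (Subtype.ext ?_) ?_
        · change q (hr.line y.1 _) = y.1
          rw [hql, hqs _ y.1.2]
        · change height v o (F (hr.line y.1 _)) = y.2
          rw [hul]; ring
      continuous_toFun := hpc.prodMk huc
      continuous_invFun := hline.comp ((continuous_subtype_val.comp continuous_fst).prodMk
        (continuous_snd.sub (huc.comp (continuous_subtype_val.comp continuous_fst)))) }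
  have := hF.hausdorff
  have := hF.secondCountable
  have hparam : ∀ s₀ : S, ∃ χ : OpenPartialHomeomorph (Euc 2) S,
      IsLocalParam (fun y : S => F y) χ ∧ s₀ ∈ χ.target := by
    intro s₀
    obtain ⟨L, ψ, hψ, hx⟩ := hr.exists_ruledParam hF hv0 (s₀ : X)
    set τ := cylHeight (ψ.symm s₀) with hτ
    -- A slice of a ruled chart at constant last coordinate, moved along the rulings onto `S`,
    -- parametrizes `S`. The inverse is `cylBase ∘ L ∘ F`, which is constant along rulings.
    let ζ : Euc 2 → Euc 3 := fun y => cylSplit.symm (y, τ)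
    have hζc : ContDiff ℝ ∞ ζ := cylSplit.symm.contDiff.comp (contDiff_id.prodMk contDiff_const)
    obtain ⟨-, -, b2⟩ := cylBase_coordVec
    obtain ⟨-, -, t2⟩ := cylHeight_coordVec
    have hLl : ∀ x t, cylBase (L (F (hr.line x t))) = cylBase (L (F x)) ∧
        cylHeight (L (F (hr.line x t))) = cylHeight (L (F x)) + t := fun x t => by
      rw [hr.map_line, map_add, map_smul, hψ.axis, map_add, map_smul, map_add, map_smul, b2, t2]
      simp
    have hsym : ∀ x ∈ ψ.target, L (F x) = ψ.symm x := fun x hx => by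
      have := hψ.graph _ (ψ.map_target hx)
      rwa [ψ.right_inv hx] at this
    have hfoot : ∀ s : X, hr.line s (τ - cylHeight (L (F s))) ∈ ψ.target →
        ζ (cylBase (L (F s))) = ψ.symm (hr.line s (τ - cylHeight (L (F s)))) := by
      intro s hs
      rw [← hsym _ hs]
      refine euc_three_ext ?_ ?_
      · rw [cylBase_symm, (hLl _ _).1]
      · rw [cylHeight_symm, (hLl _ _).2]; ring
    have hLp : ∀ y, ζ y ∈ ψ.source → cylBase (L (F (p (ψ (ζ y))))) = y ∧
        hr.line (p (ψ (ζ y))) (τ - cylHeight (L (F (p (ψ (ζ y)))))) = ψ (ζ y) := by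
      intro y hy
      have h1 := hLl (ψ (ζ y)) (H (ψ (ζ y)) - height v o (F (ψ (ζ y))))
      rw [hψ.graph _ hy, cylBase_symm, cylHeight_symm] at h1
      refine ⟨h1.1, ?_⟩
      change hr.line (hr.line (ψ (ζ y)) _) (τ - cylHeight (L (F (hr.line (ψ (ζ y)) _)))) = _
      rw [h1.2, hr.line_line hF]
      ring_nf
      exact hr.line_zero _
    let χ : OpenPartialHomeomorph (Euc 2) S :=
      { toFun := fun y => p (ψ (ζ y))
        invFun := fun s => cylBase (L (F s))
        source := {y | ζ y ∈ ψ.source}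
        target := {s | hr.line s (τ - cylHeight (L (F s))) ∈ ψ.target}
        map_source' := fun y hy => by
          change hr.line (p (ψ (ζ y))) _ ∈ ψ.target
          rw [(hLp y hy).2]
          exact ψ.map_source hy
        map_target' := fun s hs => by
          change ζ (cylBase (L (F s))) ∈ ψ.source
          rw [hfoot s hs]
          exact ψ.map_target hs
        left_inv' := fun y hy => (hLp y hy).1
        right_inv' := fun s hs => by
          apply Subtype.ext
          change q (ψ (ζ (cylBase (L (F s))))) = s
          rw [hfoot s hs, ψ.right_inv hs, hql, hqs _ s.2]
        open_source := ψ.open_source.preimage hζc.continuous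
        open_target := ψ.open_target.preimage (hline.comp (continuous_subtype_val.prodMk
          (continuous_const.sub (cylHeight.continuous.comp (L.continuous.comp
            (hFc.comp continuous_subtype_val))))))
        continuousOn_toFun := hpc.comp_continuousOn
          (ψ.continuousOn.comp hζc.continuous.continuousOn fun y hy => hy)
        continuousOn_invFun := (cylBase.continuous.comp (L.continuous.comp
          (hFc.comp continuous_subtype_val))).continuousOn }
    have hχs : ∀ y ∈ χ.source, ContDiffAt ℝ ∞ ((fun y : S => F y) ∘ χ) y := by
      intro y hy
      have h1 : (fun y : S => F y) ∘ χ = fun y => (F ∘ ψ) (ζ y) +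
          ((H ∘ ψ) (ζ y) - height v o ((F ∘ ψ) (ζ y))) • v := funext fun y => hFp (ψ (ζ y))
      have h2 : ContDiffAt ℝ ∞ (fun y => (F ∘ ψ) (ζ y)) y :=
        (hψ.param.contDiffAt hy).comp y hζc.contDiffAt
      have h3 : ContDiffAt ℝ ∞ (fun y => (H ∘ ψ) (ζ y)) y :=
        ((hsm L ψ hψ).contDiffAt (ψ.open_source.mem_nhds hy)).comp y hζc.contDiffAt
      rw [h1]
      exact h2.add ((h3.sub (contDiff_height.contDiffAt.comp y h2)).smul contDiffAt_const)
    refine ⟨χ, ⟨fun y hy => (hχs y hy).contDiffWithinAt, fun y hy => ?_⟩, ?_⟩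
    · have h1 := graphParam_fderiv (F := fun y : S => F y) (χ := χ) (cylBase.comp L)
        (fun y hy => (hLp y hy).1) hy ((hχs y hy).differentiableAt (by simp))
      intro a b hab
      rw [← h1 a, ← h1 b, hab]
    · change hr.line s₀ (τ - cylHeight (L (F s₀))) ∈ ψ.target
      rw [hsym _ hx, hτ, sub_self, hr.line_zero]
      exact hx
  refine ⟨p, fun y => Subtype.ext (hqs _ y.2), ⟨inferInstance, inferInstance, hparam⟩,
    ⟨?_, Θ.isHomeomorph, fun x => ⟨-(H x - height v o (F x)), ?_⟩⟩, hup⟩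
  -- If `v` were tangent, differentiating height = `H` on `S` along `v` would give 1 = 0.
  · rintro y ⟨χ, hχ, w, hw, rfl, b, hb⟩
    obtain ⟨L, ψ, hψ, hx⟩ := hr.exists_ruledParam hF hv0 (χ w : X)
    let c : Euc 2 → X := fun z => (χ z : X)
    have hc : ContinuousAt c w := continuous_subtype_val.continuousAt.comp (χ.continuousAt hw)
    have hFc' : ContDiffAt ℝ ∞ (F ∘ c) w := hχ.contDiffAt hw
    have hσ : DifferentiableAt ℝ (fun z => ψ.symm (c z)) w :=
      (hψ.param.contDiffAt_symm_comp hc hx hFc').differentiableAt (by simp)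
    have hws := ψ.map_target hx
    have h1 : fderiv ℝ (F ∘ c) w b = v := hb
    rw [hψ.param.fderiv_comp hc hx hFc'] at h1
    have h2 : fderiv ℝ (fun z => ψ.symm (c z)) w b = coordVec 2 := by
      have h3 := graphParam_fderiv L hψ.graph hws (hψ.param.differentiableAt hws)
        (fderiv ℝ (fun z => ψ.symm (c z)) w b)
      rw [← h3, ← hψ.axis]
      exact congrArg L h1
    have hHd : DifferentiableAt ℝ (H ∘ ψ) (ψ.symm (c w)) :=
      ((hsm L ψ hψ).contDiffAt (ψ.open_source.mem_nhds hws)).differentiableAt (by simp)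
    have hH2 : fderiv ℝ (H ∘ ψ) (ψ.symm (c w)) (coordVec 2) = 0 := by
      obtain ⟨r, hr0, hball⟩ := hψ.exists_ball hr hF hws
      have h3 : HasDerivAt (fun t : ℝ => ψ.symm (c w) + t • (coordVec 2 : Euc 3))
          (coordVec 2) 0 := by
        simpa using ((hasDerivAt_id (0 : ℝ)).smul_const (coordVec 2 : Euc 3)).const_add
          (ψ.symm (c w))
      have h4 : HasDerivAt (fun t : ℝ => (H ∘ ψ) (ψ.symm (c w) + t • (coordVec 2 : Euc 3)))
          (fderiv ℝ (H ∘ ψ) (ψ.symm (c w)) (coordVec 2)) 0 := by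
        have h5 : HasFDerivAt (H ∘ ψ) (fderiv ℝ (H ∘ ψ) (ψ.symm (c w)))
            (ψ.symm (c w) + (0 : ℝ) • (coordVec 2 : Euc 3)) := by
          rw [zero_smul, add_zero]; exact hHd.hasFDerivAt
        exact h5.comp_hasDerivAt (0 : ℝ) h3
      have h6 : (fun t : ℝ => (H ∘ ψ) (ψ.symm (c w) + t • (coordVec 2 : Euc 3))) =ᶠ[nhds 0]
          fun _ => H (ψ (ψ.symm (c w))) := by
        have : ∀ᶠ t : ℝ in nhds 0, |t| < r :=
          continuous_abs.continuousAt.eventually (gt_mem_nhds (by simpa using hr0))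
        filter_upwards [this] with t ht
        have h7 := ((hball _ (Metric.mem_ball_self hr0)).2 t ht).2
        rw [Function.comp_apply, ← h7, hinv]
      exact h4.unique (h6.hasDerivAt_iff.2 (hasDerivAt_const _ _))
    have hk1 : HasFDerivAt (fun z => height v o (F (c z)))
        ((innerSL ℝ v).comp (fderiv ℝ (F ∘ c) w)) w :=
      hasFDerivAt_height (hFc'.differentiableAt (by simp)).hasFDerivAt
    have hk2 : HasFDerivAt (fun z => (H ∘ ψ) (ψ.symm (c z)))
        ((fderiv ℝ (H ∘ ψ) (ψ.symm (c w))).comp (fderiv ℝ (fun z => ψ.symm (c z)) w)) w :=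
      hHd.hasFDerivAt.comp w hσ.hasFDerivAt
    have hk3 : (fun z => height v o (F (c z))) =ᶠ[nhds w] fun z => (H ∘ ψ) (ψ.symm (c z)) := by
      filter_upwards [hc.eventually (ψ.open_target.mem_nhds hx)] with z hz
      rw [Function.comp_apply, ψ.right_inv hz]
      exact (χ z).2
    have hk4 := congrArg (fun T : Euc 2 →L[ℝ] ℝ => T b) (hk1.unique (hk3.hasFDerivAt_iff.2 hk2))
    have hk5 : ⟪v, fderiv ℝ (F ∘ c) w b⟫_ℝ =
        fderiv ℝ (H ∘ ψ) (ψ.symm (c w)) (fderiv ℝ (fun z => ψ.symm (c z)) w b) := hk4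
    have h8 : fderiv ℝ (F ∘ c) w b = v := hb
    rw [h8, h2, hH2, real_inner_self_eq_norm_sq, hv] at hk5
    norm_num at hk5
  · rw [hFp, add_assoc, ← add_smul]
    simp

end Sections

/-! ### Recovering the 1-form on a ruled twisted-austere threefold. -/

section TwistedAustereCylinders

variable {N : ℕ} {X : Type*} [TopologicalSpace X] {F : X → Euc N} {v o : Euc N}
  {μ : X → (Euc N →L[ℝ] ℝ)} {θ : ℝ}

theorem HasFDerivAt.comp_hasDerivAt_clm_apply {E V : Type*} [NormedAddCommGroup E]
    [NormedSpace ℝ E] [NormedAddCommGroup V] [NormedSpace ℝ V] {α : E → (V →L[ℝ] ℝ)}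
    {α' : E →L[ℝ] V →L[ℝ] ℝ} {c : ℝ → E} {c' : E} {t : ℝ} (hα : HasFDerivAt α α' (c t))
    (hc : HasDerivAt c c' t) (b : V) : HasDerivAt (fun s => α (c s) b) (α' c' b) t := by
  have h1 : HasFDerivAt (fun z => α z b) (α'.flip b) (c t) := by
    simpa using hα.clm_apply (hasFDerivAt_const b (c t))
  exact h1.comp_hasDerivAt t hc

/-- Second derivatives of `f` are symmetric, so symmetry of `twistForm` is closedness of `α`. -/
theorem TwistedAustereAt.symm_fderiv {k : ℕ} {φ : ℝ} {f : Euc k → Euc N}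
    {α : Euc k → (Euc k →L[ℝ] ℝ)} {w : Euc k} (h : TwistedAustereAt φ f α w)
    (hf : ContDiffAt ℝ ∞ f w) (hinj : Function.Injective (fderiv ℝ f w)) (a b : Euc k) :
    fderiv ℝ α w a b = fderiv ℝ α w b a := by
  obtain ⟨L, hL⟩ := (fderiv ℝ f w).exists_comp_eq_id_of_injective hinj
  have h1 := (h ((InnerProductSpace.toDual ℝ (Euc N)).symm ((α w).comp L)) fun a => by
    simp [InnerProductSpace.toDual_symm_apply, hL]).1 a b
  rw [twistForm_apply, twistForm_apply, symm_second_fderiv hf] at h1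
  linarith

theorem IsTwistedAustere.differentiableAt {k : ℕ} (h : IsTwistedAustere k θ F μ)
    {ψ : OpenPartialHomeomorph (Euc k) X} (hψ : IsLocalParam F ψ) {w : Euc k}
    (hw : w ∈ ψ.source) : DifferentiableAt ℝ (localForm F μ ψ) w :=
  ((h.smooth ψ hψ).contDiffAt (ψ.open_source.mem_nhds hw)).differentiableAt (by simp)

/-- On a ruled twisted-austere threefold that is nowhere totally geodesic, the derivative of the
form along the rulings is determined by the phase. -/
theorem IsTwistedAustere.cos_mul_fderiv_add_sin (h : IsTwistedAustere 3 θ F μ)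
    (hd : Dense {x : X | SecondFundFormNeZeroAt 3 F x}) (hv : ‖v‖ = 1) {L : Euc N →L[ℝ] Euc 3}
    {ψ : OpenPartialHomeomorph (Euc 3) X} (hψ : IsRuledParam v F L ψ) {w : Euc 3}
    (hw : w ∈ ψ.source) : Real.cos (cophase N 3 θ) *
      fderiv ℝ (localForm F μ ψ) w (coordVec 2) (coordVec 2) + Real.sin (cophase N 3 θ) = 0 := by
  by_contra hne
  have hs := ((h.smooth ψ hψ.param).contDiffAt (ψ.open_source.mem_nhds hw)).fderiv_right
    (m := ∞) (by simp)
  have hc : ContinuousAt (fun z => Real.cos (cophase N 3 θ) *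
      fderiv ℝ (localForm F μ ψ) z (coordVec 2) (coordVec 2) + Real.sin (cophase N 3 θ)) w :=
    (continuousAt_const.mul ((hs.continuousAt.clm_apply continuousAt_const).clm_apply
      continuousAt_const)).add continuousAt_const
  have hev' : ∀ᶠ x in nhds (ψ w), Real.cos (cophase N 3 θ) *
      fderiv ℝ (localForm F μ ψ) (ψ.symm x) (coordVec 2) (coordVec 2) +
        Real.sin (cophase N 3 θ) ≠ 0 ∧ x ∈ ψ.target := by
    refine Filter.Eventually.and ?_ (ψ.open_target.mem_nhds (ψ.map_source hw))
    have h1 := ψ.continuousAt_symm (ψ.map_source hw)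
    rw [ContinuousAt, ψ.left_inv hw] at h1
    exact h1.eventually (hc.eventually_ne hne)
  -- A nonzero value would persist on a neighbourhood, which meets the dense set where
  -- `phase_of_normal` gives zero.
  obtain ⟨x, hx, hxn, hxt⟩ := ((mem_closure_iff_frequently.1 (hd (ψ w))).and_eventually hev').exists
  have hz := ψ.map_target hxt
  have hx' : SecondFundFormNeZeroAt 3 F (ψ (ψ.symm x)) := by rwa [ψ.right_inv hxt]
  obtain ⟨κ, hκ, a, b, hab⟩ := hx'.exists_normal hψ.param hz
  exact hxn ((h.twistedAustereAt hψ.param hz).phase_of_normal (hψ.param.contDiffAt hz)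
    (hψ.param.immersive _ hz) hv (by
      filter_upwards [ψ.open_source.mem_nhds hz] with z hz using hψ.ruled z hz) hκ hab)

theorem localForm_ruling {L : Euc N →L[ℝ] Euc 3} {ψ : OpenPartialHomeomorph (Euc 3) X}
    (hψ : IsRuledParam v F L ψ) {w : Euc 3} (hw : w ∈ ψ.source) :
    localForm F μ ψ w (coordVec 2) = μ (ψ w) v := by
  rw [localForm, ContinuousLinearMap.comp_apply, hψ.ruled w hw]

theorem IsTwistedAustere.contDiffOn_sectionHeight (h : IsTwistedAustere 3 θ F μ) (φ : ℝ)
    {L : Euc N →L[ℝ] Euc 3} {ψ : OpenPartialHomeomorph (Euc 3) X} (hψ : IsRuledParam v F L ψ) :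
    ContDiffOn ℝ ∞ ((fun x => Real.cos φ * μ x v + Real.sin φ * height v o (F x)) ∘ ψ)
      ψ.source := by
  have h1 : ContDiffOn ℝ ∞ (fun w => Real.cos φ * localForm F μ ψ w (coordVec 2) +
      Real.sin φ * height v o ((F ∘ ψ) w)) ψ.source :=
    (contDiffOn_const.mul ((h.smooth ψ hψ.param).clm_apply contDiffOn_const)).add
      (contDiffOn_const.mul (contDiff_height.comp_contDiffOn hψ.param.smooth))
  refine h1.congr fun w hw => ?_
  rw [localForm_ruling hψ hw]
  rfl

/-- The function `cos φ μ(v) + sin φ x⁰` is constant along the rulings. -/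
theorem IsTwistedAustere.sectionHeight_line (h : IsTwistedAustere 3 θ F μ)
    (hd : Dense {x : X | SecondFundFormNeZeroAt 3 F x}) (hv : ‖v‖ = 1)
    (hr : IsRuledByLines v F) (x : X) (t : ℝ) :
    Real.cos (cophase N 3 θ) * μ (hr.line x t) v +
      Real.sin (cophase N 3 θ) * height v o (F (hr.line x t)) =
    Real.cos (cophase N 3 θ) * μ x v + Real.sin (cophase N 3 θ) * height v o (F x) := by
  have hF := h.submanifold
  have hv0 : v ≠ 0 := fun h => by simp [h] at hv
  set φ := cophase N 3 θ with hφ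
  have hder : ∀ t₀ : ℝ, HasDerivAt (fun t => Real.cos φ * μ (hr.line x t) v +
      Real.sin φ * height v o (F (hr.line x t))) 0 t₀ := by
    intro t₀
    obtain ⟨L, ψ, hψ, hx⟩ := hr.exists_ruledParam hF hv0 (hr.line x t₀)
    have hw := ψ.map_target hx
    set w := ψ.symm (hr.line x t₀) with hwd
    obtain ⟨r, hr0, hball⟩ := hψ.exists_ball hr hF hw
    have h1 : HasDerivAt (fun t : ℝ => w + (t - t₀) • (coordVec 2 : Euc 3)) (coordVec 2) t₀ := by
      simpa using (((hasDerivAt_id t₀).sub_const t₀).smul_const (coordVec 2 : Euc 3)).const_add w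
    have h0 : w + (t₀ - t₀) • (coordVec 2 : Euc 3) = w := by simp
    have h2 : HasFDerivAt (localForm F μ ψ) (fderiv ℝ (localForm F μ ψ) w)
        (w + (t₀ - t₀) • (coordVec 2 : Euc 3)) := by
      rw [h0]; exact (h.differentiableAt hψ.param hw).hasFDerivAt
    have h3 := h2.comp_hasDerivAt_clm_apply (c := fun t : ℝ => w + (t - t₀) • (coordVec 2 : Euc 3))
      h1 (coordVec 2)
    have h4 : HasDerivAt (fun t => height v o (F (hr.line x t))) 1 t₀ := by
      have : (fun t => height v o (F (hr.line x t))) = fun t => height v o (F x) + t := by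
        funext t; rw [hr.map_line, height_add_smul hv]
      rw [this]
      exact (hasDerivAt_id t₀).const_add _
    have h5 := (h3.const_mul (Real.cos φ)).add (h4.const_mul (Real.sin φ))
    have h6 := h.cos_mul_fderiv_add_sin hd hv hψ hw
    rw [mul_one, h6] at h5
    refine h5.congr_of_eventuallyEq ?_
    have hev : ∀ᶠ t : ℝ in nhds t₀, |t - t₀| < r := by
      have : ContinuousAt (fun t : ℝ => |t - t₀|) t₀ := by fun_prop
      exact this.eventually (gt_mem_nhds (by simpa using hr0))
    filter_upwards [hev] with t ht
    obtain ⟨h7, h8⟩ := (hball w (Metric.mem_ball_self hr0)).2 (t - t₀) ht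
    have h9 : hr.line x t = ψ (w + (t - t₀) • coordVec 2) := by
      rw [← h8, hwd, ψ.right_inv hx, hr.line_line hF, add_sub_cancel]
    rw [Pi.add_apply, localForm_ruling hψ h7, ← h9]
  have h1 := is_const_of_deriv_eq_zero (fun t => (hder t).differentiableAt)
    (fun t => (hder t).deriv) t 0
  simpa only [hr.line_zero] using h1

variable {Y : Type*} [TopologicalSpace Y] {G : Y → Euc N} {p : X → Y} {ι : Y → X}
  {χ : OpenPartialHomeomorph (Euc 2) Y}

/-- The form on the base surface of a twisted-austere cylinder with section `ι`. -/
noncomputable def baseForm (φ : ℝ) (v o : Euc N) (F : X → Euc N) (μ : X → (Euc N →L[ℝ] ℝ))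
    (ι : Y → X) (y : Y) : Euc N →L[ℝ] ℝ :=
  -- On the section u = k, so sec φ d(uk) - tan φ u du restricts to (2 sec φ - tan φ) k dk; what is
  -- left of μ is λ.
  μ (ι y) - ((2 / Real.cos φ - Real.tan φ) * height v o (F (ι y))) • innerSL ℝ v

theorem IsLineUnion.fderiv_cylParam (hU : IsLineUnion v o F G p) (hv : ‖v‖ = 1)
    (hχ : IsLocalParam G χ) {z : Euc 3} (hz : cylBase z ∈ χ.source) (b : Euc 3) :
    fderiv ℝ (F ∘ hU.cylParam χ) z b = fderiv ℝ (G ∘ χ) (cylBase z) (cylBase b) +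
      (cylHeight b - ⟪v, fderiv ℝ (G ∘ χ) (cylBase z) (cylBase b)⟫_ℝ) • v := by
  rw [hU.comp_cylParam hv, (hasFDerivAt_cylMap (hχ.differentiableAt hz)).fderiv]
  rfl

/-- Divide `hH` by cos φ: the section was chosen so that the ruling component of μ is the one in
`cylForm`. -/
theorem IsLineUnion.localForm_cylParam_ruling (hU : IsLineUnion v o F G p) (hv : ‖v‖ = 1)
    {φ : ℝ} (hφ : Real.cos φ ≠ 0)
    (hH : ∀ x, Real.cos φ * μ x v + Real.sin φ * height v o (F x) = height v o (G (p x)))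
    (hχ : IsLocalParam G χ) {z : Euc 3} (hz : cylBase z ∈ χ.source) :
    localForm F μ (hU.cylParam χ) z (coordVec 2) =
      1 / Real.cos φ * height v o ((G ∘ χ) (cylBase z)) - Real.tan φ * cylHeight z := by
  have h1 := hH (hU.cylParam χ z)
  rw [hU.height_cylParam, hU.proj_cylParam] at h1
  rw [localForm, ContinuousLinearMap.comp_apply, hU.fderiv_cylParam hv hχ hz,
    cylBase_coordVec.2.2, cylHeight_coordVec.2.2, map_zero, inner_zero_right, zero_add, sub_zero,
    one_smul, Function.comp_apply, ← h1, Real.tan_eq_sin_div_cos]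
  field_simp
  ring

theorem IsLineUnion.cylParam_section (hU : IsLineUnion v o F G p) (hι : ∀ y, p (ι y) = y)
    (hG : ∀ y, G y = F (ι y)) (y : Euc 2) :
    hU.cylParam χ (cylSplit.symm (y, height v o (G (χ y)))) = ι (χ y) := by
  apply hU.homeomorph.injective
  refine (hU.pair_cylParam _).trans ?_
  change _ = (p (ι (χ y)), height v o (F (ι (χ y))))
  rw [cylBase_symm, cylHeight_symm, hι, hG]

/-- A surface vector a reads (a, dk(a)) in cylinder coordinates. Replacing it by (a, 0) removes μ(v)
dk(a) = (sec φ - tan φ) k dk(a), so sec φ k dk(a) remains of the correction in `baseForm`. -/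
theorem IsLineUnion.localForm_baseForm (hU : IsLineUnion v o F G p) (hv : ‖v‖ = 1)
    {φ : ℝ} (hφ : Real.cos φ ≠ 0)
    (hH : ∀ x, Real.cos φ * μ x v + Real.sin φ * height v o (F x) = height v o (G (p x)))
    (hι : ∀ y, p (ι y) = y) (hG : ∀ y, G y = F (ι y)) (hχ : IsLocalParam G χ) {y : Euc 2}
    (hy : y ∈ χ.source) (a : Euc 2) :
    localForm G (baseForm φ v o F μ ι) χ y a =
      localForm F μ (hU.cylParam χ) (cylSplit.symm (y, height v o (G (χ y))))
        (cylSplit.symm (a, 0)) -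
      1 / Real.cos φ * (height v o (G (χ y)) * ⟪v, fderiv ℝ (G ∘ χ) y a⟫_ℝ) := by
  have h1 := hH (ι (χ y))
  rw [hι, ← hG] at h1
  have h2 : μ (ι (χ y)) v = (1 - Real.sin φ) / Real.cos φ * height v o (G (χ y)) := by
    field_simp
    linear_combination h1
  rw [localForm, localForm, ContinuousLinearMap.comp_apply, ContinuousLinearMap.comp_apply,
    hU.fderiv_cylParam hv hχ (by rwa [cylBase_symm]), hU.cylParam_section hι hG, cylBase_symm,
    cylBase_symm, cylHeight_symm, map_add, map_smul, h2, baseForm, ← hG, Real.tan_eq_sin_div_cos]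
  simp only [sub_apply, smul_apply, innerSL_apply_apply, smul_eq_mul]
  field_simp
  ring

/-- Closedness exchanges derivatives: the u-derivative of α(a) is the a-derivative of the ruling
component, namely sec φ dk(a). So α(a) is affine in u along each ruling, and its value on the
section, given by `localForm_baseForm`, fixes it. -/
theorem IsTwistedAustere.localForm_cylParam (h : IsTwistedAustere 3 θ F μ)
    (hU : IsLineUnion v o F G p) (hv : ‖v‖ = 1) (hφ : Real.cos (cophase N 3 θ) ≠ 0)
    (hH : ∀ x, Real.cos (cophase N 3 θ) * μ x v + Real.sin (cophase N 3 θ) * height v o (F x) =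
      height v o (G (p x)))
    (hι : ∀ y, p (ι y) = y) (hG : ∀ y, G y = F (ι y)) (hχ : IsLocalParam G χ) {z : Euc 3}
    (hz : z ∈ (hU.cylParam χ).source) : localForm F μ (hU.cylParam χ) z =
      cylForm (cophase N 3 θ) v o (G ∘ χ) (localForm G (baseForm (cophase N 3 θ) v o F μ ι) χ)
        z := by
  set φ := cophase N 3 θ with hφd
  set ψ := hU.cylParam χ with hψd
  have hψ : IsLocalParam F ψ := hU.isLocalParam_cylParam hv hχ
  have hzs := hU.mem_cylParam_source.1 hz
  set y := cylBase z with hyd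
  set α := localForm F μ ψ with hα
  have hsplit : ∀ b : Euc 3, b = cylSplit.symm (cylBase b, 0) + cylHeight b • coordVec 2 := by
    intro b
    refine euc_three_ext ?_ ?_
    · rw [map_add, map_smul, cylBase_symm, cylBase_coordVec.2.2, smul_zero, add_zero]
    · rw [map_add, map_smul, cylHeight_symm, cylHeight_coordVec.2.2, zero_add, smul_eq_mul, mul_one]
  have hsrc : ∀ t : ℝ, cylSplit.symm (y, t) ∈ ψ.source := fun t =>
    hU.mem_cylParam_source.2 (by rwa [cylBase_symm])
  have hmixed : ∀ w ∈ ψ.source, cylBase w = y → ∀ a : Euc 2,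
      fderiv ℝ α w (coordVec 2) (cylSplit.symm (a, 0)) =
        1 / Real.cos φ * ⟪v, fderiv ℝ (G ∘ χ) y a⟫_ℝ := by
    intro w hw hwy a
    rw [(h.twistedAustereAt hψ hw).symm_fderiv (hψ.contDiffAt hw) (hψ.immersive _ hw)]
    have h1 := (h.differentiableAt hψ hw).hasFDerivAt.clm_apply
      (hasFDerivAt_const (coordVec 2 : Euc 3) w)
    have hg : HasFDerivAt (fun z => (G ∘ χ) (cylBase z))
        ((fderiv ℝ (G ∘ χ) (cylBase w)).comp cylBase) w :=
      (hχ.differentiableAt (hU.mem_cylParam_source.1 hw)).hasFDerivAt.comp w cylBase.hasFDerivAt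
    have h2 := ((hasFDerivAt_height (v := v) (o := o) hg).const_mul (1 / Real.cos φ)).sub
      (cylHeight.hasFDerivAt.const_mul (Real.tan φ))
    have h3 : (fun w => α w (coordVec 2)) =ᶠ[nhds w] fun z =>
        1 / Real.cos φ * height v o ((G ∘ χ) (cylBase z)) - Real.tan φ * cylHeight z := by
      filter_upwards [ψ.open_source.mem_nhds hw] with z hz
      exact hU.localForm_cylParam_ruling hv hφ hH hχ (hU.mem_cylParam_source.1 hz)
    have h4 := congrArg (fun T : Euc 3 →L[ℝ] ℝ => T (cylSplit.symm (a, 0)))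
      (h1.unique (h3.hasFDerivAt_iff.2 h2))
    simpa [cylBase_symm, cylHeight_symm, hwy] using h4
  have hline : ∀ (a : Euc 2) (t s : ℝ), α (cylSplit.symm (y, t)) (cylSplit.symm (a, 0)) -
      t * (1 / Real.cos φ * ⟪v, fderiv ℝ (G ∘ χ) y a⟫_ℝ) =
      α (cylSplit.symm (y, s)) (cylSplit.symm (a, 0)) -
      s * (1 / Real.cos φ * ⟪v, fderiv ℝ (G ∘ χ) y a⟫_ℝ) := by
    intro a
    have hder : ∀ t : ℝ, HasDerivAt (fun t => α (cylSplit.symm (y, t)) (cylSplit.symm (a, 0)) -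
        t * (1 / Real.cos φ * ⟪v, fderiv ℝ (G ∘ χ) y a⟫_ℝ)) 0 t := by
      intro t
      have h1 : HasDerivAt (fun t : ℝ => (cylSplit.symm (y, t) : Euc 3)) (coordVec 2) t := by
        have h2 : (fun t : ℝ => (cylSplit.symm (y, t) : Euc 3)) = fun t =>
            cylSplit.symm (y, 0) + t • coordVec 2 := by
          funext t
          have := hsplit (cylSplit.symm (y, t))
          rwa [cylBase_symm, cylHeight_symm] at this
        rw [h2]
        simpa using ((hasDerivAt_id t).smul_const (coordVec 2 : Euc 3)).const_add
          (cylSplit.symm (y, 0))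
      have h3 := ((h.differentiableAt hψ (hsrc t)).hasFDerivAt.comp_hasDerivAt_clm_apply h1
        (cylSplit.symm (a, 0))).sub
          ((hasDerivAt_id t).mul_const (1 / Real.cos φ * ⟪v, fderiv ℝ (G ∘ χ) y a⟫_ℝ))
      rw [hmixed _ (hsrc t) (cylBase_symm y t), one_mul, sub_self] at h3
      exact h3
    exact is_const_of_deriv_eq_zero (fun t => (hder t).differentiableAt) fun t => (hder t).deriv
  have hzeq : z = cylSplit.symm (y, cylHeight z) :=
    euc_three_ext (by rw [cylBase_symm]) (by rw [cylHeight_symm])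
  ext b
  have h1 : α z (cylSplit.symm (cylBase b, 0)) =
      localForm G (baseForm φ v o F μ ι) χ y (cylBase b) +
        1 / Real.cos φ * (cylHeight z * ⟪v, fderiv ℝ (G ∘ χ) y (cylBase b)⟫_ℝ) := by
    have h2 := hline (cylBase b) (cylHeight z) (height v o (G (χ y)))
    rw [← hzeq] at h2
    rw [hU.localForm_baseForm hv hφ hH hι hG hχ hzs]
    linear_combination h2
  have h2 : α z b = α z (cylSplit.symm (cylBase b, 0)) + cylHeight b * α z (coordVec 2) := by
    conv_lhs => rw [hsplit b]
    rw [map_add, map_smul, smul_eq_mul]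
  rw [h2, h1, hα, hU.localForm_cylParam_ruling hv hφ hH hχ hzs]
  change _ = localForm G (baseForm φ v o F μ ι) χ y (cylBase b) + 1 / Real.cos φ *
    (cylHeight z * ⟪v, fderiv ℝ (G ∘ χ) y (cylBase b)⟫_ℝ + height v o ((G ∘ χ) y) * cylHeight b) -
      Real.tan φ * cylHeight z * cylHeight b
  ring

theorem IsTwistedAustere.isSmoothForm_baseForm (h : IsTwistedAustere 3 θ F μ)
    (hU : IsLineUnion v o F G p) (hv : ‖v‖ = 1) {φ : ℝ} (hφ : Real.cos φ ≠ 0)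
    (hH : ∀ x, Real.cos φ * μ x v + Real.sin φ * height v o (F x) = height v o (G (p x)))
    (hι : ∀ y, p (ι y) = y) (hG : ∀ y, G y = F (ι y)) :
    IsSmoothForm 2 G (baseForm φ v o F μ ι) := by
  intro χ hχ
  have hk : ContDiffOn ℝ ∞ (fun y => height v o (G (χ y))) χ.source :=
    contDiff_height.comp_contDiffOn hχ.smooth
  have hζ : ContDiffOn ℝ ∞ (fun y => (cylSplit.symm (y, height v o (G (χ y))) : Euc 3))
      χ.source := cylSplit.symm.contDiff.comp_contDiffOn (contDiffOn_id.prodMk hk)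
  have hα := (h.smooth _ (hU.isLocalParam_cylParam hv hχ)).comp hζ fun y hy =>
    hU.mem_cylParam_source.2 (by rwa [cylBase_symm])
  have hdg : ContDiffOn ℝ ∞ (fderiv ℝ (G ∘ χ)) χ.source := fun y hy =>
    (hχ.contDiffAt_fderiv hy).contDiffWithinAt
  let J : Euc 2 →L[ℝ] Euc 3 := (cylSplit.symm : Euc 2 × ℝ →L[ℝ] Euc 3).comp
    (ContinuousLinearMap.inl ℝ (Euc 2) ℝ)
  have h1 : ContDiffOn ℝ ∞ (fun y => (localForm F μ (hU.cylParam χ)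
      (cylSplit.symm (y, height v o (G (χ y))))).comp J -
        (1 / Real.cos φ * height v o (G (χ y))) • (innerSL ℝ v).comp (fderiv ℝ (G ∘ χ) y))
      χ.source :=
    (hα.clm_comp contDiffOn_const).sub
      ((contDiffOn_const.mul hk).smul (contDiffOn_const.clm_comp hdg))
  refine h1.congr fun y hy => ?_
  ext a
  rw [hU.localForm_baseForm hv hφ hH hι hG hχ hy]
  simp only [sub_apply, smul_apply, ContinuousLinearMap.comp_apply, innerSL_apply_apply,
    smul_eq_mul, mul_assoc]
  rfl

end TwistedAustereCylinders

/-! ### Nonvanishing of cos φ and the final assembly. -/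

/-- If cos φ = 0, then cos φ ∂_v μ(v) + sin φ = 0 at a single point also gives sin φ = 0. -/
theorem IsTwistedAustere.cos_cophase_ne_zero {N : ℕ} {X : Type*} [TopologicalSpace X]
    [Nonempty X] {F : X → Euc N} {v : Euc N} {μ : X → (Euc N →L[ℝ] ℝ)} {θ : ℝ}
    (h : IsTwistedAustere 3 θ F μ) (hd : Dense {x : X | SecondFundFormNeZeroAt 3 F x})
    (hr : IsRuledByLines v F) (hv : ‖v‖ = 1) : Real.cos (cophase N 3 θ) ≠ 0 := by
  intro hc
  have hv0 : v ≠ 0 := fun h => by simp [h] at hv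
  obtain ⟨L, ψ, hψ, hx⟩ := hr.exists_ruledParam h.submanifold hv0 (Classical.arbitrary X)
  have h1 := h.cos_mul_fderiv_add_sin hd hv hψ (ψ.map_target hx)
  rw [hc, zero_mul, zero_add] at h1
  have h2 := Real.sin_sq_add_cos_sq (cophase N 3 θ)
  rw [h1, hc] at h2
  norm_num at h2

theorem theorem4p2 (n : ℕ) (θ : ℝ) (v o : Euc (n + 1)) (hv : ‖v‖ = 1) :
    (∀ (X : Type*) [TopologicalSpace X] [Nonempty X] (F : X → Euc (n + 1))
        (μ : X → (Euc (n + 1) →L[ℝ] ℝ)),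
      IsTwistedAustere 3 θ F μ →
      Dense {x : X | SecondFundFormNeZeroAt 3 F x} →
      IsRuledByLines v F →
      Real.cos (cophase (n + 1) 3 θ) ≠ 0 ∧
      ∃ (S : Set X) (p : X → S) (lam : S → (Euc (n + 1) →L[ℝ] ℝ)),
        (∀ y : S, p y = y) ∧
        IsMinimalSubmanifold 2 (fun y : S => F y) ∧
        IsLineUnion v o F (fun y : S => F y) p ∧
        IsAdmissibleForm (cophase (n + 1) 3 θ) v o (fun y : S => F y) lam ∧
        IsCylinderForm (cophase (n + 1) 3 θ) v o F (fun y : S => F y) p lam μ) ∧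
    (∀ (Y : Type*) [TopologicalSpace Y] (G : Y → Euc (n + 1)) (lam : Y → (Euc (n + 1) →L[ℝ] ℝ))
        (X : Type*) [TopologicalSpace X] (F : X → Euc (n + 1)) (p : X → Y)
        (μ : X → (Euc (n + 1) →L[ℝ] ℝ)),
      Real.cos (cophase (n + 1) 3 θ) ≠ 0 →
      IsMinimalSubmanifold 2 G →
      IsAdmissibleForm (cophase (n + 1) 3 θ) v o G lam →
      IsLineUnion v o F G p →
      IsCylinderForm (cophase (n + 1) 3 θ) v o F G p lam μ →
      IsTwistedAustere 3 θ F μ) := by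
  constructor
  · intro X _ _ F μ h hd hr
    have hφ := h.cos_cophase_ne_zero hd hr hv
    -- The invariant function left implicit is cos φ μ(v) + sin φ x⁰, read off from
    -- `sectionHeight_line`.
    obtain ⟨p, hp, hG, hU, hH⟩ := hr.exists_section h.submanifold hv (o := o) _
      (h.sectionHeight_line hd hv hr) fun L ψ hψ => h.contDiffOn_sectionHeight _ hψ
    have hform := fun χ hχ z => h.localForm_cylParam (χ := χ) (z := z) hU hv hφ
      (fun x => (hH x).symm) hp (fun _ => rfl) hχ
    obtain ⟨hmin, hadm⟩ := isMinimal_and_isAdmissible_of_cylParam hv hφ hG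
      (h.isSmoothForm_baseForm hU hv hφ (fun x => (hH x).symm) hp fun _ => rfl) hU h hform
    exact ⟨hφ, _, p, _, hp, hmin, hU, hadm, isCylinderForm_of_cylParam hv hG hU hform⟩
  · intro Y _ G lam X _ F p μ hφ hG hl hU hμ
    exact isTwistedAustere_of_isCylinderForm hv hφ hG hl hU hμ
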